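/- Let $(M^m,g_M)$ be a compact Riemannian manifold (without boundary) with negative Ricci curvature, i.e. $\mathrm{Ric}^M(v,v)<0$ for every nonzero tangent vector $v$. Let $(N^n,g_N)$ be a nonempty Riemannian manifold of dimension $n\ge 1$, let $\lambda: M\to\mathbb R$ be a smooth function, and consider the projection of the warped product onto its first factor, $$\phi:(M\times N,\ g_M+e^{2\lambda}g_N)\longrightarrow (M,g_M),\qquad \phi(x,y)=x .$$ Then $\phi$ is biharmonic if and only if it is harmonic. Moreover, if $M$ is connected, $\phi$ is harmonic if and only if $\lambda$ is constant. Here manifolds, metrics and maps are smooth, manifolds are Hausdorff and second countable, and $\tau(\phi)=\mathrm{Trace}_g\nabla \mathrm d\phi$ denotes the tension field of a map $\phi:(P,g)\to(Q,h)$. The map $\phi$ is harmonic if $\tau(\phi)=0$. It is biharmonic if for every compact $\Omega\subset P$ it is a critical point of the bienergy $E_2(\phi,\Omega)=\frac12\int_\Omega|\tau(\phi)|^2\,\mathrm dv_g$, that is, $\frac{d}{dt}\big|_{t=0}E_2(\phi_t,\Omega)=0$ for every smooth variation $(\phi_t)_{t\in\mathbb R}$ of $\phi_0=\phi$ with $\phi_t=\phi$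 outside $\Omega$. -/

import Mathlib

open scoped Manifold ContDiff
open MeasureTheory

noncomputable section

namespace RiemGeom

section Metric

variable {E : Type*} [NormedAddCommGroup E] [NormedSpace ℝ E]
  {H : Type*} [TopologicalSpace H] (I : ModelWithCorners ℝ E H)
  (M : Type*) [TopologicalSpace M] [ChartedSpace H M]

/-- Smooth Riemannian metrics on the manifold `M`. -/
abbrev Metric [IsManifold I ∞ M] : Type _ :=
  Bundle.ContMDiffRiemannianMetric I ∞ E (fun x : M => TangentSpace I x)

end Metric

section Local

variable {E : Type*} [NormedAddCommGroup E] [NormedSpace ℝ E]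
  {H : Type*} [TopologicalSpace H] {I : ModelWithCorners ℝ E H}
  {M : Type*} [TopologicalSpace M] [ChartedSpace H M] [IsManifold I ∞ M]

/-- The metric `g` in the preferred chart at `p`: a bilinear form on the model space `E`
depending on the point `u` of the chart image. -/
def chartMetric (g : Metric I M) (p : M) (u : E) : E →L[ℝ] E →L[ℝ] ℝ :=
  let x : M := (extChartAt I p).symm u
  let A : E →L[ℝ] TangentSpace I x :=
    mfderivWithin 𝓘(ℝ, E) I (extChartAt I p).symm (Set.range I) u
  (A.precomp ℝ) ∘L (g.inner x) ∘L A

/-- The Christoffel symbols in the preferred chart at `p`: `Γ(v, w)` is the vector such that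
`2 ⟨Γ(v, w), z⟩ = (D_v g)(w, z) + (D_w g)(v, z) - (D_z g)(v, w)` for all `z`. -/
def christoffel (g : Metric I M) (p : M) (u v w : E) : E :=
  let D : E →L[ℝ] E →L[ℝ] E →L[ℝ] ℝ := fderiv ℝ (chartMetric g p) u
  (chartMetric g p u).inverse ((1 / 2 : ℝ) • (D v w + D w v - (D.flip v).flip w))

/-- The curvature `R(v, w) z = ∇_v ∇_w z - ∇_w ∇_v z` of constant vector fields in the preferred
chart at `p`. -/
def chartCurvature (g : Metric I M) (p : M) (u v w z : E) : E :=
  fderiv ℝ (fun u' => christoffel g p u' w z) u v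
    - fderiv ℝ (fun u' => christoffel g p u' v z) u w
    + christoffel g p u v (christoffel g p u w z)
    - christoffel g p u w (christoffel g p u v z)

variable [FiniteDimensional ℝ E]

/-- The Ricci tensor `Ric(v, w) = trace (x ↦ R(x, v) w)` at `p`. The tangent space at `p` is
identified with the model space through the preferred chart at `p`. -/
def ricci (g : Metric I M) (p : M) (v w : TangentSpace I p) : ℝ :=
  let b := Module.finBasis ℝ E
  ∑ i, b.coord i (chartCurvature g p (extChartAt I p p) (b i) v w)

variable [MeasurableSpace E] [BorelSpace E]

/-- The Riemannian volume measure. In each preferred chart it has the density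
`√ det (g (b i, b j))` with respect to the Lebesgue measure that gives the parallelepiped of the
basis `b` volume one; these measures agree on overlaps and the volume is their supremum. -/
def riemannianVolume [MeasurableSpace M] (g : Metric I M) : Measure M :=
  let b := Module.finBasis ℝ E
  ⨆ p : M, Measure.map (extChartAt I p).symm
    ((b.addHaar.restrict (extChartAt I p).target).withDensity fun u =>
      ENNReal.ofReal (√(Matrix.det (Matrix.of fun i j => chartMetric g p u (b i) (b j)))))

end Local

section Maps

variable {E : Type*} [NormedAddCommGroup E] [NormedSpace ℝ E] [FiniteDimensional ℝ E]
  {H : Type*} [TopologicalSpace H] {I : ModelWithCorners ℝ E H}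
  {M : Type*} [TopologicalSpace M] [ChartedSpace H M] [IsManifold I ∞ M]
  {E' : Type*} [NormedAddCommGroup E'] [NormedSpace ℝ E']
  {H' : Type*} [TopologicalSpace H'] {J : ModelWithCorners ℝ E' H'}
  {N : Type*} [TopologicalSpace N] [ChartedSpace H' N] [IsManifold J ∞ N]

/-- The second fundamental form `∇dφ` of `φ : (M, g) → (N, h)` at `p`, in the preferred charts at
`p` and `φ p`. -/
def secondFundamentalForm (g : Metric I M) (h : Metric J N) (φ : M → N) (p : M) (v w : E) : E' :=
  let u : E := extChartAt I p p
  let ψ : E → E' := fun u' => extChartAt J (φ p) (φ ((extChartAt I p).symm u'))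
  fderiv ℝ (fderiv ℝ ψ) u v w - fderiv ℝ ψ u (christoffel g p u v w)
    + christoffel h (φ p) (ψ u) (fderiv ℝ ψ u v) (fderiv ℝ ψ u w)

/-- The tension field `τ(φ) = Trace_g ∇dφ`, the trace being `∑ i, (∇dφ) (b i, (b^i)^♯)` for a basis
`b` with dual basis `b^i`. -/
def tension (g : Metric I M) (h : Metric J N) (φ : M → N) (p : M) : TangentSpace J (φ p) :=
  let b := Module.finBasis ℝ E
  let τ : E' := ∑ i, secondFundamentalForm g h φ p (b i)
    ((chartMetric g p (extChartAt I p p)).inverse (LinearMap.toContinuousLinearMap (b.coord i)))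
  τ

/-- `φ` is harmonic: it is smooth and its tension field vanishes. -/
def IsHarmonic (g : Metric I M) (h : Metric J N) (φ : M → N) : Prop :=
  ContMDiff I J ∞ φ ∧ ∀ p, tension g h φ p = 0

variable [MeasurableSpace E] [BorelSpace E] [MeasurableSpace M]

/-- The bienergy `E₂(φ, Ω) = 1/2 ∫_Ω |τ(φ)|² dv_g`. -/
def bienergy (g : Metric I M) (h : Metric J N) (φ : M → N) (Ω : Set M) : ℝ :=
  1 / 2 * ∫ p in Ω, h.inner (φ p) (tension g h φ p) (tension g h φ p) ∂(riemannianVolume g)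

/-- A smooth one-parameter variation of `φ` which is fixed outside `Ω`. -/
structure IsVariation (I : ModelWithCorners ℝ E H) (J : ModelWithCorners ℝ E' H')
    (φ : M → N) (Ω : Set M) (Φ : ℝ → M → N) : Prop where
  smooth : ContMDiff (𝓘(ℝ, ℝ).prod I) J ∞ (Function.uncurry Φ)
  zero : Φ 0 = φ
  fixed : ∀ t, ∀ p ∉ Ω, Φ t p = φ p

/-- `φ` is biharmonic: it is smooth and, for every compact `Ω`, it is a critical point of the
bienergy on `Ω` with respect to the smooth variations that are fixed outside `Ω`. -/
def IsBiharmonic (g : Metric I M) (h : Metric J N) (φ : M → N) : Prop :=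
  ContMDiff I J ∞ φ ∧ ∀ Ω : Set M, IsCompact Ω → ∀ Φ : ℝ → M → N, IsVariation I J φ Ω Φ →
    HasDerivAt (fun t => bienergy g h (Φ t) Ω) 0 0

end Maps

section Warped

variable {E : Type*} [NormedAddCommGroup E] [NormedSpace ℝ E]
  {H : Type*} [TopologicalSpace H] {I : ModelWithCorners ℝ E H}
  {M : Type*} [TopologicalSpace M] [ChartedSpace H M]
  {E' : Type*} [NormedAddCommGroup E'] [NormedSpace ℝ E']
  {H' : Type*} [TopologicalSpace H'] {J : ModelWithCorners ℝ E' H'}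
  {N : Type*} [TopologicalSpace N] [ChartedSpace H' N]

theorem diff_coord [IsManifold I ∞ M] (x₀ x : M) (h : x ∈ (chartAt H x₀).source) :
    DifferentiableWithinAt ℝ (extChartAt I x ∘ (extChartAt I x₀).symm) (Set.range I)
      (extChartAt I x₀ x) := by
  have := contDiffWithinAt_ext_coord_change (I := I) (n := ∞) x x₀ (y := extChartAt I x₀ x) (by
    rw [ext_coord_change_source]
    exact ⟨_, ⟨(chartAt H x₀).map_source h, by simp [h]⟩, by simp⟩)
  exact this.differentiableWithinAt (by simp)

theorem symm_prod [IsManifold I ∞ M] [IsManifold J ∞ N]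
    (z₀ z : M × N) (h1 : z.1 ∈ (chartAt H z₀.1).source)
    (h2 : z.2 ∈ (chartAt H' z₀.2).source) :
    ((trivializationAt (E × E') (TangentSpace (I.prod J)) z₀).symmL ℝ z :
        (E × E') →L[ℝ] E × E') =
      ContinuousLinearMap.prodMap
        ((trivializationAt E (TangentSpace I) z₀.1).symmL ℝ z.1 : E →L[ℝ] E)
        ((trivializationAt E' (TangentSpace J) z₀.2).symmL ℝ z.2 : E' →L[ℝ] E') := by
  have h : z ∈ (chartAt (ModelProd H H') z₀).source := by
    simp only [prodChartedSpace_chartAt, mfld_simps]; exact ⟨h1, h2⟩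
  rw [TangentBundle.symmL_trivializationAt_eq_core (I := I.prod J) h,
    TangentBundle.symmL_trivializationAt_eq_core (I := I) h1,
    TangentBundle.symmL_trivializationAt_eq_core (I := J) h2]
  rw [tangentBundleCore_coordChange_achart, tangentBundleCore_coordChange_achart,
    tangentBundleCore_coordChange_achart]
  have d1 := (diff_coord (I := I) z₀.1 z.1 h1).hasFDerivWithinAt
  have d2 := (diff_coord (I := J) z₀.2 z.2 h2).hasFDerivWithinAt
  have key := HasFDerivWithinAt.prodMap (s := Set.range I ×ˢ Set.range J)
    (p := (extChartAt I z₀.1 z.1, extChartAt J z₀.2 z.2))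
    (d1.mono (by rintro _ ⟨a, ha, rfl⟩; exact ha.1))
    (d2.mono (by rintro _ ⟨a, ha, rfl⟩; exact ha.2))
  have hr : Set.range (I.prod J) = Set.range I ×ˢ Set.range J := ModelWithCorners.range_prod
  rw [hr]
  refine HasFDerivWithinAt.fderivWithin ?_ ?_
  · rw [extChartAt_prod, extChartAt_prod]; exact key
  · rw [← hr]
    exact (I.prod J).uniqueDiffOn _ ⟨_, rfl⟩

/-- The warped product inner product `g_M + e^{2l} g_N` on `T_{(x, y)} (M × N) = T_x M × T_y N`. -/
def warpedInner [IsManifold I ∞ M] [IsManifold J ∞ N] (gM : Metric I M) (gN : Metric J N)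
    (l : M → ℝ) (z : M × N) :
    TangentSpace (I.prod J) z →L[ℝ] TangentSpace (I.prod J) z →L[ℝ] ℝ :=
  let p₁ : TangentSpace (I.prod J) z →L[ℝ] TangentSpace I z.1 := ContinuousLinearMap.fst ℝ E E'
  let p₂ : TangentSpace (I.prod J) z →L[ℝ] TangentSpace J z.2 := ContinuousLinearMap.snd ℝ E E'
  (p₁.precomp ℝ) ∘L gM.inner z.1 ∘L p₁ +
    Real.exp (2 * l z.1) • ((p₂.precomp ℝ) ∘L gN.inner z.2 ∘L p₂)

theorem warped_apply [IsManifold I ∞ M] [IsManifold J ∞ N] (gM : Metric I M) (gN : Metric J N)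
    (l : M → ℝ) (z : M × N) (v w : TangentSpace (I.prod J) z) :
   warpedInner gM gN l z v w = gM.inner z.1 (v : E × E').1 (w : E × E').1 +
     Real.exp (2 * l z.1) * gN.inner z.2 (v : E × E').2 (w : E × E').2 := rfl

theorem coord_smooth [IsManifold I ∞ M] (g : Metric I M) (x₀ : M) :
    ContMDiffAt I 𝓘(ℝ, E →L[ℝ] E →L[ℝ] ℝ) ∞ (fun x => ContinuousLinearMap.inCoordinates E (TangentSpace I)
     (E →L[ℝ] ℝ) (fun x : M => TangentSpace I x →L[ℝ] ℝ) x₀ x x₀ x (g.inner x)) x₀ := 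
  ((contMDiffAt_hom_bundle _).1 (g.contMDiff x₀)).2

theorem triv_line {B : Type*} [TopologicalSpace B] (b x : B) (r : ℝ) :
    (trivializationAt ℝ (Bundle.Trivial B ℝ) b).linearMapAt ℝ x r = r := by
  change ((Bundle.Trivial.trivialization B ℝ).linearMapAt ℝ x) r = r
  simp

theorem smooth_warped [IsManifold I ∞ M] [IsManifold J ∞ N] (gM : Metric I M) (gN : Metric J N)
    (l : M → ℝ) (hl : ContMDiff I 𝓘(ℝ, ℝ) ∞ l) :
    ContMDiff (I.prod J) ((I.prod J).prod 𝓘(ℝ, (E × E') →L[ℝ] (E × E') →L[ℝ] ℝ)) ∞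
      (fun b : M × N ↦ Bundle.TotalSpace.mk' ((E × E') →L[ℝ] (E × E') →L[ℝ] ℝ) 
      (E := fun x : M × N => TangentSpace (I.prod J) x →L[ℝ] TangentSpace (I.prod J) x →L[ℝ] ℝ) b (warpedInner gM gN l b)) := by
  intro z₀
  refine (contMDiffAt_hom_bundle (F₁ := E × E') (E₁ := TangentSpace (I.prod J))
     (F₂ := (E × E') →L[ℝ] ℝ) (E₂ := fun x : M × N => TangentSpace (I.prod J) x →L[ℝ] ℝ)
     _).2 ⟨contMDiffAt_id, ?_⟩
  have s1 := (coord_smooth gM z₀.1).comp z₀ (contMDiffAt_fst (I := I) (J := J) (n := ∞))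
  have s2 := (coord_smooth gN z₀.2).comp z₀ (contMDiffAt_snd (I := I) (J := J) (n := ∞))
  have s3 : ContMDiffAt (I.prod J) 𝓘(ℝ, ℝ) ∞ (fun z : M × N => Real.exp (2 * l z.1)) z₀ :=
    (Real.contDiff_exp.comp (contDiff_const.mul contDiff_id)).contMDiff.contMDiffAt.comp z₀
      ((hl z₀.1).comp z₀ (contMDiffAt_fst (I := I) (J := J) (n := ∞)))
  have t1 := (contMDiffAt_const (c := (ContinuousLinearMap.fst ℝ E E').precomp ℝ)).clm_comp
    (s1.clm_comp (contMDiffAt_const (c := ContinuousLinearMap.fst ℝ E E')))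
  have t2 := s3.smul ((contMDiffAt_const (c := (ContinuousLinearMap.snd ℝ E E').precomp ℝ)).clm_comp
    (s2.clm_comp (contMDiffAt_const (c := ContinuousLinearMap.snd ℝ E E'))))
  refine (t1.add t2).congr_of_eventuallyEq ?_
  have n1 : ∀ᶠ z : M × N in nhds z₀, z.1 ∈ (chartAt H z₀.1).source :=
    continuous_fst.continuousAt.eventually (chart_source_mem_nhds H z₀.1)
  have n2 : ∀ᶠ z : M × N in nhds z₀, z.2 ∈ (chartAt H' z₀.2).source :=
    continuous_snd.continuousAt.eventually (chart_source_mem_nhds H' z₀.2)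
  filter_upwards [n1, n2] with z h1 h2
  have h : z ∈ (chartAt (ModelProd H H') z₀).source := by
    simp only [prodChartedSpace_chartAt, mfld_simps]; exact ⟨h1, h2⟩
  refine ContinuousLinearMap.ext fun v => ContinuousLinearMap.ext fun w => ?_
  have k0 := inCoordinates_apply_eq₂ (F₁ := E × E') (F₂ := E × E') (F₃ := ℝ)
    (E₁ := TangentSpace (I.prod J)) (E₂ := TangentSpace (I.prod J)) (E₃ := Bundle.Trivial (M × N) ℝ)
    (x₀ := z₀) (x := z) (ϕ := warpedInner gM gN l z) (v := v) (w := w) h h (Set.mem_univ _)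
  have k1 := inCoordinates_apply_eq₂ (F₁ := E) (F₂ := E) (F₃ := ℝ)
    (E₁ := TangentSpace I) (E₂ := TangentSpace I) (E₃ := Bundle.Trivial M ℝ)
    (x₀ := z₀.1) (x := z.1) (ϕ := gM.inner z.1) (v := v.1) (w := w.1) h1 h1 (Set.mem_univ _)
  have k2 := inCoordinates_apply_eq₂ (F₁ := E') (F₂ := E') (F₃ := ℝ)
    (E₁ := TangentSpace J) (E₂ := TangentSpace J) (E₃ := Bundle.Trivial N ℝ)
    (x₀ := z₀.2) (x := z.2) (ϕ := gN.inner z.2) (v := v.2) (w := w.2) h2 h2 (Set.mem_univ _)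
  replace k0 := k0.trans (triv_line _ _ _)
  replace k1 := k1.trans (triv_line _ _ _)
  replace k2 := k2.trans (triv_line _ _ _)
  have hs := symm_prod (I := I) (J := J) z₀ z h1 h2
  have hv := congrArg (fun A : (E × E') →L[ℝ] E × E' => A v) hs
  have hw := congrArg (fun A : (E × E') →L[ℝ] E × E' => A w) hs
  refine k0.trans ?_
  change warpedInner gM gN l z ((trivializationAt (E × E') (TangentSpace (I.prod J)) z₀).symm z v)
    ((trivializationAt (E × E') (TangentSpace (I.prod J)) z₀).symm z w) = _
  rw [warped_apply]
  refine Eq.trans ?_ (congrArg₂ (fun a b : ℝ => a + Real.exp (2 * l z.1) * b) k1.symm k2.symm)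
  have a0 := (trivializationAt (E × E') (TangentSpace (I.prod J)) z₀).symmL_apply (R := ℝ) h v
  have b0 := (trivializationAt (E × E') (TangentSpace (I.prod J)) z₀).symmL_apply (R := ℝ) h w
  have a1 := fun u => (trivializationAt E (TangentSpace I) z₀.1).symmL_apply (R := ℝ) h1 u
  have a2 := fun u => (trivializationAt E' (TangentSpace J) z₀.2).symmL_apply (R := ℝ) h2 u
  have v1 := congrArg Prod.fst hv
  have v2 := congrArg Prod.snd hv
  have w1 := congrArg Prod.fst hw
  have w2 := congrArg Prod.snd hw
  exact congrArg₂ (fun a b : ℝ => a + Real.exp (2 * l z.1) * b)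
    (congrArg₂ (fun a b : E => gM.inner z.1 a b)
      ((congrArg Prod.fst a0).symm.trans (v1.trans (a1 _))) ((congrArg Prod.fst b0).symm.trans (w1.trans (a1 _))))
    (congrArg₂ (fun a b : E' => gN.inner z.2 a b)
      ((congrArg Prod.snd a0).symm.trans (v2.trans (a2 _))) ((congrArg Prod.snd b0).symm.trans (w2.trans (a2 _))))

theorem self_nonneg [IsManifold I ∞ M] (g : Metric I M) (x : M) (v : TangentSpace I x) :
    0 ≤ g.inner x v v := by
  by_cases h : v = 0
  · rw [h]; simp
  · exact (g.pos _ _ h).le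

theorem smul_self [IsManifold I ∞ M] (g : Metric I M) (x : M) (c : ℝ) (v : TangentSpace I x) :
    g.inner x (c • v) (c • v) = c * c * g.inner x v v := by
  simp [mul_assoc]

theorem warped_bdd [IsManifold I ∞ M] [IsManifold J ∞ N] (gM : Metric I M) (gN : Metric J N)
    (l : M → ℝ) (z : M × N) :
    Bornology.IsVonNBounded ℝ {v : TangentSpace (I.prod J) z | warpedInner gM gN l z v v < 1} := by
  have n1 := gM.isVonNBounded z.1
  have n2 := gN.isVonNBounded z.2
  have n3 := n2.image ((Real.exp (- l z.1)) • ContinuousLinearMap.id ℝ (TangentSpace J z.2))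
  have p1 := n1.image (ContinuousLinearMap.inl ℝ E E')
  have p2 := n3.image (ContinuousLinearMap.inr ℝ E E')
  refine (p1.add p2).subset ?_
  intro v hv
  have hv' : gM.inner z.1 (v : E × E').1 (v : E × E').1 +
     Real.exp (2 * l z.1) * gN.inner z.2 (v : E × E').2 (v : E × E').2 < 1 := hv
  have a1 := self_nonneg gM z.1 (v : E × E').1
  have a2 := self_nonneg gN z.2 (v : E × E').2
  have e0 : Real.exp (- l z.1) * Real.exp (l z.1) = 1 := by rw [← Real.exp_add]; simp
  have e2 : Real.exp (2 * l z.1) = Real.exp (l z.1) * Real.exp (l z.1) := by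
    rw [← Real.exp_add]; congr 1; ring
  refine ⟨((v : E × E').1, 0), ⟨(v : E × E').1, ?_, rfl⟩, (0, (v : E × E').2),
    ⟨(v : E × E').2, ⟨Real.exp (l z.1) • (v : E × E').2, ?_, ?_⟩, rfl⟩, ?_⟩
  · have := mul_nonneg (Real.exp_pos (2 * l z.1)).le a2
    change gM.inner z.1 (v : E × E').1 (v : E × E').1 < 1
    linarith
  · have := smul_self gN z.2 (Real.exp (l z.1)) (v : E × E').2
    rw [← e2] at this
    exact lt_of_eq_of_lt this (by linarith)
  · change Real.exp (-l z.1) • Real.exp (l z.1) • (v : E × E').2 = (v : E × E').2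
    rw [smul_smul, e0, one_smul]
  · change ((v : E × E').1 + 0, 0 + (v : E × E').2) = (v : E × E')
    simp

/-- The warped product metric `g_M + e^{2l} g_N` on `M × N`. -/
def warpedMetric [IsManifold I ∞ M] [IsManifold J ∞ N] (gM : Metric I M) (gN : Metric J N)
    (l : M → ℝ) (hl : ContMDiff I 𝓘(ℝ, ℝ) ∞ l) : Metric (I.prod J) (M × N) where
  inner := warpedInner gM gN l
  symm z v w := congrArg₂ (fun a b : ℝ => a + Real.exp (2 * l z.1) * b)
    (gM.symm z.1 (v : E × E').1 (w : E × E').1) (gN.symm z.2 (v : E × E').2 (w : E × E').2)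
  pos z v hv := by
    change 0 < gM.inner z.1 (v : E × E').1 (v : E × E').1 +
      Real.exp (2 * l z.1) * gN.inner z.2 (v : E × E').2 (v : E × E').2
    have a1 := self_nonneg gM z.1 (v : E × E').1
    have a2 := self_nonneg gN z.2 (v : E × E').2
    have e := Real.exp_pos (2 * l z.1)
    by_cases h : (v : E × E').1 = 0
    · have h2 : (v : E × E').2 ≠ 0 := fun h2 => hv (Prod.ext h h2)
      have := mul_pos e (gN.pos z.2 _ h2)
      linarith
    · have := mul_nonneg e.le a2
      have := gM.pos z.1 _ h
      linarith
  isVonNBounded := warped_bdd gM gN l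
  contMDiff := smooth_warped gM gN l hl

end Warped

end RiemGeom

end

set_option maxSynthPendingDepth 3

noncomputable section

namespace RiemGeom

section BilinearForms

variable {E : Type*} [NormedAddCommGroup E] [NormedSpace ℝ E]
  {F : Type*} [NormedAddCommGroup F] [NormedSpace ℝ F]

/-- Symmetric positive definite bilinear forms. -/
structure IsPosDefForm (B : E →L[ℝ] E →L[ℝ] ℝ) : Prop where
  symm : ∀ v w, B v w = B w v
  pos : ∀ v, v ≠ 0 → 0 < B v v

namespace IsPosDefForm

variable {B : E →L[ℝ] E →L[ℝ] ℝ}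

theorem nonneg (hB : IsPosDefForm B) (v : E) : 0 ≤ B v v := by
  by_cases h : v = 0
  · simp [h]
  · exact (hB.pos v h).le

theorem eq_zero_of_self (hB : IsPosDefForm B) {v : E} (h : B v v = 0) : v = 0 := by
  by_contra hv
  exact (hB.pos v hv).ne' h

theorem ext_right (hB : IsPosDefForm B) {v w : E} (h : ∀ z, B v z = B w z) : v = w := by
  have : B (v - w) (v - w) = 0 := by
    have h' := h (v - w)
    rw [map_sub B v w, sub_apply, h', sub_self]
  exact sub_eq_zero.1 (hB.eq_zero_of_self this)

variable [FiniteDimensional ℝ E]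

theorem exists_equiv (hB : IsPosDefForm B) :
    ∃ e : E ≃L[ℝ] (E →L[ℝ] ℝ), (e : E →L[ℝ] E →L[ℝ] ℝ) = B := by
  have hinj : Function.Injective (B : E →ₗ[ℝ] E →L[ℝ] ℝ) := fun v w h =>
    hB.ext_right fun z => DFunLike.congr_fun h z
  have hd : Module.finrank ℝ E = Module.finrank ℝ (E →L[ℝ] ℝ) := by
    rw [← (LinearMap.toContinuousLinearMap (𝕜 := ℝ) (E := E) (F' := ℝ)).finrank_eq]
    exact (Subspace.dual_finrank_eq).symm
  refine ⟨(LinearEquiv.ofInjectiveOfFinrankEq _ hinj hd).toContinuousLinearEquiv, ?_⟩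
  ext v w
  rfl

theorem apply_inverse (hB : IsPosDefForm B) (α : E →L[ℝ] ℝ) : B (B.inverse α) = α := by
  obtain ⟨e, rfl⟩ := hB.exists_equiv
  rw [ContinuousLinearMap.inverse_equiv]
  exact e.apply_symm_apply α

theorem exists_orthonormal (hB : IsPosDefForm B) :
    ∃ e : Module.Basis (Fin (Module.finrank ℝ E)) ℝ E,
      ∀ i j, B (e i) (e j) = if i = j then 1 else 0 := by
  let B' : LinearMap.BilinForm ℝ E := LinearMap.mk₂ ℝ (fun v w => B v w)
    (by simp) (by simp) (by simp) (by simp)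
  obtain ⟨v, hv⟩ := LinearMap.BilinForm.exists_orthogonal_basis (B := B') ⟨fun v w => hB.symm v w⟩
  have hp : ∀ i, 0 < B (v i) (v i) := fun i => hB.pos _ (v.ne_zero i)
  have hu : ∀ i, IsUnit ((√(B (v i) (v i)))⁻¹) := fun i =>
    (inv_ne_zero (Real.sqrt_pos.2 (hp i)).ne').isUnit
  refine ⟨v.isUnitSMul hu, fun i j => ?_⟩
  rw [Module.Basis.isUnitSMul_apply, Module.Basis.isUnitSMul_apply]
  simp only [map_smul, smul_apply, smul_eq_mul]
  split_ifs with h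
  · subst h
    rw [← mul_assoc, ← mul_inv, Real.mul_self_sqrt (hp i).le, inv_mul_cancel₀ (hp i).ne']
  · have : B (v i) (v j) = 0 := LinearMap.isOrthoᵢ_def.1 hv i j h
    rw [this, mul_zero, mul_zero]

theorem eq_sum_orthonormal {κ : Type*} [Fintype κ] [DecidableEq κ] (e : Module.Basis κ ℝ E)
    (he : ∀ i j, B (e i) (e j) = if i = j then 1 else 0) (v : E) : v = ∑ k, B (e k) v • e k := by
  conv_lhs => rw [← e.sum_repr v]
  refine Finset.sum_congr rfl fun k _ => ?_
  have : B (e k) v = ∑ j, e.repr v j * B (e k) (e j) := by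
    conv_lhs => rw [← e.sum_repr v]
    simp only [map_sum, map_smul, smul_eq_mul]
  rw [this]
  simp [he]

theorem inverse_eq_sum (hB : IsPosDefForm B) {κ : Type*} [Fintype κ] [DecidableEq κ]
    (e : Module.Basis κ ℝ E) (he : ∀ i j, B (e i) (e j) = if i = j then 1 else 0)
    (α : E →L[ℝ] ℝ) : B.inverse α = ∑ k, α (e k) • e k := by
  refine hB.ext_right fun z => ?_
  rw [hB.apply_inverse]
  conv_lhs => rw [eq_sum_orthonormal e he z]
  simp [mul_comm]

/-- The metric contraction of a bilinear map may be computed in an orthonormal basis. -/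
theorem sum_apply_sharp (hB : IsPosDefForm B) {ι κ : Type*} [Fintype ι] [Fintype κ]
    (b : Module.Basis ι ℝ E) (e : Module.Basis κ ℝ E) [DecidableEq κ]
    (he : ∀ i j, B (e i) (e j) = if i = j then 1 else 0) (Q : E →L[ℝ] E →L[ℝ] F) :
    ∑ i, Q (b i) (B.inverse (LinearMap.toContinuousLinearMap (b.coord i))) =
      ∑ k, Q (e k) (e k) := by
  have h1 := eq_sum_orthonormal e he
  have h2 : ∀ v w : E, Q v w = ∑ k, B (e k) v • Q (e k) w := fun v w => by
    conv_lhs => rw [h1 v]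
    simp
  have h3 : ∀ k, ∑ i, B (e k) (b i) •
      B.inverse (LinearMap.toContinuousLinearMap (b.coord i)) = e k := fun k => by
    refine hB.ext_right fun z => ?_
    conv_rhs => rw [← b.sum_repr z]
    simp only [map_sum, map_smul, sum_apply, smul_apply,
      hB.apply_inverse]
    exact Finset.sum_congr rfl fun i _ => by simp [mul_comm]
  simp_rw [h2 (b _)]
  rw [Finset.sum_comm]
  refine Finset.sum_congr rfl fun k _ => ?_
  have h4 := congrArg (Q (e k)) (h3 k)
  rw [map_sum] at h4
  simpa only [map_smul] using h4

end IsPosDefForm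

end BilinearForms

section LocalMetrics

variable {E : Type*} [NormedAddCommGroup E] [NormedSpace ℝ E]
  {F : Type*} [NormedAddCommGroup F] [NormedSpace ℝ F]
  {P : Type*} [NormedAddCommGroup P] [NormedSpace ℝ P]

/-- Smooth Riemannian metrics on an open subset of a vector space. -/
structure IsMetricOn (G : E → E →L[ℝ] E →L[ℝ] ℝ) (U : Set E) : Prop where
  isOpen : IsOpen U
  contDiffOn : ContDiffOn ℝ ∞ G U
  posDef : ∀ u ∈ U, IsPosDefForm (G u)

/-- The Christoffel symbols of a metric on a vector space. -/
def localChristoffel (G : E → E →L[ℝ] E →L[ℝ] ℝ) (u : E) : E →L[ℝ] E →L[ℝ] E :=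
  let D : E →L[ℝ] E →L[ℝ] E →L[ℝ] ℝ := fderiv ℝ G u
  (ContinuousLinearMap.compL ℝ E (E →L[ℝ] ℝ) E (G u).inverse) ∘L
    ((1 / 2 : ℝ) • (D + D.flip - ((ContinuousLinearMap.flipₗᵢ ℝ E E ℝ).toContinuousLinearEquiv :
        (E →L[ℝ] E →L[ℝ] ℝ) →L[ℝ] E →L[ℝ] E →L[ℝ] ℝ) ∘L D.flip))

theorem localChristoffel_apply (G : E → E →L[ℝ] E →L[ℝ] ℝ) (u v w : E) :
    localChristoffel G u v w = (G u).inverse ((1 / 2 : ℝ) •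
      (fderiv ℝ G u v w + fderiv ℝ G u w v - ((fderiv ℝ G u).flip v).flip w)) := by
  simp [localChristoffel]

/-- The second fundamental form of a map between vector spaces with metrics. -/
def localSFF (G : P → P →L[ℝ] P →L[ℝ] ℝ) (h : E → E →L[ℝ] E →L[ℝ] ℝ) (ψ : P → E) (u : P) :
    P →L[ℝ] P →L[ℝ] E :=
  fderiv ℝ (fderiv ℝ ψ) u
    - (ContinuousLinearMap.compL ℝ P P E (fderiv ℝ ψ u)) ∘L localChristoffel G u
    + (localChristoffel h (ψ u)).bilinearComp (fderiv ℝ ψ u) (fderiv ℝ ψ u)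

theorem localSFF_apply (G : P → P →L[ℝ] P →L[ℝ] ℝ) (h : E → E →L[ℝ] E →L[ℝ] ℝ) (ψ : P → E)
    (u v w : P) : localSFF G h ψ u v w =
      fderiv ℝ (fderiv ℝ ψ) u v w - fderiv ℝ ψ u (localChristoffel G u v w)
        + localChristoffel h (ψ u) (fderiv ℝ ψ u v) (fderiv ℝ ψ u w) := rfl

/-- The tension field of a map between vector spaces with metrics. -/
def localTension [FiniteDimensional ℝ P] (G : P → P →L[ℝ] P →L[ℝ] ℝ)
    (h : E → E →L[ℝ] E →L[ℝ] ℝ) (ψ : P → E) (u : P) : E :=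
  ∑ i, localSFF G h ψ u (Module.finBasis ℝ P i)
    ((G u).inverse (LinearMap.toContinuousLinearMap ((Module.finBasis ℝ P).coord i)))

theorem localTension_eq_sum [FiniteDimensional ℝ P] {G : P → P →L[ℝ] P →L[ℝ] ℝ}
    (h : E → E →L[ℝ] E →L[ℝ] ℝ) (ψ : P → E) {u : P} (hG : IsPosDefForm (G u))
    {κ : Type*} [Fintype κ] [DecidableEq κ] (e : Module.Basis κ ℝ P)
    (he : ∀ i j, G u (e i) (e j) = if i = j then 1 else 0) :
    localTension G h ψ u = ∑ k, localSFF G h ψ u (e k) (e k) :=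
  hG.sum_apply_sharp _ e he _

theorem fderiv_fderiv_comp {f : E → F} {g : P → E} {u : P} (hf : ContDiffAt ℝ 2 f (g u))
    (hg : ContDiffAt ℝ 2 g u) (v w : P) :
    fderiv ℝ (fderiv ℝ (f ∘ g)) u v w =
      fderiv ℝ (fderiv ℝ f) (g u) (fderiv ℝ g u v) (fderiv ℝ g u w) +
        fderiv ℝ f (g u) (fderiv ℝ (fderiv ℝ g) u v w) := by
  have h1 : fderiv ℝ (f ∘ g) =ᶠ[nhds u] fun x => (fderiv ℝ f (g x)).comp (fderiv ℝ g x) := by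
    filter_upwards [hg.continuousAt.eventually (hf.eventually (by simp)),
      hg.eventually (by simp)] with x h1 h2
    exact fderiv_comp x (h1.differentiableAt two_ne_zero) (h2.differentiableAt two_ne_zero)
  have hf' : DifferentiableAt ℝ (fderiv ℝ f) (g u) :=
    (hf.fderiv_right (m := 1) (by norm_num)).differentiableAt one_ne_zero
  have hg' : DifferentiableAt ℝ (fderiv ℝ g) u :=
    (hg.fderiv_right (m := 1) (by norm_num)).differentiableAt one_ne_zero
  have h2 := (hf'.hasFDerivAt.comp u (hg.differentiableAt two_ne_zero).hasFDerivAt).clm_comp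
    hg'.hasFDerivAt
  rw [h1.fderiv_eq]
  erw [h2.fderiv]
  simp [add_comm]

theorem fderiv_fderiv_symm {f : P → E} {u : P} (hf : ContDiffAt ℝ 2 f u) (v w : P) :
    fderiv ℝ (fderiv ℝ f) u v w = fderiv ℝ (fderiv ℝ f) u w v :=
  (hf.isSymmSndFDerivAt (by simp)) v w

namespace IsMetricOn

variable {G : E → E →L[ℝ] E →L[ℝ] ℝ} {U : Set E}

theorem contDiffAt (hG : IsMetricOn G U) {u : E} (hu : u ∈ U) : ContDiffAt ℝ ∞ G u :=
  (hG.contDiffOn u hu).contDiffAt (hG.isOpen.mem_nhds hu)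

theorem differentiableAt (hG : IsMetricOn G U) {u : E} (hu : u ∈ U) : DifferentiableAt ℝ G u :=
  (hG.contDiffAt hu).differentiableAt (by simp)

theorem contDiffAt_fderiv (hG : IsMetricOn G U) {u : E} (hu : u ∈ U) :
    ContDiffAt ℝ ∞ (fderiv ℝ G) u :=
  (hG.contDiffAt hu).fderiv_right (by simp)

theorem fderiv_symm (hG : IsMetricOn G U) {u : E} (hu : u ∈ U) (v w z : E) :
    fderiv ℝ G u v w z = fderiv ℝ G u v z w := by
  have h := (hG.differentiableAt hu).hasFDerivAt
  have h1 := (h.clm_apply (hasFDerivAt_const w u)).clm_apply (hasFDerivAt_const z u)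
  have h2 := (h.clm_apply (hasFDerivAt_const z u)).clm_apply (hasFDerivAt_const w u)
  have h3 : (fun y => G y w z) =ᶠ[nhds u] fun y => G y z w := by
    filter_upwards [hG.isOpen.mem_nhds hu] with y hy
    exact (hG.posDef y hy).symm w z
  have := DFunLike.congr_fun ((h1.congr_of_eventuallyEq h3.symm).unique h2) v
  simpa using this

variable [FiniteDimensional ℝ E]

theorem koszul (hG : IsMetricOn G U) {u : E} (hu : u ∈ U) (v w z : E) :
    G u (localChristoffel G u v w) z =
      1 / 2 * (fderiv ℝ G u v w z + fderiv ℝ G u w v z - fderiv ℝ G u z v w) := by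
  rw [localChristoffel_apply, (hG.posDef u hu).apply_inverse]
  simp

theorem christoffel_symm (hG : IsMetricOn G U) {u : E} (hu : u ∈ U) (v w : E) :
    localChristoffel G u v w = localChristoffel G u w v := by
  refine (hG.posDef u hu).ext_right fun z => ?_
  rw [hG.koszul hu, hG.koszul hu, hG.fderiv_symm hu z v w]
  ring

theorem fderiv_eq (hG : IsMetricOn G U) {u : E} (hu : u ∈ U) (v w z : E) :
    fderiv ℝ G u v w z =
      G u (localChristoffel G u v w) z + G u w (localChristoffel G u v z) := by
  rw [(hG.posDef u hu).symm w, hG.koszul hu, hG.koszul hu, hG.fderiv_symm hu v z w,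
    hG.fderiv_symm hu w v z, hG.fderiv_symm hu z v w]
  ring

theorem contDiffAt_inverse (hG : IsMetricOn G U) {u : E} (hu : u ∈ U) :
    ContDiffAt ℝ ∞ (fun x => (G x).inverse) u := by
  obtain ⟨e, he⟩ := (hG.posDef u hu).exists_equiv
  have := contDiffAt_map_inverse (n := ∞) e
  rw [he] at this
  have : CompleteSpace E := FiniteDimensional.complete ℝ E
  exact ContDiffAt.comp u (by assumption) (hG.contDiffAt hu)

theorem contDiffAt_christoffel (hG : IsMetricOn G U) {u : E} (hu : u ∈ U) :
    ContDiffAt ℝ ∞ (localChristoffel G) u := by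
  have h1 := hG.contDiffAt_fderiv hu
  have h2 : ContDiffAt ℝ ∞ (fun x => (fderiv ℝ G x).flip) u :=
    ((ContinuousLinearMap.flipₗᵢ ℝ E E (E →L[ℝ] ℝ)).contDiff.contDiffAt).comp u h1
  refine ContDiffAt.clm_comp ?_ ((ContDiffAt.sub (h1.add h2)
    (ContDiffAt.clm_comp contDiffAt_const h2)).const_smul _)
  exact (ContinuousLinearMap.contDiff _).contDiffAt.comp u (hG.contDiffAt_inverse hu)

/-- The transformation law of the Christoffel symbols. -/
theorem christoffel_pullback {G₀ : F → F →L[ℝ] F →L[ℝ] ℝ} {W : Set F} (hG : IsMetricOn G U)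
    (hG₀ : IsMetricOn G₀ W) [FiniteDimensional ℝ F] {κ : E → F} {u : E} (hu : u ∈ U)
    (hW : κ u ∈ W) (hκ : ContDiffAt ℝ 2 κ u) (hs : Function.Surjective (fderiv ℝ κ u))
    (h : ∀ᶠ x in nhds u, ∀ v w, G x v w = G₀ (κ x) (fderiv ℝ κ x v) (fderiv ℝ κ x w)) (v w : E) :
    fderiv ℝ κ u (localChristoffel G u v w) =
      localChristoffel G₀ (κ u) (fderiv ℝ κ u v) (fderiv ℝ κ u w) +
        fderiv ℝ (fderiv ℝ κ) u v w := by
  have hB := hG₀.posDef _ hW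
  refine hB.ext_right fun z' => ?_
  obtain ⟨z, rfl⟩ := hs z'
  have hκ' : DifferentiableAt ℝ (fderiv ℝ κ) u :=
    (hκ.fderiv_right (m := 1) (by norm_num)).differentiableAt one_ne_zero
  have hc := (hG₀.differentiableAt hW).hasFDerivAt.comp u
    (hκ.differentiableAt two_ne_zero).hasFDerivAt
  have key : ∀ a b c, fderiv ℝ G u a b c =
      fderiv ℝ G₀ (κ u) (fderiv ℝ κ u a) (fderiv ℝ κ u b) (fderiv ℝ κ u c) +
        G₀ (κ u) (fderiv ℝ (fderiv ℝ κ) u a b) (fderiv ℝ κ u c) +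
        G₀ (κ u) (fderiv ℝ κ u b) (fderiv ℝ (fderiv ℝ κ) u a c) := fun a b c => by
    have h1 := ((hG.differentiableAt hu).hasFDerivAt.clm_apply
      (hasFDerivAt_const b u)).clm_apply (hasFDerivAt_const c u)
    have h2 := (hc.clm_apply (hκ'.hasFDerivAt.clm_apply (hasFDerivAt_const b u))).clm_apply
      (hκ'.hasFDerivAt.clm_apply (hasFDerivAt_const c u))
    have h3 := DFunLike.congr_fun ((h1.congr_of_eventuallyEq
      (h.mono fun x hx => (hx b c).symm)).unique h2) a
    simp at h3
    rw [h3]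
    ring
  have sκ := fderiv_fderiv_symm hκ
  rw [← h.self_of_nhds, hG.koszul hu, map_add, add_apply, hG₀.koszul hW,
    key, key, key, sκ w v, sκ z v, sκ z w, hB.symm (fderiv ℝ (fderiv ℝ κ) u v z),
    hB.symm (fderiv ℝ κ u v)]
  ring

end IsMetricOn

end LocalMetrics

section TransformationLaws

variable {E : Type*} [NormedAddCommGroup E] [NormedSpace ℝ E] [FiniteDimensional ℝ E]
  {F : Type*} [NormedAddCommGroup F] [NormedSpace ℝ F] [FiniteDimensional ℝ F]
  {P : Type*} [NormedAddCommGroup P] [NormedSpace ℝ P] [FiniteDimensional ℝ P]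
  {P' : Type*} [NormedAddCommGroup P'] [NormedSpace ℝ P'] [FiniteDimensional ℝ P']
  {G : P → P →L[ℝ] P →L[ℝ] ℝ} {U : Set P} {G₀ : P' → P' →L[ℝ] P' →L[ℝ] ℝ} {W : Set P'}
  {h : E → E →L[ℝ] E →L[ℝ] ℝ} {V : Set E} {h₁ : F → F →L[ℝ] F →L[ℝ] ℝ} {V₁ : Set F}

theorem localTension_congr {ψ ψ' : P → E} {u : P} (H : ψ =ᶠ[nhds u] ψ') :
    localTension G h ψ u = localTension G h ψ' u := by
  simp only [localTension, localSFF_apply, H.fderiv_eq, H.fderiv.fderiv_eq, H.self_of_nhds]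

theorem localSFF_comp_right (hG : IsMetricOn G U) (hG₀ : IsMetricOn G₀ W) {κ : P → P'} {u : P}
    (hu : u ∈ U) (hW : κ u ∈ W) (hκ : ContDiffAt ℝ 2 κ u)
    (hs : Function.Surjective (fderiv ℝ κ u))
    (H : ∀ᶠ x in nhds u, ∀ v w, G x v w = G₀ (κ x) (fderiv ℝ κ x v) (fderiv ℝ κ x w))
    {ψ : P' → E} (hψ : ContDiffAt ℝ 2 ψ (κ u)) (v w : P) :
    localSFF G h (ψ ∘ κ) u v w = localSFF G₀ h ψ (κ u) (fderiv ℝ κ u v) (fderiv ℝ κ u w) := by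
  rw [localSFF_apply, localSFF_apply, fderiv_fderiv_comp hψ hκ,
    fderiv_comp u (hψ.differentiableAt two_ne_zero) (hκ.differentiableAt two_ne_zero)]
  simp only [ContinuousLinearMap.comp_apply, Function.comp_apply]
  rw [hG.christoffel_pullback hG₀ hu hW hκ hs H, map_add]
  abel

theorem localSFF_comp_left (hh : IsMetricOn h V) (hh₁ : IsMetricOn h₁ V₁) {β : E → F} {ψ : P → E}
    {u : P} (hV : ψ u ∈ V) (hV₁ : β (ψ u) ∈ V₁) (hβ : ContDiffAt ℝ 2 β (ψ u))
    (hs : Function.Surjective (fderiv ℝ β (ψ u)))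
    (H : ∀ᶠ x in nhds (ψ u), ∀ v w, h x v w = h₁ (β x) (fderiv ℝ β x v) (fderiv ℝ β x w))
    (hψ : ContDiffAt ℝ 2 ψ u) (v w : P) :
    localSFF G h₁ (β ∘ ψ) u v w = fderiv ℝ β (ψ u) (localSFF G h ψ u v w) := by
  rw [localSFF_apply, localSFF_apply, fderiv_fderiv_comp hβ hψ,
    fderiv_comp u (hβ.differentiableAt two_ne_zero) (hψ.differentiableAt two_ne_zero)]
  simp only [ContinuousLinearMap.comp_apply, Function.comp_apply, map_add, map_sub]
  rw [hh.christoffel_pullback hh₁ hV hV₁ hβ hs H]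
  abel

theorem localTension_comp_right (hG : IsMetricOn G U) (hG₀ : IsMetricOn G₀ W) {κ : P → P'} {u : P}
    (hu : u ∈ U) (hW : κ u ∈ W) (hκ : ContDiffAt ℝ 2 κ u)
    (hs : Function.Surjective (fderiv ℝ κ u))
    (H : ∀ᶠ x in nhds u, ∀ v w, G x v w = G₀ (κ x) (fderiv ℝ κ x v) (fderiv ℝ κ x w))
    {ψ : P' → E} (hψ : ContDiffAt ℝ 2 ψ (κ u)) :
    localTension G h (ψ ∘ κ) u = localTension G₀ h ψ (κ u) := by
  obtain ⟨e, he⟩ := (hG.posDef u hu).exists_orthonormal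
  have hi : Function.Injective (fderiv ℝ κ u) := by
    refine (injective_iff_map_eq_zero _).2 fun v hv => (hG.posDef u hu).eq_zero_of_self ?_
    rw [H.self_of_nhds, hv]
    simp
  let e' := e.map (LinearEquiv.ofBijective (fderiv ℝ κ u : P →ₗ[ℝ] P') ⟨hi, hs⟩)
  have hv : ∀ i, e' i = fderiv ℝ κ u (e i) := fun i => rfl
  rw [localTension_eq_sum h _ (hG.posDef u hu) e he,
    localTension_eq_sum h _ (hG₀.posDef _ hW) e' fun i j => by
      rw [hv, hv, ← H.self_of_nhds, he]]
  exact Finset.sum_congr rfl fun i _ => by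
    rw [hv, localSFF_comp_right hG hG₀ hu hW hκ hs H hψ]

theorem localTension_comp_left (hh : IsMetricOn h V) (hh₁ : IsMetricOn h₁ V₁) {β : E → F}
    {ψ : P → E} {u : P} (hV : ψ u ∈ V) (hV₁ : β (ψ u) ∈ V₁) (hβ : ContDiffAt ℝ 2 β (ψ u))
    (hs : Function.Surjective (fderiv ℝ β (ψ u)))
    (H : ∀ᶠ x in nhds (ψ u), ∀ v w, h x v w = h₁ (β x) (fderiv ℝ β x v) (fderiv ℝ β x w))
    (hψ : ContDiffAt ℝ 2 ψ u) :
    localTension G h₁ (β ∘ ψ) u = fderiv ℝ β (ψ u) (localTension G h ψ u) := by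
  simp only [localTension, map_sum]
  exact Finset.sum_congr rfl fun i _ => localSFF_comp_left hh hh₁ hV hV₁ hβ hs H hψ _ _

/-- The tension field of a smooth family of maps depends smoothly on the parameter and the point. -/
theorem contDiffAt_localTension (hG : IsMetricOn G U) (hh : IsMetricOn h V) {ψ : ℝ → P → E} {t : ℝ}
    {u : P} (hψ : ContDiffAt ℝ ∞ (Function.uncurry ψ) (t, u)) (hu : u ∈ U) (hV : ψ t u ∈ V) :
    ContDiffAt ℝ ∞ (fun x : ℝ × P => localTension G h (ψ x.1) x.2) (t, u) := by
  have hsnd : ContDiffAt ℝ ∞ (fun x : ℝ × P => x.2) (t, u) := contDiffAt_snd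
  have a0 : ContDiffAt ℝ ∞ (fun q : (ℝ × P) × P => ψ q.1.1 q.2) ((t, u), u) :=
    ContDiffAt.comp (g := Function.uncurry ψ) ((t, u), u)
      (f := fun q : (ℝ × P) × P => (q.1.1, q.2)) hψ
      ((contDiffAt_fst.comp _ contDiffAt_fst).prodMk contDiffAt_snd)
  have d1 : ContDiffAt ℝ ∞ (fun x : ℝ × P => fderiv ℝ (ψ x.1) x.2) (t, u) :=
    ContDiffAt.fderiv (n := ∞) (f := fun x : ℝ × P => ψ x.1) a0 hsnd (by simp)
  have a1 : ContDiffAt ℝ ∞ (fun q : (ℝ × P) × P => fderiv ℝ (ψ q.1.1) q.2) ((t, u), u) :=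
    ContDiffAt.comp (g := fun x : ℝ × P => fderiv ℝ (ψ x.1) x.2) ((t, u), u)
      (f := fun q : (ℝ × P) × P => (q.1.1, q.2)) d1
      ((contDiffAt_fst.comp _ contDiffAt_fst).prodMk contDiffAt_snd)
  have d2 : ContDiffAt ℝ ∞ (fun x : ℝ × P => fderiv ℝ (fderiv ℝ (ψ x.1)) x.2) (t, u) :=
    ContDiffAt.fderiv (n := ∞) (f := fun x : ℝ × P => fderiv ℝ (ψ x.1)) a1 hsnd (by simp)
  have g1 : ContDiffAt ℝ ∞ (fun x : ℝ × P => localChristoffel G x.2) (t, u) :=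
    ContDiffAt.comp (g := localChristoffel G) (t, u) (hG.contDiffAt_christoffel hu) hsnd
  have g2 : ContDiffAt ℝ ∞ (fun x : ℝ × P => (G x.2).inverse) (t, u) :=
    ContDiffAt.comp (g := fun x => (G x).inverse) (t, u) (hG.contDiffAt_inverse hu) hsnd
  have g3 : ContDiffAt ℝ ∞ (fun x : ℝ × P => localChristoffel h (ψ x.1 x.2)) (t, u) :=
    ContDiffAt.comp (g := localChristoffel h) (t, u) (hh.contDiffAt_christoffel hV) hψ
  refine ContDiffAt.sum fun i _ => ?_
  have s := g2.clm_apply (contDiffAt_const (c := LinearMap.toContinuousLinearMap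
    ((Module.finBasis ℝ P).coord i)))
  have b : ContDiffAt ℝ ∞ (fun _ : ℝ × P => Module.finBasis ℝ P i) (t, u) := contDiffAt_const
  exact (((d2.clm_apply b).clm_apply s).sub (d1.clm_apply ((g1.clm_apply b).clm_apply s))).add
    ((g3.clm_apply (d1.clm_apply b)).clm_apply (d1.clm_apply s))

end TransformationLaws

section WarpedProducts

variable {E : Type*} [NormedAddCommGroup E] [NormedSpace ℝ E] [FiniteDimensional ℝ E]
  {E' : Type*} [NormedAddCommGroup E'] [NormedSpace ℝ E'] [FiniteDimensional ℝ E']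
  {G : E × E' → E × E' →L[ℝ] E × E' →L[ℝ] ℝ} {U : Set (E × E')}
  {g : E → E →L[ℝ] E →L[ℝ] ℝ} {V : Set E} {h : E' → E' →L[ℝ] E' →L[ℝ] ℝ} {V' : Set E'}
  {μ : E → ℝ}

/-- An orthonormal basis of a warped product which is adapted to the product structure. -/
theorem exists_orthonormal_warped {B : E × E' →L[ℝ] E × E' →L[ℝ] ℝ} {B₁ : E →L[ℝ] E →L[ℝ] ℝ}
    {B₂ : E' →L[ℝ] E' →L[ℝ] ℝ} (h₁ : IsPosDefForm B₁) (h₂ : IsPosDefForm B₂) {c : ℝ}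
    (hB : ∀ v w, B v w = B₁ v.1 w.1 + Real.exp (2 * c) * B₂ v.2 w.2) :
    ∃ (e₁ : Module.Basis (Fin (Module.finrank ℝ E)) ℝ E)
      (e : Module.Basis (Fin (Module.finrank ℝ E) ⊕ Fin (Module.finrank ℝ E')) ℝ (E × E')),
      (∀ i j, B₁ (e₁ i) (e₁ j) = if i = j then 1 else 0) ∧
      (∀ i j, B (e i) (e j) = if i = j then 1 else 0) ∧
      (∀ i, e (Sum.inl i) = (e₁ i, 0)) ∧ (∀ j, (e (Sum.inr j)).1 = 0) ∧
      (∀ j, Real.exp (2 * c) * B₂ (e (Sum.inr j)).2 (e (Sum.inr j)).2 = 1) := by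
  obtain ⟨e₁, he₁⟩ := h₁.exists_orthonormal
  obtain ⟨e₂, he₂⟩ := h₂.exists_orthonormal
  have hu : ∀ i : Fin (Module.finrank ℝ E'), IsUnit (Real.exp (-c)) := fun i =>
    (Real.exp_pos _).ne'.isUnit
  have hc : Real.exp (2 * c) * (Real.exp (-c) * Real.exp (-c)) = 1 := by
    rw [← Real.exp_add, ← Real.exp_add, Real.exp_eq_one_iff]
    ring
  have hr : ∀ j, (e₁.prod (e₂.isUnitSMul hu)) (Sum.inr j) = (0, Real.exp (-c) • e₂ j) :=
    fun j => by
      refine Prod.ext (by simp) ?_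
      rw [Module.Basis.prod_apply_inr_snd, Module.Basis.isUnitSMul_apply]
  have hl : ∀ j, (e₁.prod (e₂.isUnitSMul hu)) (Sum.inl j) = (e₁ j, 0) :=
    fun j => Prod.ext (by simp) (by simp)
  refine ⟨e₁, e₁.prod (e₂.isUnitSMul hu), he₁, ?_, hl, fun j => by rw [hr], fun j => ?_⟩
  · rintro (i | i) (j | j)
    · rw [hl, hl, hB]
      simp [he₁]
    · rw [hl, hr, hB]
      simp
    · rw [hl, hr, hB]
      simp
    · rw [hr, hr, hB]
      simp only [map_smul, smul_apply, smul_eq_mul, he₂, map_zero, zero_add]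
      by_cases hij : i = j
      · simp [hij, hc]
      · simp [hij]
  · rw [hr]
    simp only [map_smul, smul_apply, smul_eq_mul, he₂, if_true, mul_one]
    exact hc

/-- The second fundamental form of the projection of a warped product onto its first factor. -/
theorem localSFF_fst_warped (hG : IsMetricOn G U) (hg : IsMetricOn g V) (hh : IsMetricOn h V')
    (hμ : ContDiffOn ℝ ∞ μ V) (hU : ∀ u ∈ U, u.1 ∈ V ∧ u.2 ∈ V')
    (H : ∀ u ∈ U, ∀ v w, G u v w = g u.1 v.1 w.1 + Real.exp (2 * μ u.1) * h u.2 v.2 w.2)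
    {u : E × E'} (hu : u ∈ U) (v w : E × E') :
    localSFF G g Prod.fst u v w = (Real.exp (2 * μ u.1) * h u.2 v.2 w.2) •
      (g u.1).inverse (fderiv ℝ μ u.1) := by
  obtain ⟨h1, h2⟩ := hU u hu
  have dμ : DifferentiableAt ℝ μ u.1 :=
    ((hμ u.1 h1).contDiffAt (hg.isOpen.mem_nhds h1)).differentiableAt (by simp)
  have key : ∀ a b c : E × E', fderiv ℝ G u a b c = fderiv ℝ g u.1 a.1 b.1 c.1 +
      (Real.exp (2 * μ u.1) * (2 * fderiv ℝ μ u.1 a.1) * h u.2 b.2 c.2 +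
        Real.exp (2 * μ u.1) * fderiv ℝ h u.2 a.2 b.2 c.2) := fun a b c => by
    have k1 := ((hG.differentiableAt hu).hasFDerivAt.clm_apply
      (hasFDerivAt_const b u)).clm_apply (hasFDerivAt_const c u)
    have k2 := (((hg.differentiableAt h1).hasFDerivAt.comp u hasFDerivAt_fst).clm_apply
      (hasFDerivAt_const b.1 u)).clm_apply (hasFDerivAt_const c.1 u)
    have k3 := (((hh.differentiableAt h2).hasFDerivAt.comp u hasFDerivAt_snd).clm_apply
      (hasFDerivAt_const b.2 u)).clm_apply (hasFDerivAt_const c.2 u)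
    have k4 := ((dμ.hasFDerivAt.comp u hasFDerivAt_fst).const_mul 2).exp
    have k5 : (fun y => G y b c) =ᶠ[nhds u]
        fun y => g y.1 b.1 c.1 + Real.exp (2 * μ y.1) * h y.2 b.2 c.2 := by
      filter_upwards [hG.isOpen.mem_nhds hu] with y hy
      exact H y hy b c
    have := DFunLike.congr_fun ((k1.congr_of_eventuallyEq k5.symm).unique (k2.add (k4.mul k3))) a
    simp at this
    rw [this]
    ring
  have hfst : fderiv ℝ (Prod.fst : E × E' → E) = fun _ => ContinuousLinearMap.fst ℝ E E' := by
    ext1 x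
    exact fderiv_fst
  have hB := hg.posDef _ h1
  refine hB.ext_right fun z => ?_
  have c1 := hG.koszul hu v w (z, 0)
  rw [H u hu] at c1
  simp only [key, map_zero, zero_apply, mul_zero, add_zero] at c1
  have c2 := hg.koszul h1 v.1 w.1 z
  rw [localSFF_apply, hfst]
  simp only [fderiv_fun_const, map_add, map_sub, map_smul, add_apply, sub_apply, smul_apply,
    smul_eq_mul, hB.apply_inverse, Pi.zero_apply, zero_apply, map_zero]
  simp only [ContinuousLinearMap.coe_fst', c1, c2]
  ring

/-- The tension field of the projection of a warped product onto its first factor. -/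
theorem localTension_fst_warped (hG : IsMetricOn G U) (hg : IsMetricOn g V) (hh : IsMetricOn h V')
    (hμ : ContDiffOn ℝ ∞ μ V) (hU : ∀ u ∈ U, u.1 ∈ V ∧ u.2 ∈ V')
    (H : ∀ u ∈ U, ∀ v w, G u v w = g u.1 v.1 w.1 + Real.exp (2 * μ u.1) * h u.2 v.2 w.2)
    {u : E × E'} (hu : u ∈ U) :
    localTension G g Prod.fst u =
      (Module.finrank ℝ E' : ℝ) • (g u.1).inverse (fderiv ℝ μ u.1) := by
  obtain ⟨h1, h2⟩ := hU u hu
  obtain ⟨e₁, e, -, he, hl, -, hr⟩ :=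
    exists_orthonormal_warped (hg.posDef _ h1) (hh.posDef _ h2) (H u hu)
  rw [localTension_eq_sum _ _ (hG.posDef u hu) e he, Fintype.sum_sum_type]
  simp_rw [localSFF_fst_warped hG hg hh hμ hU H hu, hr, hl]
  simp [Nat.cast_smul_eq_nsmul]

end WarpedProducts

theorem two_le_infty : (2 : WithTop ℕ∞) ≤ ∞ := by
  exact ENat.LEInfty.out

section Curvature

variable {E : Type*} [NormedAddCommGroup E] [NormedSpace ℝ E]
  {g : E → E →L[ℝ] E →L[ℝ] ℝ} {V : Set E}

/-- The curvature of constant vector fields for a metric on a vector space. -/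
def localCurvature (g : E → E →L[ℝ] E →L[ℝ] ℝ) (u v w z : E) : E :=
  fderiv ℝ (localChristoffel g) u v w z - fderiv ℝ (localChristoffel g) u w v z
    + localChristoffel g u v (localChristoffel g u w z)
    - localChristoffel g u w (localChristoffel g u v z)

variable [FiniteDimensional ℝ E]

theorem IsMetricOn.differentiableAt_christoffel (hg : IsMetricOn g V) {u : E} (hu : u ∈ V) :
    DifferentiableAt ℝ (localChristoffel g) u :=
  (hg.contDiffAt_christoffel hu).differentiableAt (by simp)

theorem IsMetricOn.fderiv_christoffel_symm (hg : IsMetricOn g V) {u : E} (hu : u ∈ V) (v w z : E) :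
    fderiv ℝ (localChristoffel g) u v w z = fderiv ℝ (localChristoffel g) u v z w := by
  have h := (hg.differentiableAt_christoffel hu).hasFDerivAt
  have h1 := (h.clm_apply (hasFDerivAt_const w u)).clm_apply (hasFDerivAt_const z u)
  have h2 := (h.clm_apply (hasFDerivAt_const z u)).clm_apply (hasFDerivAt_const w u)
  have h3 : (fun y => localChristoffel g y w z) =ᶠ[nhds u] fun y => localChristoffel g y z w := by
    filter_upwards [hg.isOpen.mem_nhds hu] with y hy
    exact hg.christoffel_symm hy w z
  simpa using DFunLike.congr_fun ((h1.congr_of_eventuallyEq h3.symm).unique h2) v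

theorem IsMetricOn.curvature_skew (hg : IsMetricOn g V) {u : E} (hu : u ∈ V) (v w z z' : E) :
    g u (localCurvature g u v w z) z' = - g u z (localCurvature g u v w z') := by
  have hG := hg.differentiableAt hu
  have hΓ := hg.differentiableAt_christoffel hu
  have hG2 : DifferentiableAt ℝ (fderiv ℝ g) u :=
    (hg.contDiffAt_fderiv hu).differentiableAt (by simp)
  have key : ∀ a b : E, fderiv ℝ (fderiv ℝ g) u a b z z' =
      g u (localChristoffel g u a (localChristoffel g u b z)) z' +
      g u (localChristoffel g u b z) (localChristoffel g u a z') +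
      g u (fderiv ℝ (localChristoffel g) u a b z) z' +
      g u (localChristoffel g u a z) (localChristoffel g u b z') +
      g u z (localChristoffel g u a (localChristoffel g u b z')) +
      g u z (fderiv ℝ (localChristoffel g) u a b z') := fun a b => by
    have h1 := ((hG2.hasFDerivAt.clm_apply (hasFDerivAt_const b u)).clm_apply
      (hasFDerivAt_const z u)).clm_apply (hasFDerivAt_const z' u)
    have k : ∀ y, HasFDerivAt (fun x => localChristoffel g x b y) _ u := fun y =>
      (hΓ.hasFDerivAt.clm_apply (hasFDerivAt_const b u)).clm_apply (hasFDerivAt_const y u)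
    have h2 := ((hG.hasFDerivAt.clm_apply (k z)).clm_apply (hasFDerivAt_const z' u)).add
      ((hG.hasFDerivAt.clm_apply (hasFDerivAt_const z u)).clm_apply (k z'))
    have h3 : (fun y => fderiv ℝ g y b z z') =ᶠ[nhds u] fun y =>
        g y (localChristoffel g y b z) z' + g y z (localChristoffel g y b z') := by
      filter_upwards [hg.isOpen.mem_nhds hu] with y hy
      exact hg.fderiv_eq hy b z z'
    have := DFunLike.congr_fun ((h1.congr_of_eventuallyEq h3.symm).unique h2) a
    simp [hg.fderiv_eq hu] at this
    rw [this]
    ring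
  have sym : fderiv ℝ (fderiv ℝ g) u v w z z' = fderiv ℝ (fderiv ℝ g) u w v z z' := by
    rw [fderiv_fderiv_symm ((hg.contDiffAt hu).of_le two_le_infty)]
  rw [key, key] at sym
  simp only [localCurvature, map_add, map_sub, add_apply, sub_apply]
  linarith

/-- The Ricci form in an orthonormal basis. -/
theorem IsMetricOn.sum_curvature (hg : IsMetricOn g V) {u : E} (hu : u ∈ V) {ι κ : Type*}
    [Fintype ι] [Fintype κ] [DecidableEq κ] (b : Module.Basis ι ℝ E) (e : Module.Basis κ ℝ E)
    (he : ∀ i j, g u (e i) (e j) = if i = j then 1 else 0) (z : E) :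
    ∑ i, b.coord i (localCurvature g u (b i) z z) =
      - ∑ k, g u z (localCurvature g u (e k) z (e k)) := by
  let R : E →L[ℝ] E := ((fderiv ℝ (localChristoffel g) u).flip z).flip z
    - (fderiv ℝ (localChristoffel g) u z).flip z
    + (localChristoffel g u).flip (localChristoffel g u z z)
    - (localChristoffel g u z) ∘L ((localChristoffel g u).flip z)
  have hR : ∀ v, localCurvature g u v z z = R v := fun v => rfl
  have hB := hg.posDef u hu
  have := hB.sum_apply_sharp b e he ((g u) ∘L R)
  simp only [ContinuousLinearMap.comp_apply] at this
  rw [← Finset.sum_neg_distrib]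
  convert this using 1
  · refine Finset.sum_congr rfl fun i _ => ?_
    rw [hB.symm, hB.apply_inverse, hR]
    rfl
  · refine Finset.sum_congr rfl fun k _ => ?_
    rw [← hR, hg.curvature_skew hu, neg_inj]

end Curvature

section SecondVariation

variable {E : Type*} [NormedAddCommGroup E] [NormedSpace ℝ E] [FiniteDimensional ℝ E]
  {P : Type*} [NormedAddCommGroup P] [NormedSpace ℝ P] [FiniteDimensional ℝ P]
  {G : P → P →L[ℝ] P →L[ℝ] ℝ} {U : Set P} {g : E → E →L[ℝ] E →L[ℝ] ℝ} {V : Set E}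
  {A : P →L[ℝ] E}

/-- The metric trace of a bilinear map. -/
def metricTrace {F : Type*} [NormedAddCommGroup F] [NormedSpace ℝ F]
    (B : P →L[ℝ] P →L[ℝ] ℝ) (Q : P →L[ℝ] P →L[ℝ] F) : F :=
  ∑ i, Q (Module.finBasis ℝ P i)
    (B.inverse (LinearMap.toContinuousLinearMap ((Module.finBasis ℝ P).coord i)))

/-- The Hessian of a function on a vector space with a metric. -/
def localHessian {F : Type*} [NormedAddCommGroup F] [NormedSpace ℝ F]
    (G : P → P →L[ℝ] P →L[ℝ] ℝ) (f : P → F) (u : P) : P →L[ℝ] P →L[ℝ] F :=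
  fderiv ℝ (fderiv ℝ f) u
    - (ContinuousLinearMap.compL ℝ P P F (fderiv ℝ f u)) ∘L localChristoffel G u

/-- The Jacobi operator before taking the trace: the linearization of the second fundamental form
at the linear map `A` in the direction of `W`. -/
def localJacobi (G : P → P →L[ℝ] P →L[ℝ] ℝ) (g : E → E →L[ℝ] E →L[ℝ] ℝ) (A : P →L[ℝ] E)
    (W : P → E) (u : P) : P →L[ℝ] P →L[ℝ] E :=
  localHessian G W u
    + (fderiv ℝ (localChristoffel g) (A u) (W u)).bilinearComp A A
    + (localChristoffel g (A u)).bilinearComp (fderiv ℝ W u) A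
    + (localChristoffel g (A u)).bilinearComp A (fderiv ℝ W u)

/-- The density of the first variation of the bienergy at the linear map `A`, whose tension field is
`T`, in the direction of `W`. -/
def firstVariation (G : P → P →L[ℝ] P →L[ℝ] ℝ) (g : E → E →L[ℝ] E →L[ℝ] ℝ) (A : P →L[ℝ] E)
    (T W : P → E) (u : P) : ℝ :=
  g (A u) (T u) (metricTrace (G u) (localJacobi G g A W u) + localChristoffel g (A u) (W u) (T u))

theorem localHessian_apply {F : Type*} [NormedAddCommGroup F] [NormedSpace ℝ F]
    (f : P → F) (u v w : P) : localHessian G f u v w =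
      fderiv ℝ (fderiv ℝ f) u v w - fderiv ℝ f u (localChristoffel G u v w) := rfl

theorem localJacobi_apply (W : P → E) (u v w : P) : localJacobi G g A W u v w =
    fderiv ℝ (fderiv ℝ W) u v w - fderiv ℝ W u (localChristoffel G u v w)
      + fderiv ℝ (localChristoffel g) (A u) (W u) (A v) (A w)
      + localChristoffel g (A u) (fderiv ℝ W u v) (A w)
      + localChristoffel g (A u) (A v) (fderiv ℝ W u w) := rfl

theorem metricTrace_eq_sum {F : Type*} [NormedAddCommGroup F] [NormedSpace ℝ F]
    {B : P →L[ℝ] P →L[ℝ] ℝ} (hB : IsPosDefForm B) {κ : Type*} [Fintype κ] [DecidableEq κ]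
    (e : Module.Basis κ ℝ P) (he : ∀ i j, B (e i) (e j) = if i = j then 1 else 0)
    (Q : P →L[ℝ] P →L[ℝ] F) : metricTrace B Q = ∑ k, Q (e k) (e k) :=
  hB.sum_apply_sharp _ e he Q

theorem hasDerivAt_localTension (hg : IsMetricOn g V) {u : P} (hV : A u ∈ V) {W : P → E}
    (hW : ContDiffAt ℝ 2 W u) {s : ℝ → ℝ} (hs0 : s 0 = 0) (hs : HasDerivAt s 1 0) :
    HasDerivAt (fun t => localTension G g (fun x => A x + s t • W x) u)
      (metricTrace (G u) (localJacobi G g A W u)) 0 := by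
  have h1 : ∀ t, fderiv ℝ (fun x => A x + s t • W x) =ᶠ[nhds u]
      fun x => A + s t • fderiv ℝ W x := fun t => by
    filter_upwards [hW.eventually (by simp)] with x hx
    have hx' : HasFDerivAt (fun x => s t • W x) (s t • fderiv ℝ W x) x :=
      (hx.differentiableAt two_ne_zero).hasFDerivAt.const_smul (s t)
    exact (A.hasFDerivAt.add hx').fderiv
  have hW' : DifferentiableAt ℝ (fderiv ℝ W) u :=
    (hW.fderiv_right (m := 1) (by norm_num)).differentiableAt one_ne_zero
  have h2 : ∀ t, fderiv ℝ (fderiv ℝ (fun x => A x + s t • W x)) u =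
      s t • fderiv ℝ (fderiv ℝ W) u := fun t => by
    rw [(h1 t).fderiv_eq]
    have hx' : HasFDerivAt (fun x => s t • fderiv ℝ W x) (s t • fderiv ℝ (fderiv ℝ W) u) u :=
      hW'.hasFDerivAt.const_smul (s t)
    exact (hx'.const_add A).fderiv
  have hw : ∀ a b : E, HasDerivAt (fun t => a + s t • b) b 0 := fun a b => by
    simpa using (hs.smul_const b).const_add a
  have d0 : HasDerivAt (fun t => localChristoffel g (A u + s t • W u))
      (fderiv ℝ (localChristoffel g) (A u) (W u)) 0 := by
    refine HasFDerivAt.comp_hasDerivAt (l := localChristoffel g) 0 ?_ (hw (A u) (W u))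
    rw [hs0, zero_smul, add_zero]
    exact (hg.differentiableAt_christoffel hV).hasFDerivAt
  refine HasDerivAt.fun_sum fun i _ => ?_
  simp only [localSFF_apply, h2, (h1 _).self_of_nhds]
  generalize Module.finBasis ℝ P i = b
  generalize (G u).inverse _ = c
  have d1 := (d0.clm_apply (hw (A b) (fderiv ℝ W u b))).clm_apply (hw (A c) (fderiv ℝ W u c))
  have d2 := hw (-(A (localChristoffel G u b c)))
    (fderiv ℝ (fderiv ℝ W) u b c - fderiv ℝ W u (localChristoffel G u b c))
  refine ((d2.add d1).congr_deriv ?_).congr_of_eventuallyEq (Filter.Eventually.of_forall fun t => ?_)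
  · rw [localJacobi_apply]
    simp only [hs0, zero_smul, add_zero, add_apply]
    abel
  · simp only [add_apply, smul_apply, smul_sub, Pi.add_apply]
    abel

theorem hasDerivAt_tension_density (hg : IsMetricOn g V) {u : P} (hV : A u ∈ V) {W T : P → E}
    (hW : ContDiffAt ℝ 2 W u) (hT : localTension G g A u = T u) {s : ℝ → ℝ} (hs0 : s 0 = 0)
    (hs : HasDerivAt s 1 0) :
    HasDerivAt (fun t => g (A u + s t • W u) (localTension G g (fun x => A x + s t • W x) u)
      (localTension G g (fun x => A x + s t • W x) u)) (2 * firstVariation G g A T W u) 0 := by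
  have h1 := hasDerivAt_localTension (G := G) hg hV hW hs0 hs
  have h2 : HasDerivAt (fun t => A u + s t • W u) (W u) 0 := by
    simpa using (hs.smul_const (W u)).const_add (A u)
  have h3 : HasDerivAt (fun t => g (A u + s t • W u)) (fderiv ℝ g (A u) (W u)) 0 := by
    refine HasFDerivAt.comp_hasDerivAt (l := g) 0 ?_ h2
    rw [hs0, zero_smul, add_zero]
    exact (hg.differentiableAt hV).hasFDerivAt
  have h0 : localTension G g (fun x => A x + s 0 • W x) u = T u := by
    simpa [hs0] using hT
  refine ((h3.clm_apply h1).clm_apply h1).congr_deriv ?_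
  rw [h0, hs0, zero_smul, add_zero, firstVariation]
  simp only [map_add, add_apply]
  rw [hg.fderiv_eq hV, (hg.posDef _ hV).symm (metricTrace _ _),
    (hg.posDef _ hV).symm (localChristoffel _ _ _ _)]
  ring

theorem fderiv_half_normSq (hg : IsMetricOn g V) {u : P} (hV : A u ∈ V) {T : P → E}
    (hT : DifferentiableAt ℝ T u) (v : P) :
    fderiv ℝ (fun x => 1 / 2 * g (A x) (T x) (T x)) u v =
      g (A u) (T u) (fderiv ℝ T u v + localChristoffel g (A u) (A v) (T u)) := by
  have h := ((((hg.differentiableAt hV).hasFDerivAt.comp u A.hasFDerivAt).clm_apply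
    hT.hasFDerivAt).clm_apply hT.hasFDerivAt).const_mul (1 / 2)
  have h' := DFunLike.congr_fun h.fderiv v
  simp [hg.fderiv_eq hV] at h'
  rw [show (1 / 2 : ℝ) = 2⁻¹ by norm_num, h', map_add,
    (hg.posDef _ hV).symm (localChristoffel _ _ _ _), (hg.posDef _ hV).symm (fderiv ℝ T u v)]
  ring

theorem fderiv_fderiv_half_normSq (hg : IsMetricOn g V) {u : P} (hV : A u ∈ V) {T : P → E}
    (hT : ContDiffAt ℝ 2 T u) (v w : P) :
    fderiv ℝ (fderiv ℝ (fun x => 1 / 2 * g (A x) (T x) (T x))) u v w =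
      g (A u) (fderiv ℝ T u v + localChristoffel g (A u) (A v) (T u))
        (fderiv ℝ T u w + localChristoffel g (A u) (A w) (T u)) +
      g (A u) (T u) (fderiv ℝ (fderiv ℝ T) u v w
        + fderiv ℝ (localChristoffel g) (A u) (A v) (A w) (T u)
        + localChristoffel g (A u) (A w) (fderiv ℝ T u v)
        + localChristoffel g (A u) (A v) (fderiv ℝ T u w)
        + localChristoffel g (A u) (A v) (localChristoffel g (A u) (A w) (T u))) := by
  have hT' : DifferentiableAt ℝ (fderiv ℝ T) u :=
    (hT.fderiv_right (m := 1) (by norm_num)).differentiableAt one_ne_zero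
  have hT1 := (hT.differentiableAt two_ne_zero).hasFDerivAt
  have k1 := ((hg.differentiableAt_christoffel hV).hasFDerivAt.comp u A.hasFDerivAt)
  have k2 := (hT'.hasFDerivAt.clm_apply (hasFDerivAt_const w u)).add
    ((k1.clm_apply (hasFDerivAt_const (A w) u)).clm_apply hT1)
  have k3 := (((hg.differentiableAt hV).hasFDerivAt.comp u A.hasFDerivAt).clm_apply hT1).clm_apply
    k2
  have hc : ContDiffAt ℝ 2 (fun x => 1 / 2 * g (A x) (T x) (T x)) u :=
    contDiffAt_const.mul ((ContDiffAt.clm_apply (ContDiffAt.comp (g := g) u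
      ((hg.contDiffAt hV).of_le two_le_infty) A.contDiff.contDiffAt) hT).clm_apply hT)
  have hc' : DifferentiableAt ℝ (fderiv ℝ (fun x => 1 / 2 * g (A x) (T x) (T x))) u :=
    (hc.fderiv_right (m := 1) (by norm_num)).differentiableAt one_ne_zero
  have k4 := hc'.hasFDerivAt.clm_apply (hasFDerivAt_const w u)
  have k5 : (fun x => fderiv ℝ (fun x => 1 / 2 * g (A x) (T x) (T x)) x w) =ᶠ[nhds u] fun x =>
      g (A x) (T x) (fderiv ℝ T x w + localChristoffel g (A x) (A w) (T x)) := by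
    filter_upwards [A.continuous.continuousAt.eventually (hg.isOpen.mem_nhds hV),
      hT.eventually (by simp)] with x hx hx'
    exact fderiv_half_normSq hg hx (hx'.differentiableAt two_ne_zero) w
  have := DFunLike.congr_fun ((k4.congr_of_eventuallyEq k5.symm).unique k3) v
  simp [hg.fderiv_eq hV] at this
  rw [show (1 / 2 : ℝ) = 2⁻¹ by norm_num, this]
  simp only [map_add, add_apply]
  ring

/-- The first variation in the direction of a multiple of the tension field. -/
theorem firstVariation_smul (hG : IsMetricOn G U) (hg : IsMetricOn g V) {u : P} (hu : u ∈ U)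
    (hV : A u ∈ V) {T : P → E} (hT : ContDiffAt ℝ 2 T u) {f : P → ℝ} (hf : ContDiffAt ℝ 2 f u) :
    firstVariation G g A T (fun x => f x • T x) u =
      2 * (1 / 2 * g (A u) (T u) (T u) * metricTrace (G u) (localHessian G f u) +
        fderiv ℝ (fun x => 1 / 2 * g (A x) (T x) (T x)) u ((G u).inverse (fderiv ℝ f u))) +
      f u * firstVariation G g A T T u := by
  have hB := hG.posDef u hu
  have hBg := hg.posDef _ hV
  obtain ⟨e, he⟩ := hB.exists_orthonormal
  have hf' : DifferentiableAt ℝ (fderiv ℝ f) u :=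
    (hf.fderiv_right (m := 1) (by norm_num)).differentiableAt one_ne_zero
  have hT' : DifferentiableAt ℝ (fderiv ℝ T) u :=
    (hT.fderiv_right (m := 1) (by norm_num)).differentiableAt one_ne_zero
  have h1 : fderiv ℝ (fun x => f x • T x) =ᶠ[nhds u]
      fun x => f x • fderiv ℝ T x + (fderiv ℝ f x).smulRight (T x) := by
    filter_upwards [hT.eventually (by simp), hf.eventually (by simp)] with x hx hx'
    exact fderiv_fun_smul (hx'.differentiableAt two_ne_zero) (hx.differentiableAt two_ne_zero)
  have h1' : ∀ v, fderiv ℝ (fun x => f x • T x) u v =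
      f u • fderiv ℝ T u v + fderiv ℝ f u v • T u := fun v => by
    rw [h1.self_of_nhds]
    rfl
  have h2 : ∀ v, fderiv ℝ (fderiv ℝ (fun x => f x • T x)) u v v =
      f u • fderiv ℝ (fderiv ℝ T) u v v + (2 * fderiv ℝ f u v) • fderiv ℝ T u v +
        fderiv ℝ (fderiv ℝ f) u v v • T u := fun v => by
    have hc : ContDiffAt ℝ 2 (fun x => f x • T x) u := hf.smul hT
    have hc' : DifferentiableAt ℝ (fderiv ℝ (fun x => f x • T x)) u :=
      (hc.fderiv_right (m := 1) (by norm_num)).differentiableAt one_ne_zero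
    have k1 := hc'.hasFDerivAt.clm_apply (hasFDerivAt_const v u)
    have k2 := ((hf.differentiableAt two_ne_zero).hasFDerivAt.smul
      (hT'.hasFDerivAt.clm_apply (hasFDerivAt_const v u))).add
      ((hf'.hasFDerivAt.clm_apply (hasFDerivAt_const v u)).smul
        (hT.differentiableAt two_ne_zero).hasFDerivAt)
    have k3 : (fun x => fderiv ℝ (fun x => f x • T x) x v) =ᶠ[nhds u]
        fun x => f x • fderiv ℝ T x v + fderiv ℝ f x v • T x := by
      filter_upwards [h1] with x hx
      rw [hx]
      rfl
    have := DFunLike.congr_fun ((k1.congr_of_eventuallyEq k3.symm).unique k2) v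
    simp at this
    rw [this, two_mul, add_smul]
    abel
  have hY := hB.inverse_eq_sum e he (fderiv ℝ f u)
  have hJ : ∀ k, localJacobi G g A (fun x => f x • T x) u (e k) (e k) =
      f u • localJacobi G g A T u (e k) (e k) + localHessian G f u (e k) (e k) • T u +
        (2 * fderiv ℝ f u (e k)) •
          (fderiv ℝ T u (e k) + localChristoffel g (A u) (A (e k)) (T u)) := fun k => by
    rw [localJacobi_apply, localJacobi_apply, localHessian_apply, h2, h1', h1']
    simp only [map_add, map_smul, add_apply, smul_apply,
      hg.christoffel_symm hV (T u) (A _), hg.christoffel_symm hV (fderiv ℝ T u _) (A _)]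
    module
  have hU := fun k => fderiv_half_normSq hg hV (hT.differentiableAt two_ne_zero) (e k)
  obtain ⟨N, hN⟩ : ∃ N : Fin (Module.finrank ℝ P) → E, ∀ k, fderiv ℝ T u (e k) +
      localChristoffel g (A u) (A (e k)) (T u) = N k := ⟨_, fun _ => rfl⟩
  simp only [hN] at hJ hU
  rw [firstVariation, firstVariation, hY, metricTrace_eq_sum hB e he, metricTrace_eq_sum hB e he,
    metricTrace_eq_sum hB e he, map_sum]
  simp only [map_smul, smul_eq_mul, hU, hJ, Finset.sum_add_distrib, ← Finset.smul_sum, ← Finset.sum_smul, map_add, smul_apply,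
    map_sum, Finset.mul_sum, mul_assoc]
  simp only [← mul_assoc, ← Finset.mul_sum]
  ring_nf
  simp only [Finset.sum_mul]

/-- The Bochner formula for the first variation in the direction of the tension field. -/
theorem firstVariation_self (hG : IsMetricOn G U) (hg : IsMetricOn g V) {u : P} (hu : u ∈ U)
    (hV : A u ∈ V) {T : P → E} (hT : ContDiffAt ℝ 2 T u) (hTt : localTension G g A u = T u)
    {κ : Type*} [Fintype κ] [DecidableEq κ] (e : Module.Basis κ ℝ P)
    (he : ∀ i j, G u (e i) (e j) = if i = j then 1 else 0) :
    firstVariation G g A T T u =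
      metricTrace (G u) (localHessian G (fun x => 1 / 2 * g (A x) (T x) (T x)) u) -
      ∑ k, g (A u) (fderiv ℝ T u (e k) + localChristoffel g (A u) (A (e k)) (T u))
        (fderiv ℝ T u (e k) + localChristoffel g (A u) (A (e k)) (T u)) -
      ∑ k, g (A u) (T u) (localCurvature g (A u) (A (e k)) (T u) (A (e k))) := by
  have hB := hG.posDef u hu
  have hTt' : T u = ∑ k, (localChristoffel g (A u) (A (e k)) (A (e k)) -
      A (localChristoffel G u (e k) (e k))) := by
    rw [← hTt, localTension_eq_sum _ _ hB e he]
    refine Finset.sum_congr rfl fun k _ => ?_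
    have hA : fderiv ℝ A = fun _ => A := by
      ext1 x
      exact A.fderiv
    rw [localSFF_apply, hA]
    simp
    abel
  have hTT : g (A u) (T u) (localChristoffel g (A u) (T u) (T u)) =
      ∑ k, (g (A u) (T u) (localChristoffel g (A u) (T u)
          (localChristoffel g (A u) (A (e k)) (A (e k)))) -
        g (A u) (T u) (localChristoffel g (A u) (A (localChristoffel G u (e k) (e k))) (T u))) := by
    conv_lhs => enter [2, 2]; rw [hTt']
    rw [map_sum, map_sum]
    refine Finset.sum_congr rfl fun k _ => ?_
    rw [map_sub, map_sub, hg.christoffel_symm hV (T u) (A _)]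
  rw [firstVariation, metricTrace_eq_sum hB e he, metricTrace_eq_sum hB e he, map_add, hTT, map_sum,
    ← Finset.sum_add_distrib, ← Finset.sum_sub_distrib, ← Finset.sum_sub_distrib]
  refine Finset.sum_congr rfl fun k _ => ?_
  rw [localJacobi_apply, localHessian_apply, fderiv_fderiv_half_normSq hg hV hT,
    fderiv_half_normSq hg hV (hT.differentiableAt two_ne_zero), localCurvature,
    hg.fderiv_christoffel_symm hV (A (e k)) (T u) (A (e k)),
    hg.christoffel_symm hV (fderiv ℝ T u (e k)) (A (e k)),
    hg.christoffel_symm hV (A (e k)) (T u)]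
  simp only [map_add, map_sub]
  ring

end SecondVariation

section MaximumPrinciple

variable {E : Type*} [NormedAddCommGroup E] [NormedSpace ℝ E] [FiniteDimensional ℝ E]
  {E' : Type*} [NormedAddCommGroup E'] [NormedSpace ℝ E'] [FiniteDimensional ℝ E']
  {P : Type*} [NormedAddCommGroup P] [NormedSpace ℝ P] [FiniteDimensional ℝ P]

theorem fderiv_fderiv_self_nonpos {f : P → ℝ} {u : P} (hf : ContDiffAt ℝ 2 f u)
    (hu : IsLocalMax f u) (v : P) : fderiv ℝ (fderiv ℝ f) u v v ≤ 0 := by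
  by_contra! h
  let c : ℝ → P := fun t => u + t • v
  have hc : ∀ t, HasDerivAt c v t := fun t => by
    simpa [c] using ((hasDerivAt_id t).smul_const v).const_add u
  have hc0 : c 0 = u := by simp [c]
  have hcc : Filter.Tendsto c (nhds 0) (nhds u) := by
    have := (hc 0).continuousAt
    rwa [ContinuousAt, hc0] at this
  have hf' : DifferentiableAt ℝ (fderiv ℝ f) u :=
    (hf.fderiv_right (m := 1) (by norm_num)).differentiableAt one_ne_zero
  have d1 : deriv (f ∘ c) =ᶠ[nhds 0] fun t => fderiv ℝ f (c t) v := by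
    filter_upwards [hcc.eventually (hf.eventually (by simp))] with t ht
    exact ((ht.differentiableAt two_ne_zero).hasFDerivAt.comp_hasDerivAt t (hc t)).deriv
  have d2 : deriv (deriv (f ∘ c)) 0 = fderiv ℝ (fderiv ℝ f) u v v := by
    rw [d1.deriv_eq]
    have k : HasFDerivAt (fderiv ℝ f) (fderiv ℝ (fderiv ℝ f) u) (c 0) := by
      rw [hc0]
      exact hf'.hasFDerivAt
    have := (k.comp_hasDerivAt 0 (hc 0)).clm_apply (hasDerivAt_const 0 v)
    simpa using this.deriv
  have hmax : IsLocalMax (f ∘ c) 0 := by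
    have : ∀ᶠ t in nhds 0, f (c t) ≤ f (c 0) := by
      rw [hc0]
      exact hcc.eventually hu
    exact this
  have hcont : ContinuousAt (f ∘ c) 0 := by
    refine ContinuousAt.comp ?_ (hc 0).continuousAt
    rw [hc0]
    exact hf.continuousAt
  have hmin := isLocalMin_of_deriv_deriv_pos (d2 ▸ h) hmax.deriv_eq_zero hcont
  have hconst : f ∘ c =ᶠ[nhds 0] fun _ => f (c 0) := by
    filter_upwards [hmax, hmin] with t h1 h2
    exact le_antisymm h1 h2
  have : deriv (deriv (f ∘ c)) 0 = 0 := by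
    rw [hconst.deriv.deriv_eq]
    simp
  rw [d2] at this
  exact h.ne' this

theorem metricTrace_localHessian_nonpos {G : P → P →L[ℝ] P →L[ℝ] ℝ} {f : P → ℝ} {u : P}
    (hG : IsPosDefForm (G u)) (hf : ContDiffAt ℝ 2 f u) (hu : IsLocalMax f u) :
    metricTrace (G u) (localHessian G f u) ≤ 0 := by
  obtain ⟨e, he⟩ := hG.exists_orthonormal
  rw [metricTrace_eq_sum hG e he]
  refine Finset.sum_nonpos fun k _ => ?_
  rw [localHessian_apply, hu.fderiv_eq_zero, zero_apply, sub_zero]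
  exact fderiv_fderiv_self_nonpos hf hu _

variable {G : E × E' → E × E' →L[ℝ] E × E' →L[ℝ] ℝ} {U : Set (E × E')}
  {g : E → E →L[ℝ] E →L[ℝ] ℝ} {V : Set E} {h : E' → E' →L[ℝ] E' →L[ℝ] ℝ}
  {μ : E → ℝ}

theorem firstVariation_self_neg (hG : IsMetricOn G U) (hg : IsMetricOn g V) {u : E × E'}
    (hu : u ∈ U) (hV : u.1 ∈ V) (hh : IsPosDefForm (h u.2))
    (H : ∀ v w, G u v w = g u.1 v.1 w.1 + Real.exp (2 * μ u.1) * h u.2 v.2 w.2)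
    {T : E × E' → E} (hT : ContDiffAt ℝ 2 T u) (hTt : localTension G g Prod.fst u = T u)
    (hmax : IsLocalMax (fun x => 1 / 2 * g x.1 (T x) (T x)) u)
    (hRic : ∑ i, (Module.finBasis ℝ E).coord i
      (localCurvature g u.1 (Module.finBasis ℝ E i) (T u) (T u)) < 0) :
    firstVariation G g (ContinuousLinearMap.fst ℝ E E') T T u < 0 := by
  obtain ⟨e₁, e, he₁, he, hl, hr, -⟩ := exists_orthonormal_warped (hg.posDef _ hV) hh H
  have hc : ContDiffAt ℝ 2 (fun x => 1 / 2 * g x.1 (T x) (T x)) u :=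
    contDiffAt_const.mul ((ContDiffAt.clm_apply (ContDiffAt.comp (g := g) u
      ((hg.contDiffAt hV).of_le two_le_infty) contDiffAt_fst) hT).clm_apply hT)
  have h1 := metricTrace_localHessian_nonpos (hG.posDef u hu) hc hmax
  rw [hg.sum_curvature hV _ e₁ he₁] at hRic
  rw [firstVariation_self hG hg (A := ContinuousLinearMap.fst ℝ E E') hu hV hT hTt e he]
  have h2 : ∀ k, 0 ≤ g u.1 (fderiv ℝ T u (e k) + localChristoffel g u.1 (e k).1 (T u))
      (fderiv ℝ T u (e k) + localChristoffel g u.1 (e k).1 (T u)) := fun k =>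
    (hg.posDef _ hV).nonneg _
  have h3 := Finset.sum_nonneg fun k (_ : k ∈ Finset.univ) => h2 k
  have h4 : ∑ k, g u.1 (T u) (localCurvature g u.1 (e k).1 (T u) (e k).1) =
      ∑ k, g u.1 (T u) (localCurvature g u.1 (e₁ k) (T u) (e₁ k)) := by
    rw [Fintype.sum_sum_type]
    simp only [hl, hr]
    simp [localCurvature]
  simp only [ContinuousLinearMap.coe_fst'] at h4 ⊢
  linarith

end MaximumPrinciple

section Divergence

variable {P : Type*} [NormedAddCommGroup P] [NormedSpace ℝ P] [FiniteDimensional ℝ P]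
  {G : P → P →L[ℝ] P →L[ℝ] ℝ} {U : Set P}

/-- The Gram determinant of a bilinear form in the standard basis. -/
def gramDet (B : P →L[ℝ] P →L[ℝ] ℝ) : ℝ :=
  Matrix.det (Matrix.of fun i j => B (Module.finBasis ℝ P i) (Module.finBasis ℝ P j))

theorem gramDet_comp (B : P →L[ℝ] P →L[ℝ] ℝ) (A : P →L[ℝ] P) :
    Matrix.det (Matrix.of fun i j => B (A (Module.finBasis ℝ P i)) (A (Module.finBasis ℝ P j))) =
      A.det ^ 2 * gramDet B := by
  let b := Module.finBasis ℝ P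
  let B' : P →ₗ[ℝ] P →ₗ[ℝ] ℝ := LinearMap.mk₂ ℝ (fun v w => B v w)
    (by simp) (by simp) (by simp) (by simp)
  have h1 := LinearMap.toMatrix₂_compl₁₂ b b b b B' (A : P →ₗ[ℝ] P) (A : P →ₗ[ℝ] P)
  have h2 : Matrix.of (fun i j => B (A (b i)) (A (b j))) =
      LinearMap.toMatrix₂ b b (B'.compl₁₂ (A : P →ₗ[ℝ] P) (A : P →ₗ[ℝ] P)) := by
    ext i j
    simp [LinearMap.toMatrix₂_apply, B']
  have h3 : Matrix.of (fun i j => B (b i) (b j)) = LinearMap.toMatrix₂ b b B' := by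
    ext i j
    simp [LinearMap.toMatrix₂_apply, B']
  rw [gramDet]
  change Matrix.det (Matrix.of fun i j => B (A (b i)) (A (b j))) =
    A.det ^ 2 * Matrix.det (Matrix.of fun i j => B (b i) (b j))
  rw [h2, h3, h1, Matrix.det_mul, Matrix.det_mul, Matrix.det_transpose, LinearMap.det_toMatrix]
  change LinearMap.det _ * _ * LinearMap.det _ = LinearMap.det _ ^ 2 * _
  ring

theorem exists_gramDet_eq (e : Module.Basis (Fin (Module.finrank ℝ P)) ℝ P) :
    ∃ c : ℝ, ∀ B : P →L[ℝ] P →L[ℝ] ℝ,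
      Matrix.det (Matrix.of fun i j => B (e i) (e j)) = c ^ 2 * gramDet B := by
  let A : P →L[ℝ] P := LinearMap.toContinuousLinearMap
    ((Module.finBasis ℝ P).equiv e (Equiv.refl _) : P →ₗ[ℝ] P)
  have hA : ∀ i, A (Module.finBasis ℝ P i) = e i := fun i => by simp [A]
  exact ⟨A.det, fun B => by rw [← gramDet_comp]; simp only [hA]⟩

theorem IsPosDefForm.gramDet_pos {B : P →L[ℝ] P →L[ℝ] ℝ} (hB : IsPosDefForm B) :
    0 < gramDet B := by
  obtain ⟨e, he⟩ := hB.exists_orthonormal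
  obtain ⟨c, hc⟩ := exists_gramDet_eq e
  have h1 : Matrix.of (fun i j => B (e i) (e j)) = 1 := by
    ext i j
    rw [Matrix.of_apply, he, Matrix.one_apply]
  have := hc B
  rw [h1, Matrix.det_one] at this
  by_contra! hn
  nlinarith [sq_nonneg c]

/-- The density of the Riemannian volume with respect to the Lebesgue measure. -/
def volumeDensity (G : P → P →L[ℝ] P →L[ℝ] ℝ) (u : P) : ℝ := √(gramDet (G u))

theorem volumeDensity_nonneg (G : P → P →L[ℝ] P →L[ℝ] ℝ) (u : P) : 0 ≤ volumeDensity G u :=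
  Real.sqrt_nonneg _

theorem contDiff_det {ι : Type*} [Fintype ι] [DecidableEq ι] :
    ContDiff ℝ ∞ fun A : ι → ι → ℝ => Matrix.det (Matrix.of A) := by
  simp only [Matrix.det_apply, Matrix.of_apply]
  fun_prop

theorem fderiv_det_one {ι : Type*} [Fintype ι] [DecidableEq ι] {A₁ : ι → ι → ℝ}
    (h₁ : Matrix.of A₁ = 1) (A : ι → ι → ℝ) :
    fderiv ℝ (fun A : ι → ι → ℝ => Matrix.det (Matrix.of A)) A₁ A = ∑ i, A i i := by
  have hd : DifferentiableAt ℝ (fun A : ι → ι → ℝ => Matrix.det (Matrix.of A)) (A₁ + (0 : ℝ) • A) :=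
    contDiff_det.contDiffAt.differentiableAt (by simp)
  have hl : HasDerivAt (fun t : ℝ => A₁ + t • A) A 0 := by
    simpa using ((hasDerivAt_id (0 : ℝ)).smul_const A).const_add A₁
  have h1 := hd.hasFDerivAt.comp_hasDerivAt 0 hl
  obtain ⟨q, hq⟩ : ∃ q : Polynomial ℝ, ∀ t : ℝ, (1 + t • Matrix.of A).det =
      1 + (Matrix.of A).trace * t + q.eval t * t ^ 2 :=
    ⟨_, fun t => Matrix.det_one_add_smul t (Matrix.of A)⟩
  have h2 : ∀ t : ℝ, Matrix.det (Matrix.of (A₁ + t • A)) =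
      1 + (∑ i, A i i) * t + q.eval t * t ^ 2 := fun t => by
    rw [← Matrix.of_add_of, ← Matrix.smul_of, h₁, hq]
    rfl
  have h3 : HasDerivAt (fun t : ℝ => Matrix.det (Matrix.of (A₁ + t • A))) (∑ i, A i i) 0 := by
    simp only [h2]
    have k1 := ((hasDerivAt_id (0 : ℝ)).const_mul (∑ i, A i i)).const_add 1
    have k2 := (q.hasDerivAt 0).mul (hasDerivAt_pow 2 (0 : ℝ))
    exact (k1.add k2).congr_deriv (by simp)
  have := h1.unique h3
  simpa using this

theorem IsMetricOn.contDiffAt_gramDet (hG : IsMetricOn G U) {u : P} (hu : u ∈ U) :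
    ContDiffAt ℝ ∞ (fun x => gramDet (G x)) u := by
  refine contDiff_det.contDiffAt.comp u (contDiffAt_pi.2 fun i => contDiffAt_pi.2 fun j => ?_)
  exact ((hG.contDiffAt hu).clm_apply contDiffAt_const).clm_apply contDiffAt_const

theorem IsMetricOn.contDiffAt_volumeDensity (hG : IsMetricOn G U) {u : P} (hu : u ∈ U) :
    ContDiffAt ℝ ∞ (volumeDensity G) u :=
  (hG.contDiffAt_gramDet hu).sqrt (hG.posDef u hu).gramDet_pos.ne'

theorem IsMetricOn.volumeDensity_pos (hG : IsMetricOn G U) {u : P} (hu : u ∈ U) :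
    0 < volumeDensity G u := Real.sqrt_pos.2 (hG.posDef u hu).gramDet_pos

theorem IsMetricOn.fderiv_volumeDensity (hG : IsMetricOn G U) {u : P} (hu : u ∈ U)
    (e : Module.Basis (Fin (Module.finrank ℝ P)) ℝ P)
    (he : ∀ i j, G u (e i) (e j) = if i = j then 1 else 0) (v : P) :
    fderiv ℝ (volumeDensity G) u v =
      1 / 2 * volumeDensity G u * ∑ k, fderiv ℝ G u v (e k) (e k) := by
  obtain ⟨c, hc⟩ := exists_gramDet_eq e
  have hp := (hG.posDef u hu).gramDet_pos
  have hm : Matrix.of (fun i j => G u (e i) (e j)) = 1 := by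
    ext i j
    rw [Matrix.of_apply, he, Matrix.one_apply]
  have hc1 : c ^ 2 * gramDet (G u) = 1 := by rw [← hc, hm, Matrix.det_one]
  have hd : HasFDerivAt (fun x => gramDet (G x)) (fderiv ℝ (fun x => gramDet (G x)) u) u :=
    ((hG.contDiffAt_gramDet hu).differentiableAt (by simp)).hasFDerivAt
  have h1 := hd.const_mul (c ^ 2)
  simp only [← hc] at h1
  have hG' := (hG.differentiableAt hu).hasFDerivAt
  have hi : HasFDerivAt (fun x i j => G x (e i) (e j)) (ContinuousLinearMap.pi fun i =>
      ContinuousLinearMap.pi fun j => ((fderiv ℝ G u).flip (e i)).flip (e j)) u := by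
    refine hasFDerivAt_pi.2 fun i => hasFDerivAt_pi.2 fun j => ?_
    refine ((hG'.clm_apply (hasFDerivAt_const (e i) u)).clm_apply
      (hasFDerivAt_const (e j) u)).congr_fderiv ?_
    ext v
    simp
  have h2 := ((contDiff_det (ι := Fin (Module.finrank ℝ P))).contDiffAt.differentiableAt
    (by simp)).hasFDerivAt.comp u hi
  have h3 := DFunLike.congr_fun (h1.unique h2) v
  simp only [smul_apply, smul_eq_mul, ContinuousLinearMap.comp_apply] at h3
  rw [fderiv_det_one hm] at h3
  simp only [ContinuousLinearMap.pi_apply, ContinuousLinearMap.flip_apply] at h3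
  have h4 : fderiv ℝ (fun x => gramDet (G x)) u v =
      gramDet (G u) * ∑ k, fderiv ℝ G u v (e k) (e k) := by
    rw [← h3]
    linear_combination (-(fderiv ℝ (fun x => gramDet (G x)) u v)) * hc1
  have h5 : HasFDerivAt (volumeDensity G) _ u := hd.sqrt hp.ne'
  rw [h5.fderiv, smul_apply, smul_eq_mul, h4, volumeDensity]
  have h6 := Real.sq_sqrt hp.le
  have h7 := (Real.sqrt_pos.2 hp).ne'
  field_simp
  rw [h6]

/-- The divergence of a multiple of a gradient. -/
theorem sum_coord_fderiv_gradient (hG : IsMetricOn G U) {u : P} (hu : u ∈ U) {f φ : P → ℝ}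
    (hf : ContDiffAt ℝ 2 f u) (hφ : DifferentiableAt ℝ φ u) :
    ∑ i, (Module.finBasis ℝ P).coord i (fderiv ℝ (fun x => (volumeDensity G x * φ x) •
        (G x).inverse (fderiv ℝ f x)) u (Module.finBasis ℝ P i)) =
      (φ u * metricTrace (G u) (localHessian G f u) +
        fderiv ℝ φ u ((G u).inverse (fderiv ℝ f u))) * volumeDensity G u := by
  have hB := hG.posDef u hu
  obtain ⟨e, he⟩ := hB.exists_orthonormal
  have hf' : DifferentiableAt ℝ (fderiv ℝ f) u :=
    (hf.fderiv_right (m := 1) (by norm_num)).differentiableAt one_ne_zero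
  have hi : DifferentiableAt ℝ (fun x => (G x).inverse) u :=
    (hG.contDiffAt_inverse hu).differentiableAt (by simp)
  have hw : DifferentiableAt ℝ (volumeDensity G) u :=
    (hG.contDiffAt_volumeDensity hu).differentiableAt (by simp)
  obtain ⟨Y, hY⟩ : ∃ Y : P → P, Y = fun x => (G x).inverse (fderiv ℝ f x) := ⟨_, rfl⟩
  have hYd : DifferentiableAt ℝ Y u := by
    rw [hY]
    exact hi.clm_apply hf'
  have hGY : ∀ z, G u (Y u) z = fderiv ℝ f u z := fun z => by rw [hY, hB.apply_inverse]
  have hGY' : ∀ v z, G u (fderiv ℝ Y u v) z =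
      fderiv ℝ (fderiv ℝ f) u v z - fderiv ℝ G u v (Y u) z := fun v z => by
    have k1 := ((hG.differentiableAt hu).hasFDerivAt.clm_apply hYd.hasFDerivAt).clm_apply
      (hasFDerivAt_const z u)
    have k2 := hf'.hasFDerivAt.clm_apply (hasFDerivAt_const z u)
    have k3 : (fun x => G x (Y x) z) =ᶠ[nhds u] fun x => fderiv ℝ f x z := by
      filter_upwards [hG.isOpen.mem_nhds hu] with x hx
      rw [hY, (hG.posDef x hx).apply_inverse]
    have := DFunLike.congr_fun ((k1.congr_of_eventuallyEq k3.symm).unique k2) v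
    simp at this
    linarith
  have hYu : (G u).inverse (fderiv ℝ f u) = Y u := by rw [hY]
  have hYe : Y u = ∑ k, fderiv ℝ f u (e k) • e k := by
    rw [← hYu, hB.inverse_eq_sum e he]
  have hF := (hw.hasFDerivAt.mul hφ.hasFDerivAt).smul hYd.hasFDerivAt
  have htr : ∑ i, (Module.finBasis ℝ P).coord i
      (fderiv ℝ (fun x => (volumeDensity G x * φ x) • Y x) u (Module.finBasis ℝ P i)) =
      ∑ k, G u (fderiv ℝ (fun x => (volumeDensity G x * φ x) • Y x) u (e k)) (e k) := by
    refine Eq.trans ?_ (hB.sum_apply_sharp (Module.finBasis ℝ P) e he ((G u) ∘L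
      fderiv ℝ (fun x => (volumeDensity G x * φ x) • Y x) u))
    refine Finset.sum_congr rfl fun i _ => ?_
    rw [ContinuousLinearMap.comp_apply, hB.symm, hB.apply_inverse]
    rfl
  have hFe : ∀ k, G u (fderiv ℝ (fun x => (volumeDensity G x * φ x) • Y x) u (e k)) (e k) =
      volumeDensity G u * φ u * (fderiv ℝ (fderiv ℝ f) u (e k) (e k)
        - fderiv ℝ G u (e k) (Y u) (e k)) + φ u * (fderiv ℝ f u (e k) *
          fderiv ℝ (volumeDensity G) u (e k)) +
        volumeDensity G u * (fderiv ℝ f u (e k) * fderiv ℝ φ u (e k)) := fun k => by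
    have := DFunLike.congr_fun hF.fderiv (e k)
    simp only [Pi.mul_apply] at this
    erw [this]
    simp [hGY, hGY']
    ring
  have hw1 : ∑ k, fderiv ℝ f u (e k) * fderiv ℝ (volumeDensity G) u (e k) =
      1 / 2 * volumeDensity G u * ∑ k, fderiv ℝ G u (Y u) (e k) (e k) := by
    rw [← hG.fderiv_volumeDensity hu e he, hYe, map_sum]
    simp only [map_smul, smul_eq_mul]
  have hφ1 : fderiv ℝ φ u (Y u) = ∑ k, fderiv ℝ f u (e k) * fderiv ℝ φ u (e k) := by
    rw [hYe, map_sum]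
    simp only [map_smul, smul_eq_mul]
  have hΓ : ∀ k, fderiv ℝ f u (localChristoffel G u (e k) (e k)) =
      fderiv ℝ G u (e k) (Y u) (e k) - 1 / 2 * fderiv ℝ G u (Y u) (e k) (e k) := fun k => by
    rw [← hGY, hB.symm, hG.koszul hu, hG.fderiv_symm hu (e k) (Y u)]
    ring
  have hYx : ∀ x, (G x).inverse (fderiv ℝ f x) = Y x := fun x => by rw [hY]
  simp only [hYx]
  rw [htr, metricTrace_eq_sum hB e he, hφ1]
  simp only [hFe, localHessian_apply, hΓ, Finset.sum_add_distrib, Finset.sum_sub_distrib,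
    ← Finset.mul_sum, hw1]
  ring

variable [MeasurableSpace P] [BorelSpace P]

theorem integral_divergence_eq_zero {F : P → P} (hF : ContDiff ℝ 1 F) (hc : HasCompactSupport F)
    {ι : Type*} [Fintype ι] (b : Module.Basis ι ℝ P) (μ : Measure P) [μ.IsAddHaarMeasure] :
    ∫ x, ∑ i, b.coord i (fderiv ℝ F x (b i)) ∂μ = 0 := by
  let L : ι → P →L[ℝ] ℝ := fun i => LinearMap.toContinuousLinearMap (b.coord i)
  have hF' : Continuous fun x => fderiv ℝ F x := hF.continuous_fderiv one_ne_zero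
  have hi : ∀ i, Integrable (fun x => L i (fderiv ℝ F x (b i))) μ := fun i =>
    ((L i).continuous.comp (hF'.clm_apply continuous_const)).integrable_of_hasCompactSupport
      ((hc.fderiv_apply ℝ (b i)).comp_left (map_zero (L i)))
  have hd : ∀ i x, fderiv ℝ (fun y => L i (F y)) x (b i) = L i (fderiv ℝ F x (b i)) := fun i x => by
    have := (L i).hasFDerivAt.comp x (hF.differentiable one_ne_zero x).hasFDerivAt
    exact DFunLike.congr_fun this.fderiv (b i)
  refine (integral_finsetSum _ fun i _ => hi i).trans (Finset.sum_eq_zero fun i _ => ?_)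
  have hi' : Integrable (fun y => L i (F y)) μ :=
    ((L i).continuous.comp hF.continuous).integrable_of_hasCompactSupport
      (hc.comp_left (map_zero (L i)))
  have := integral_mul_fderiv_eq_neg_fderiv_mul_of_integrable (𝕜 := ℝ) (μ := μ)
    (f := fun _ : P => (1 : ℝ)) (g := fun y => L i (F y)) (v := b i) (by simp)
    (by simpa [hd] using hi i) (by simpa using hi') (fun _ _ => differentiableAt_const _)
    (fun x _ => (L i).differentiableAt.comp x (hF.differentiable one_ne_zero x))
  simp only [hd, one_mul] at this
  refine this.trans ?_
  simp

end Divergence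

section Charts

variable {E : Type*} [NormedAddCommGroup E] [NormedSpace ℝ E]
  {H : Type*} [TopologicalSpace H] {I : ModelWithCorners ℝ E H} [I.Boundaryless]
  {M : Type*} [TopologicalSpace M] [ChartedSpace H M] [IsManifold I ∞ M]

theorem chartMetric_apply (g : Metric I M) (p : M) (u v w : E) :
    chartMetric g p u v w = g.inner ((extChartAt I p).symm u)
      (mfderiv 𝓘(ℝ, E) I (extChartAt I p).symm u v)
      (mfderiv 𝓘(ℝ, E) I (extChartAt I p).symm u w) := by
  rw [← mfderivWithin_univ, ← I.range_eq_univ]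
  rfl

theorem mdifferentiableAt_extChartAt_symm {p : M} {u : E} (hu : u ∈ (extChartAt I p).target) :
    MDifferentiableAt 𝓘(ℝ, E) I (extChartAt I p).symm u :=
  ((contMDiffOn_extChartAt_symm (n := ∞) p u hu).contMDiffAt
    ((isOpen_extChartAt_target p).mem_nhds hu)).mdifferentiableAt (by simp)

theorem mfderiv_symm_injective {p : M} {u : E} (hu : u ∈ (extChartAt I p).target) :
    Function.Injective (mfderiv 𝓘(ℝ, E) I (extChartAt I p).symm u) := by
  rw [← mfderivWithin_univ, ← I.range_eq_univ]
  obtain ⟨e, he⟩ := isInvertible_mfderivWithin_extChartAt_symm (I := I) hu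
  rw [← he]
  exact e.injective

theorem inner_congr (g : Metric I M) {x y : M} (h : x = y) {a b a' b' : E} (ha : a = a')
    (hb : b = b') : g.inner x a b = g.inner y a' b' := by
  subst h ha hb
  rfl

theorem inCoordinates_metric (g : Metric I M) (p x : M) (hx : x ∈ (chartAt H p).source) (v w : E) :
    ContinuousLinearMap.inCoordinates E (TangentSpace I) (E →L[ℝ] ℝ)
      (fun x : M => TangentSpace I x →L[ℝ] ℝ) p x p x (g.inner x) v w =
      chartMetric g p (extChartAt I p x) v w := by
  have k1 := inCoordinates_apply_eq₂ (F₁ := E) (F₂ := E) (F₃ := ℝ)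
    (E₁ := TangentSpace I) (E₂ := TangentSpace I) (E₃ := Bundle.Trivial M ℝ)
    (x₀ := p) (x := x) (ϕ := g.inner x) (v := v) (w := w) hx hx (Set.mem_univ _)
  replace k1 := k1.trans (triv_line _ _ _)
  have a := fun u => (trivializationAt E (TangentSpace I) p).symmL_apply (R := ℝ) hx u
  refine k1.trans ?_
  have hl : (extChartAt I p).symm (extChartAt I p x) = x :=
    (extChartAt I p).left_inv (by simpa using hx)
  have hs := fun u : E => DFunLike.congr_fun (TangentBundle.symmL_trivializationAt (𝕜 := ℝ) (I := I) hx) u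
  exact inner_congr g hl.symm ((a v).symm.trans (hs v)) ((a w).symm.trans (hs w))

theorem isMetricOn_chartMetric (g : Metric I M) (p : M) :
    IsMetricOn (chartMetric g p) (extChartAt I p).target where
  isOpen := isOpen_extChartAt_target p
  posDef u hu :=
    { symm := fun v w => by
        rw [chartMetric_apply, chartMetric_apply]
        exact g.symm _ _ _
      pos := fun v hv => by
        rw [chartMetric_apply]
        exact g.pos _ _ fun h => hv (mfderiv_symm_injective hu
          (h.trans (map_zero (mfderiv 𝓘(ℝ, E) I (extChartAt I p).symm u)).symm)) }
  contDiffOn := by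
    rw [← contMDiffOn_iff_contDiffOn]
    have h1 : ContMDiffOn I 𝓘(ℝ, E →L[ℝ] E →L[ℝ] ℝ) ∞ (fun x =>
        ContinuousLinearMap.inCoordinates E (TangentSpace I) (E →L[ℝ] ℝ)
          (fun x : M => TangentSpace I x →L[ℝ] ℝ) p x p x (g.inner x)) (chartAt H p).source := by
      intro x hx
      have := (Bundle.Trivialization.contMDiffAt_iff (n := ∞) (IB := I)
        (e := trivializationAt (E →L[ℝ] E →L[ℝ] ℝ)
          (fun x : M => TangentSpace I x →L[ℝ] TangentSpace I x →L[ℝ] ℝ) p)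
        (f := fun x => Bundle.TotalSpace.mk' (E →L[ℝ] E →L[ℝ] ℝ) x (g.inner x)) (x₀ := x)
        (by simpa [Bundle.Trivialization.mem_source] using hx)).1 (g.contMDiff x)
      exact this.2.contMDiffWithinAt
    refine (h1.comp (contMDiffOn_extChartAt_symm p) fun u hu => ?_).congr fun u hu => ?_
    · simpa using (extChartAt I p).map_target hu
    · have hs : (extChartAt I p).symm u ∈ (chartAt H p).source := by
        simpa using (extChartAt I p).map_target hu
      refine ContinuousLinearMap.ext fun v => ContinuousLinearMap.ext fun w => ?_
      rw [Function.comp_apply, inCoordinates_metric g p _ hs, (extChartAt I p).right_inv hu]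

/-- The coordinate change between two preferred charts. -/
def transition (I : ModelWithCorners ℝ E H) (p q : M) (u : E) : E :=
  extChartAt I q ((extChartAt I p).symm u)

theorem contDiffAt_transition {p q : M} {u : E} (hu : u ∈ (extChartAt I p).target)
    (hq : (extChartAt I p).symm u ∈ (extChartAt I q).source) :
    ContDiffAt ℝ ∞ (transition I p q) u := by
  rw [← contMDiffAt_iff_contDiffAt]
  have h1 := (contMDiffOn_extChartAt_symm (n := ∞) p u hu).contMDiffAt
    ((isOpen_extChartAt_target p).mem_nhds hu)
  exact (contMDiffAt_extChartAt' (n := ∞) (by simpa using hq)).comp u h1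

theorem eventually_transition_mem {p q : M} {u : E} (hu : u ∈ (extChartAt I p).target)
    (hq : (extChartAt I p).symm u ∈ (extChartAt I q).source) :
    ∀ᶠ x in nhds u, x ∈ (extChartAt I p).target ∧
      (extChartAt I p).symm x ∈ (extChartAt I q).source :=
  Filter.Eventually.and ((isOpen_extChartAt_target p).mem_nhds hu) ((continuousAt_extChartAt_symm'' hu).eventually
    ((isOpen_extChartAt_source q).mem_nhds hq))

theorem mfderiv_symm_transition {p q : M} {u : E} (hu : u ∈ (extChartAt I p).target)
    (hq : (extChartAt I p).symm u ∈ (extChartAt I q).source) (v : E) :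
    mfderiv 𝓘(ℝ, E) I (extChartAt I q).symm (transition I p q u) (fderiv ℝ (transition I p q) u v) =
      (mfderiv 𝓘(ℝ, E) I (extChartAt I p).symm u v : E) := by
  have h1 : MDifferentiableAt 𝓘(ℝ, E) I (extChartAt I q).symm (transition I p q u) :=
    mdifferentiableAt_extChartAt_symm ((extChartAt I q).map_source hq)
  have h2 : MDifferentiableAt 𝓘(ℝ, E) 𝓘(ℝ, E) (transition I p q) u :=
    ((contDiffAt_transition hu hq).differentiableAt (by simp)).mdifferentiableAt
  have h3 := mfderiv_comp u h1 h2
  have h4 : (extChartAt I q).symm ∘ transition I p q =ᶠ[nhds u] (extChartAt I p).symm := by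
    filter_upwards [eventually_transition_mem hu hq] with x hx
    exact (extChartAt I q).left_inv hx.2
  rw [h4.mfderiv_eq, mfderiv_eq_fderiv] at h3
  exact (DFunLike.congr_fun h3 v).symm

theorem chartMetric_transition (g : Metric I M) {p q : M} {u : E} (hu : u ∈ (extChartAt I p).target)
    (hq : (extChartAt I p).symm u ∈ (extChartAt I q).source) (v w : E) :
    chartMetric g p u v w = chartMetric g q (transition I p q u)
      (fderiv ℝ (transition I p q) u v) (fderiv ℝ (transition I p q) u w) := by
  rw [chartMetric_apply, chartMetric_apply]
  have hv := mfderiv_symm_transition hu hq v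
  have hw := mfderiv_symm_transition hu hq w
  have hx : (extChartAt I q).symm (transition I p q u) = (extChartAt I p).symm u :=
    (extChartAt I q).left_inv hq
  exact inner_congr g hx.symm hv.symm hw.symm

theorem chartMetric_self (g : Metric I M) (p : M) (v w : TangentSpace I p) :
    chartMetric g p (extChartAt I p p) v w = g.inner p v w := by
  have h : ∀ v : E, (mfderiv 𝓘(ℝ, E) I (extChartAt I p).symm (extChartAt I p p) v : E) = v :=
    fun v => by
      rw [← mfderivWithin_univ, ← I.range_eq_univ, mfderivWithin_range_extChartAt_symm]
      rfl
  exact (chartMetric_apply g p _ _ _).trans (inner_congr g (extChartAt_to_inv p) (h v) (h w))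

theorem fderiv_transition_surjective [FiniteDimensional ℝ E] {p q : M} {u : E}
    (hu : u ∈ (extChartAt I p).target) (hq : (extChartAt I p).symm u ∈ (extChartAt I q).source) :
    Function.Surjective (fderiv ℝ (transition I p q) u) := by
  have hi : Function.Injective (fderiv ℝ (transition I p q) u : E →ₗ[ℝ] E) := fun v w h => by
    refine mfderiv_symm_injective hu ?_
    have hv := mfderiv_symm_transition hu hq v
    have hw := mfderiv_symm_transition hu hq w
    refine Eq.trans hv.symm (Eq.trans ?_ hw)
    exact congrArg _ h
  exact LinearMap.injective_iff_surjective.1 hi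

end Charts

section Tension

variable {E : Type*} [NormedAddCommGroup E] [NormedSpace ℝ E] [FiniteDimensional ℝ E]
  {H : Type*} [TopologicalSpace H] {I : ModelWithCorners ℝ E H} [I.Boundaryless]
  {M : Type*} [TopologicalSpace M] [ChartedSpace H M] [IsManifold I ∞ M]
  {E' : Type*} [NormedAddCommGroup E'] [NormedSpace ℝ E'] [FiniteDimensional ℝ E']
  {H' : Type*} [TopologicalSpace H'] {J : ModelWithCorners ℝ E' H'} [J.Boundaryless]
  {N : Type*} [TopologicalSpace N] [ChartedSpace H' N] [IsManifold J ∞ N]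

theorem christoffel_eq (g : Metric I M) (p : M) (u v w : E) :
    christoffel g p u v w = localChristoffel (chartMetric g p) u v w :=
  (localChristoffel_apply _ u v w).symm

theorem tension_eq (g : Metric I M) (h : Metric J N) (φ : M → N) (p : M) :
    tension g h φ p = localTension (chartMetric g p) (chartMetric h (φ p))
      (fun u => extChartAt J (φ p) (φ ((extChartAt I p).symm u))) (extChartAt I p p) := by
  refine Finset.sum_congr rfl fun i _ => ?_
  rw [localSFF_apply, secondFundamentalForm, christoffel_eq, christoffel_eq]

theorem chartCurvature_eq (g : Metric I M) (p : M) {u : E} (hu : u ∈ (extChartAt I p).target)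
    (v w z : E) : chartCurvature g p u v w z = localCurvature (chartMetric g p) u v w z := by
  have hd := ((isMetricOn_chartMetric g p).differentiableAt_christoffel hu).hasFDerivAt
  have h : ∀ a b c : E, fderiv ℝ (fun u' => localChristoffel (chartMetric g p) u' a b) u c =
      fderiv ℝ (localChristoffel (chartMetric g p)) u c a b := fun a b c => by
    have := (hd.clm_apply (hasFDerivAt_const a u)).clm_apply (hasFDerivAt_const b u)
    rw [this.fderiv]
    simp
  simp only [chartCurvature, localCurvature, christoffel_eq, h]

/-- A map in the preferred charts at two given points. -/
def inCharts (I : ModelWithCorners ℝ E H) (J : ModelWithCorners ℝ E' H') (φ : M → N) (p : M) (q : N)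
    (u : E) : E' :=
  extChartAt J q (φ ((extChartAt I p).symm u))

theorem contDiffAt_inCharts {φ : M → N} {p : M} {q : N} {u : E} (hu : u ∈ (extChartAt I p).target)
    (hq : φ ((extChartAt I p).symm u) ∈ (extChartAt J q).source)
    (hφ : ContMDiffAt I J ∞ φ ((extChartAt I p).symm u)) :
    ContDiffAt ℝ ∞ (inCharts I J φ p q) u := by
  rw [← contMDiffAt_iff_contDiffAt]
  have h1 := (contMDiffOn_extChartAt_symm (n := ∞) p u hu).contMDiffAt
    ((isOpen_extChartAt_target p).mem_nhds hu)
  exact (contMDiffAt_extChartAt' (n := ∞) (by simpa using hq)).comp u (hφ.comp u h1)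

/-- The length of the tension field may be computed in any of the preferred charts. -/
theorem inner_tension_eq (g : Metric I M) (h : Metric J N) {φ : M → N} {p p₀ : M} {q₀ : N}
    (hp : p ∈ (extChartAt I p₀).source) (hq : φ p ∈ (extChartAt J q₀).source)
    (hφ : ContMDiffAt I J ∞ φ p) :
    h.inner (φ p) (tension g h φ p) (tension g h φ p) =
      chartMetric h q₀ (extChartAt J q₀ (φ p))
        (localTension (chartMetric g p₀) (chartMetric h q₀) (inCharts I J φ p₀ q₀)
          (extChartAt I p₀ p))
        (localTension (chartMetric g p₀) (chartMetric h q₀) (inCharts I J φ p₀ q₀)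
          (extChartAt I p₀ p)) := by
  set u := extChartAt I p p with hu
  have hut : u ∈ (extChartAt I p).target := mem_extChartAt_target p
  have hus : (extChartAt I p).symm u = p := extChartAt_to_inv p
  have hup : (extChartAt I p).symm u ∈ (extChartAt I p₀).source := by rwa [hus]
  set κ := transition I p p₀ with hκ
  have hκu : κ u = extChartAt I p₀ p := by rw [hκ, transition, hus]
  have hκt : κ u ∈ (extChartAt I p₀).target := by
    rw [hκu]
    exact (extChartAt I p₀).map_source hp
  have hκs : (extChartAt I p₀).symm (κ u) = p := by rw [hκu, (extChartAt I p₀).left_inv hp]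
  set ψ := inCharts I J φ p₀ q₀ with hψ
  have hψd : ContDiffAt ℝ ∞ ψ (κ u) := contDiffAt_inCharts hκt (by rwa [hκs]) (by rwa [hκs])
  have hψu : ψ (κ u) = extChartAt J q₀ (φ p) := by rw [hψ, inCharts, hκs]
  have hψt : ψ (κ u) ∈ (extChartAt J q₀).target := by
    rw [hψu]
    exact (extChartAt J q₀).map_source hq
  have hψs : (extChartAt J q₀).symm (ψ (κ u)) = φ p := by
    rw [hψu, (extChartAt J q₀).left_inv hq]
  have hψs' : (extChartAt J q₀).symm (ψ (κ u)) ∈ (extChartAt J (φ p)).source := by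
    rw [hψs]
    exact mem_extChartAt_source (φ p)
  set β := transition J q₀ (φ p) with hβ
  have hβψ : β (ψ (κ u)) = extChartAt J (φ p) (φ p) := by rw [hβ, transition, hψs]
  have hβt : β (ψ (κ u)) ∈ (extChartAt J (φ p)).target := by
    rw [hβψ]
    exact mem_extChartAt_target (φ p)
  have hκd := (contDiffAt_transition hut hup).of_le two_le_infty
  have hβd := (contDiffAt_transition hψt hψs').of_le two_le_infty
  have hev : (fun x => extChartAt J (φ p) (φ ((extChartAt I p).symm x))) =ᶠ[nhds u]
      β ∘ (ψ ∘ κ) := by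
    have hφc : ContinuousAt φ ((extChartAt I p).symm u) := by
      rw [hus]
      exact hφ.continuousAt
    have hc := hφc.comp (continuousAt_extChartAt_symm'' hut)
    have hn : ∀ᶠ x in nhds u, φ ((extChartAt I p).symm x) ∈ (extChartAt J q₀).source := by
      refine hc.eventually ((isOpen_extChartAt_source q₀).mem_nhds ?_)
      rwa [Function.comp_apply, hus]
    filter_upwards [eventually_transition_mem hut hup, hn] with x hx hx'
    have k1 : (extChartAt I p₀).symm (κ x) = (extChartAt I p).symm x :=
      (extChartAt I p₀).left_inv hx.2
    simp only [Function.comp_apply, hβ, hψ, inCharts]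
    rw [k1, transition, (extChartAt J q₀).left_inv hx']
  have hG := isMetricOn_chartMetric g p
  have hG₀ := isMetricOn_chartMetric g p₀
  have hh := isMetricOn_chartMetric h q₀
  have hh₁ := isMetricOn_chartMetric h (φ p)
  have h1 : tension g h φ p = fderiv ℝ β (ψ (κ u))
      (localTension (chartMetric g p₀) (chartMetric h q₀) ψ (κ u)) := by
    rw [tension_eq, localTension_congr hev,
      localTension_comp_left (ψ := ψ ∘ κ) hh hh₁ hψt hβt hβd
        (fderiv_transition_surjective hψt hψs')
        ((eventually_transition_mem hψt hψs').mono fun x hx v w =>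
          chartMetric_transition h hx.1 hx.2 v w)
        ((hψd.of_le two_le_infty).comp u hκd),
      localTension_comp_right hG hG₀ hut hκt hκd (fderiv_transition_surjective hut hup)
        ((eventually_transition_mem hut hup).mono fun x hx v w =>
          chartMetric_transition g hx.1 hx.2 v w) (hψd.of_le two_le_infty)]
    rfl
  rw [← chartMetric_self, h1, ← hβψ]
  refine (chartMetric_transition h hψt hψs' _ _).symm.trans ?_
  rw [hψu, hκu]

end Tension

section Warped

variable {E : Type*} [NormedAddCommGroup E] [NormedSpace ℝ E]
  {H : Type*} [TopologicalSpace H] {I : ModelWithCorners ℝ E H} [I.Boundaryless]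
  {M : Type*} [TopologicalSpace M] [ChartedSpace H M] [IsManifold I ∞ M]
  {E' : Type*} [NormedAddCommGroup E'] [NormedSpace ℝ E']
  {H' : Type*} [TopologicalSpace H'] {J : ModelWithCorners ℝ E' H'} [J.Boundaryless]
  {N : Type*} [TopologicalSpace N] [ChartedSpace H' N] [IsManifold J ∞ N]
  {gM : Metric I M} {gN : Metric J N} {l : M → ℝ} {hl : ContMDiff I 𝓘(ℝ, ℝ) ∞ l}

theorem mem_target_prod {z : M × N} {u : E × E'} :
    u ∈ (extChartAt (I.prod J) z).target ↔
      u.1 ∈ (extChartAt I z.1).target ∧ u.2 ∈ (extChartAt J z.2).target := by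
  rw [extChartAt_prod]
  rfl

theorem extChartAt_prod_symm_apply (z : M × N) (u : E × E') :
    (extChartAt (I.prod J) z).symm u =
      ((extChartAt I z.1).symm u.1, (extChartAt J z.2).symm u.2) := by
  rw [extChartAt_prod]
  rfl

theorem extChartAt_prod_apply (z p : M × N) :
    extChartAt (I.prod J) z p = (extChartAt I z.1 p.1, extChartAt J z.2 p.2) := by
  rw [extChartAt_prod]
  rfl

theorem chartMetric_warpedMetric {z : M × N} {u : E × E'}
    (hu : u ∈ (extChartAt (I.prod J) z).target) (v w : E × E') :
    chartMetric (warpedMetric gM gN l hl) z u v w = chartMetric gM z.1 u.1 v.1 w.1 +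
      Real.exp (2 * l ((extChartAt I z.1).symm u.1)) * chartMetric gN z.2 u.2 v.2 w.2 := by
  obtain ⟨h1, h2⟩ := mem_target_prod.1 hu
  have hs : ((extChartAt (I.prod J) z).symm : E × E' → M × N) =
      Prod.map (extChartAt I z.1).symm (extChartAt J z.2).symm := by
    funext x
    exact extChartAt_prod_symm_apply z x
  have hd := mfderiv_prodMap (mdifferentiableAt_extChartAt_symm h1)
    (mdifferentiableAt_extChartAt_symm h2)
  have key : ∀ v : E × E', (mfderiv 𝓘(ℝ, E × E') (I.prod J) (extChartAt (I.prod J) z).symm u v :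
      E × E') = ((mfderiv 𝓘(ℝ, E) I (extChartAt I z.1).symm u.1 v.1 : E),
        (mfderiv 𝓘(ℝ, E') J (extChartAt J z.2).symm u.2 v.2 : E')) := fun v => by
    rw [hs, modelWithCornersSelf_prod, ← chartedSpaceSelf_prod]
    erw [hd]
    rfl
  rw [chartMetric_apply, chartMetric_apply, chartMetric_apply]
  refine (inner_congr (warpedMetric gM gN l hl) (extChartAt_prod_symm_apply z u)
    (key v) (key w)).trans ?_
  exact warped_apply gM gN l _ _ _

variable [FiniteDimensional ℝ E] [FiniteDimensional ℝ E']

theorem contDiffOn_comp_symm (hl : ContMDiff I 𝓘(ℝ, ℝ) ∞ l) (x : M) :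
    ContDiffOn ℝ ∞ (fun u => l ((extChartAt I x).symm u)) (extChartAt I x).target := by
  rw [← contMDiffOn_iff_contDiffOn]
  exact hl.comp_contMDiffOn (contMDiffOn_extChartAt_symm x)

/-- The gradient of a function in the preferred chart at `x`. -/
def chartGradient (gM : Metric I M) (l : M → ℝ) (x : M) (u : E) : E :=
  (chartMetric gM x u).inverse (fderiv ℝ (fun u' => l ((extChartAt I x).symm u')) u)

theorem contDiffOn_chartGradient (hl : ContMDiff I 𝓘(ℝ, ℝ) ∞ l) (x : M) :
    ContDiffOn ℝ ∞ (chartGradient gM l x) (extChartAt I x).target := fun u hu =>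
  (((isMetricOn_chartMetric gM x).contDiffAt_inverse hu).clm_apply
    ((((contDiffOn_comp_symm hl x) u hu).contDiffAt
      ((isOpen_extChartAt_target x).mem_nhds hu)).fderiv_right (by simp))).contDiffWithinAt

theorem localTension_fst_warpedMetric {z : M × N} {u : E × E'}
    (hu : u ∈ (extChartAt (I.prod J) z).target) :
    localTension (chartMetric (warpedMetric gM gN l hl) z) (chartMetric gM z.1) Prod.fst u =
      (Module.finrank ℝ E' : ℝ) • chartGradient gM l z.1 u.1 :=
  localTension_fst_warped (μ := fun u => l ((extChartAt I z.1).symm u))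
    (isMetricOn_chartMetric _ z) (isMetricOn_chartMetric gM z.1)
    (isMetricOn_chartMetric gN z.2) (contDiffOn_comp_symm hl z.1) (fun _ h => mem_target_prod.1 h)
    (fun _ h => chartMetric_warpedMetric h) hu

theorem inCharts_fst_eventuallyEq {z : M × N} {u : E × E'}
    (hu : u ∈ (extChartAt (I.prod J) z).target) :
    inCharts (I.prod J) I (Prod.fst : M × N → M) z z.1 =ᶠ[nhds u] Prod.fst := by
  filter_upwards [(isOpen_extChartAt_target z).mem_nhds hu] with x hx
  rw [inCharts, extChartAt_prod_symm_apply, (extChartAt I z.1).right_inv (mem_target_prod.1 hx).1]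

theorem tension_fst_warpedMetric (z : M × N) :
    tension (warpedMetric gM gN l hl) gM (Prod.fst : M × N → M) z =
      (Module.finrank ℝ E' : ℝ) • chartGradient gM l z.1 (extChartAt I z.1 z.1) := by
  have hz := mem_extChartAt_target (I := I.prod J) z
  rw [tension_eq]
  refine (localTension_congr (inCharts_fst_eventuallyEq hz)).trans ?_
  rw [localTension_fst_warpedMetric hz, extChartAt_prod_apply]

end Warped

section Volume

variable {E : Type*} [NormedAddCommGroup E] [NormedSpace ℝ E] [FiniteDimensional ℝ E]
  [MeasurableSpace E] [BorelSpace E]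
  {H : Type*} [TopologicalSpace H] {I : ModelWithCorners ℝ E H} [I.Boundaryless]
  {M : Type*} [TopologicalSpace M] [ChartedSpace H M] [IsManifold I ∞ M]
  [MeasurableSpace M] [BorelSpace M]

theorem volumeDensity_transition (g : Metric I M) {p q : M} {u : E}
    (hu : u ∈ (extChartAt I p).target) (hq : (extChartAt I p).symm u ∈ (extChartAt I q).source) :
    volumeDensity (chartMetric g p) u =
      |(fderiv ℝ (transition I p q) u).det| * volumeDensity (chartMetric g q) (transition I p q u) := by
  have h : gramDet (chartMetric g p u) = (fderiv ℝ (transition I p q) u).det ^ 2 *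
      gramDet (chartMetric g q (transition I p q u)) := by
    rw [← gramDet_comp]
    simp only [gramDet, chartMetric_transition g hu hq]
  rw [volumeDensity, h, Real.sqrt_mul (sq_nonneg _), Real.sqrt_sq_eq_abs, volumeDensity]

/-- The part of the Riemannian volume carried by a chart. -/
def chartVolume (g : Metric I M) (p : M) : Measure M :=
  Measure.map (extChartAt I p).symm
    (((Module.finBasis ℝ E).addHaar.restrict (extChartAt I p).target).withDensity fun u =>
      ENNReal.ofReal (volumeDensity (chartMetric g p) u))

theorem aemeasurable_extChartAt_symm (p : M) (ν : Measure E) :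
    AEMeasurable (extChartAt I p).symm (ν.restrict (extChartAt I p).target) :=
  (continuousOn_extChartAt_symm p).aemeasurable (isOpen_extChartAt_target p).measurableSet

theorem chartVolume_apply (g : Metric I M) (p : M) {A : Set M} (hA : MeasurableSet A) :
    chartVolume g p A = ∫⁻ u in (extChartAt I p).symm ⁻¹' A ∩ (extChartAt I p).target,
      ENNReal.ofReal (volumeDensity (chartMetric g p) u) ∂(Module.finBasis ℝ E).addHaar := by
  rw [chartVolume, Measure.map_apply_of_aemeasurable
    ((aemeasurable_extChartAt_symm p _).mono_ac (withDensity_absolutelyContinuous _ _)) hA,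
    withDensity_apply', Measure.restrict_restrict' (isOpen_extChartAt_target p).measurableSet]

theorem measurableSet_symm_preimage (p : M) {A : Set M} (hA : MeasurableSet A) :
    MeasurableSet ((extChartAt I p).symm ⁻¹' A ∩ (extChartAt I p).target) := by
  have h := (continuousOn_iff_continuous_domRestrict.1
    (continuousOn_extChartAt_symm (I := I) p)).measurable hA
  have := (isOpen_extChartAt_target (I := I) p).measurableSet.subtype_image h
  convert this using 1
  ext x
  simp [Set.mem_image, and_comm]

theorem chartVolume_le (g : Metric I M) (p q : M) {A : Set M} (hA : MeasurableSet A)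
    (hq : A ⊆ (extChartAt I q).source) : chartVolume g p A ≤ chartVolume g q A := by
  rw [chartVolume_apply g p hA, chartVolume_apply g q hA]
  set B := (extChartAt I p).symm ⁻¹' A ∩ (extChartAt I p).target with hB
  have hBm : MeasurableSet B := measurableSet_symm_preimage p hA
  have hd : ∀ u ∈ B, HasFDerivWithinAt (transition I p q) (fderiv ℝ (transition I p q) u) B u :=
    fun u hu => ((contDiffAt_transition hu.2 (hq hu.1)).differentiableAt
      (by simp)).hasFDerivAt.hasFDerivWithinAt
  have hi : Set.InjOn (transition I p q) B := fun u hu v hv h =>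
    (extChartAt I p).symm.injOn hu.2 hv.2 ((extChartAt I q).injOn (hq hu.1) (hq hv.1) h)
  have h1 := lintegral_image_eq_lintegral_abs_det_fderiv_mul (Module.finBasis ℝ E).addHaar hBm hd hi
    fun u => ENNReal.ofReal (volumeDensity (chartMetric g q) u)
  have h2 : ∫⁻ u in B, ENNReal.ofReal (volumeDensity (chartMetric g p) u)
      ∂(Module.finBasis ℝ E).addHaar = ∫⁻ u in B, ENNReal.ofReal
        |(fderiv ℝ (transition I p q) u).det| * ENNReal.ofReal
          (volumeDensity (chartMetric g q) (transition I p q u)) ∂(Module.finBasis ℝ E).addHaar :=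
    setLIntegral_congr_fun hBm fun u hu => by
      rw [volumeDensity_transition g hu.2 (hq hu.1), ENNReal.ofReal_mul (abs_nonneg _)]
  rw [h2, ← h1]
  refine lintegral_mono_set ?_
  rintro _ ⟨u, hu, rfl⟩
  refine ⟨?_, (extChartAt I q).map_source (hq hu.1)⟩
  rw [Set.mem_preimage, transition, (extChartAt I q).left_inv (hq hu.1)]
  exact hu.1

theorem riemannianVolume_apply (g : Metric I M) (q : M) {A : Set M} (hA : MeasurableSet A)
    (hq : A ⊆ (extChartAt I q).source) : riemannianVolume g A = chartVolume g q A := by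
  refine le_antisymm ?_ (le_iSup (chartVolume g) q A)
  have hS : MeasurableSet (extChartAt I q).source := (isOpen_extChartAt_source q).measurableSet
  have hle : riemannianVolume g ≤
      chartVolume g q + (riemannianVolume g).restrict (extChartAt I q).sourceᶜ := by
    refine iSup_le fun p => ?_
    change chartVolume g p ≤ _
    rw [← Measure.restrict_add_restrict_compl (μ := chartVolume g p) hS]
    refine add_le_add (Measure.le_iff.2 fun B hB => ?_)
      (Measure.restrict_mono subset_rfl (le_iSup (chartVolume g) p))
    rw [Measure.restrict_apply hB]
    exact (chartVolume_le g p q (hB.inter hS) Set.inter_subset_right).trans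
      (measure_mono Set.inter_subset_left)
  refine (hle A).trans (le_of_eq ?_)
  rw [Measure.add_apply, Measure.restrict_apply hA, (Set.disjoint_compl_right_iff_subset.2 hq).inter_eq,
    measure_empty, add_zero]

theorem continuousOn_volumeDensity (g : Metric I M) (p : M) :
    ContinuousOn (volumeDensity (chartMetric g p)) (extChartAt I p).target := fun _ hu =>
  ((isMetricOn_chartMetric g p).contDiffAt_volumeDensity hu).continuousAt.continuousWithinAt

instance isLocallyFiniteMeasure_riemannianVolume (g : Metric I M) :
    IsLocallyFiniteMeasure (riemannianVolume g) where
  finiteAtNhds x := by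
    obtain ⟨r, hr, hrt⟩ := Metric.nhds_basis_closedBall.mem_iff.1
      ((isOpen_extChartAt_target (I := I) x).mem_nhds (mem_extChartAt_target x))
    have hO : IsOpen ((extChartAt I x).source ∩ extChartAt I x ⁻¹' Metric.ball (extChartAt I x x) r) :=
      (continuousOn_extChartAt x).isOpen_inter_preimage (isOpen_extChartAt_source x) Metric.isOpen_ball
    refine ⟨_, hO.mem_nhds ⟨mem_extChartAt_source x, Metric.mem_ball_self hr⟩, ?_⟩
    rw [riemannianVolume_apply g x hO.measurableSet Set.inter_subset_left,
      chartVolume_apply g x hO.measurableSet]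
    have : ProperSpace E := FiniteDimensional.proper ℝ E
    have hi : IntegrableOn (volumeDensity (chartMetric g x))
        (Metric.closedBall (extChartAt I x x) r) (Module.finBasis ℝ E).addHaar :=
      ((continuousOn_volumeDensity g x).mono hrt).integrableOn_compact (isCompact_closedBall _ _)
    refine lt_of_le_of_lt (lintegral_mono_set ?_) hi.lintegral_lt_top
    rintro u ⟨hu, hut⟩
    have := hu.2
    rw [Set.mem_preimage, (extChartAt I x).right_inv hut] at this
    exact Metric.ball_subset_closedBall this

/-- Integration over a compact subset of a chart. -/
theorem setIntegral_riemannianVolume [T2Space M] (g : Metric I M) (p : M) {K : Set E}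
    (hK : IsCompact K) (hKt : K ⊆ (extChartAt I p).target) {F : M → ℝ}
    (hF : ContinuousOn (fun u => F ((extChartAt I p).symm u)) K) :
    ∫ x in (extChartAt I p).symm '' K, F x ∂(riemannianVolume g) =
      ∫ u in K, F ((extChartAt I p).symm u) * volumeDensity (chartMetric g p) u
        ∂(Module.finBasis ℝ E).addHaar := by
  set Ω := (extChartAt I p).symm '' K with hΩ
  have hΩc : IsCompact Ω := hK.image_of_continuousOn ((continuousOn_extChartAt_symm p).mono hKt)
  have hΩs : Ω ⊆ (extChartAt I p).source := by
    rintro _ ⟨u, hu, rfl⟩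
    exact (extChartAt I p).map_target (hKt hu)
  have hΩK : (extChartAt I p).symm ⁻¹' Ω ∩ (extChartAt I p).target = K := by
    ext u
    constructor
    · rintro ⟨⟨v, hv, hvu⟩, hu⟩
      rwa [← (extChartAt I p).symm.injOn (hKt hv) hu hvu]
    · exact fun hu => ⟨⟨u, hu, rfl⟩, hKt hu⟩
  have hsm : AEMeasurable (extChartAt I p).symm ((Module.finBasis ℝ E).addHaar.restrict K) :=
    ((continuousOn_extChartAt_symm p).mono hKt).aemeasurable hK.measurableSet
  have hm : (riemannianVolume g).restrict Ω = Measure.map (extChartAt I p).symm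
      (((Module.finBasis ℝ E).addHaar.restrict K).withDensity fun u =>
        ENNReal.ofReal (volumeDensity (chartMetric g p) u)) := by
    ext A hA
    rw [Measure.restrict_apply hA, riemannianVolume_apply g p (hA.inter hΩc.measurableSet)
      (Set.inter_subset_right.trans hΩs), chartVolume_apply g p (hA.inter hΩc.measurableSet),
      Measure.map_apply_of_aemeasurable
        (hsm.mono_ac (withDensity_absolutelyContinuous _ _)) hA,
      withDensity_apply', Measure.restrict_restrict' hK.measurableSet, Set.preimage_inter,
      Set.inter_assoc, hΩK]
  have hFm : AEStronglyMeasurable F ((riemannianVolume g).restrict Ω) := by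
    refine ContinuousOn.aestronglyMeasurable ?_ hΩc.measurableSet
    have := hF.comp ((continuousOn_extChartAt p).mono hΩs) (t := K) (by
      rintro _ ⟨u, hu, rfl⟩
      rwa [(extChartAt I p).right_inv (hKt hu)])
    refine this.congr fun x hx => ?_
    rw [Function.comp_apply, (extChartAt I p).left_inv (hΩs hx)]
  have hwm : AEMeasurable (fun u => ENNReal.ofReal (volumeDensity (chartMetric g p) u))
      ((Module.finBasis ℝ E).addHaar.restrict K) :=
    (((continuousOn_volumeDensity g p).mono hKt).aemeasurable hK.measurableSet).ennreal_ofReal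
  rw [hm] at hFm ⊢
  rw [integral_map (hsm.mono_ac (withDensity_absolutelyContinuous _ _)) hFm,
    integral_withDensity_eq_integral_toReal_smul₀ hwm (by simp)]
  refine integral_congr_ae (Filter.Eventually.of_forall fun u => ?_)
  simp only [smul_eq_mul]
  rw [ENNReal.toReal_ofReal (volumeDensity_nonneg _ _), mul_comm]

end Volume

section ParametricIntegrals

variable {P : Type*} [NormedAddCommGroup P] [NormedSpace ℝ P] [MeasurableSpace P] [BorelSpace P]

theorem hasDerivAt_setIntegral_of_contDiffAt {F : ℝ × P → ℝ} {K : Set P} (hK : IsCompact K)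
    (hF : ∀ u ∈ K, ContDiffAt ℝ 1 F (0, u)) (μ : Measure P) [IsFiniteMeasureOnCompacts μ] :
    HasDerivAt (fun t => ∫ u in K, F (t, u) ∂μ) (∫ u in K, fderiv ℝ F (0, u) (1, 0) ∂μ) 0 := by
  have hWo : IsOpen {x | ContDiffAt ℝ 1 F x} :=
    isOpen_iff_mem_nhds.2 fun x hx => ContDiffAt.eventually hx (by simp)
  have hKW : ({0} : Set ℝ) ×ˢ K ⊆ {x | ContDiffAt ℝ 1 F x} := by
    rintro ⟨t, u⟩ ⟨rfl, hu⟩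
    exact hF u hu
  obtain ⟨S, O, hS, -, h0S, hKO, hSO⟩ := generalized_tube_lemma isCompact_singleton hK hWo hKW
  obtain ⟨ε, hε, hεS⟩ := Metric.nhds_basis_closedBall.mem_iff.1
    (hS.mem_nhds (h0S (Set.mem_singleton 0)))
  have hW : ∀ t ∈ Metric.closedBall (0 : ℝ) ε, ∀ u ∈ K, ContDiffAt ℝ 1 F (t, u) :=
    fun t ht u hu => hSO ⟨hεS ht, hKO hu⟩
  have hcont : ∀ t ∈ Metric.closedBall (0 : ℝ) ε, ContinuousOn (fun u => F (t, u)) K :=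
    fun t ht u hu => ((hW t ht u hu).continuousAt.comp
      (continuous_const.prodMk continuous_id).continuousAt).continuousWithinAt
  have hcont' : ∀ t ∈ Metric.closedBall (0 : ℝ) ε,
      ContinuousOn (fun u => fderiv ℝ F (t, u) (1, 0)) K := fun t ht u hu => by
    have := ((hW t ht u hu).fderiv_right (m := 0) (by simp)).continuousAt
    exact ((ContinuousAt.comp (g := fderiv ℝ F) this (continuous_const.prodMk
      continuous_id).continuousAt).clm_apply continuousAt_const).continuousWithinAt
  obtain ⟨C, hC⟩ := ((isCompact_closedBall (0 : ℝ) ε).prod hK).exists_bound_of_continuousOn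
    (f := fun x => fderiv ℝ F x (1, 0)) fun x hx =>
      (((hW x.1 hx.1 x.2 hx.2).fderiv_right (m := 0) (by simp)).continuousAt.clm_apply
        continuousAt_const).continuousWithinAt
  have h0 : (0 : ℝ) ∈ Metric.closedBall (0 : ℝ) ε := Metric.mem_closedBall_self hε.le
  refine (hasDerivAt_integral_of_dominated_loc_of_deriv_le (μ := μ.restrict K)
    (F := fun t u => F (t, u)) (F' := fun t u => fderiv ℝ F (t, u) (1, 0)) (bound := fun _ => C)
    (Metric.closedBall_mem_nhds (0 : ℝ) hε) ?_ ?_ ?_ ?_ ?_ ?_).2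
  · filter_upwards [Metric.closedBall_mem_nhds (0 : ℝ) hε] with t ht
    exact (hcont t ht).aestronglyMeasurable_of_isCompact hK hK.measurableSet
  · exact (hcont 0 h0).integrableOn_compact hK
  · exact (hcont' 0 h0).aestronglyMeasurable_of_isCompact hK hK.measurableSet
  · filter_upwards [ae_restrict_mem hK.measurableSet] with u hu t ht
    exact hC (t, u) ⟨ht, hu⟩
  · exact integrableOn_const hK.measure_lt_top.ne
  · filter_upwards [ae_restrict_mem hK.measurableSet] with u hu t ht
    exact ((hW t ht u hu).differentiableAt one_ne_zero).hasFDerivAt.comp_hasDerivAt t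
      ((hasDerivAt_id t).prodMk (hasDerivAt_const t u))

end ParametricIntegrals

section Variations

variable {E : Type*} [NormedAddCommGroup E] [NormedSpace ℝ E] [FiniteDimensional ℝ E]
  {H : Type*} [TopologicalSpace H] {I : ModelWithCorners ℝ E H} [I.Boundaryless]
  {M : Type*} [TopologicalSpace M] [ChartedSpace H M] [IsManifold I ∞ M]
  {E' : Type*} [NormedAddCommGroup E'] [NormedSpace ℝ E'] [FiniteDimensional ℝ E']
  {H' : Type*} [TopologicalSpace H'] {J : ModelWithCorners ℝ E' H'} [J.Boundaryless]
  {N : Type*} [TopologicalSpace N] [ChartedSpace H' N] [IsManifold J ∞ N]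

theorem contDiffAt_inCharts_uncurry {Φ : ℝ → M → N}
    (hΦ : ContMDiff (𝓘(ℝ, ℝ).prod I) J ∞ (Function.uncurry Φ)) {p : M} {q : N} {t : ℝ} {u : E}
    (hu : u ∈ (extChartAt I p).target)
    (hq : Φ t ((extChartAt I p).symm u) ∈ (extChartAt J q).source) :
    ContDiffAt ℝ ∞ (Function.uncurry fun t => inCharts I J (Φ t) p q) (t, u) := by
  rw [← contMDiffAt_iff_contDiffAt]
  have h1 := (contMDiffOn_extChartAt_symm (n := ∞) p u hu).contMDiffAt
    ((isOpen_extChartAt_target p).mem_nhds hu)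
  have h2 : ContMDiffAt 𝓘(ℝ, ℝ × E) 𝓘(ℝ, E) ∞ (fun x : ℝ × E => x.2) (t, u) :=
    contMDiffAt_iff_contDiffAt.2 contDiffAt_snd
  have h3 : ContMDiffAt 𝓘(ℝ, ℝ × E) 𝓘(ℝ, ℝ) ∞ (fun x : ℝ × E => x.1) (t, u) :=
    contMDiffAt_iff_contDiffAt.2 contDiffAt_fst
  have h4 := h3.prodMk (ContMDiffAt.comp (t, u) h1 h2)
  exact (contMDiffAt_extChartAt' (n := ∞) (by simpa using hq)).comp (t, u)
    ((hΦ (t, (extChartAt I p).symm u)).comp (t, u) h4)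

theorem contMDiff_of_uncurry {Φ : ℝ → M → N}
    (hΦ : ContMDiff (𝓘(ℝ, ℝ).prod I) J ∞ (Function.uncurry Φ)) (t : ℝ) : ContMDiff I J ∞ (Φ t) :=
  hΦ.comp (contMDiff_const.prodMk contMDiff_id)

/-- Along a variation of a harmonic map, the length of the tension field is locally quadratically
small. -/
theorem IsHarmonic.exists_local_bound {g : Metric I M} {h : Metric J N} {φ : M → N}
    (hφ : IsHarmonic g h φ) {Φ : ℝ → M → N}
    (hΦ : ContMDiff (𝓘(ℝ, ℝ).prod I) J ∞ (Function.uncurry Φ)) (h0 : Φ 0 = φ) (p₀ : M) :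
    ∃ C, ∀ᶠ x : ℝ × M in nhds (0, p₀),
      ‖h.inner (Φ x.1 x.2) (tension g h (Φ x.1) x.2) (tension g h (Φ x.1) x.2)‖ ≤ C * x.1 ^ 2 := by
  set q₀ := φ p₀ with hq₀
  set u₀ := extChartAt I p₀ p₀ with hu₀
  have hu₀t : u₀ ∈ (extChartAt I p₀).target := mem_extChartAt_target p₀
  set ψ : ℝ → E → E' := fun t => inCharts I J (Φ t) p₀ q₀ with hψ
  have hq : Φ 0 ((extChartAt I p₀).symm u₀) ∈ (extChartAt J q₀).source := by
    rw [h0, extChartAt_to_inv]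
    exact mem_extChartAt_source q₀
  have hψd : ContDiffAt ℝ ∞ (Function.uncurry ψ) (0, u₀) :=
    contDiffAt_inCharts_uncurry hΦ hu₀t hq
  have hψt : ψ 0 u₀ ∈ (extChartAt J q₀).target := (extChartAt J q₀).map_source hq
  have hT := contDiffAt_localTension (isMetricOn_chartMetric g p₀) (isMetricOn_chartMetric h q₀)
    hψd hu₀t hψt
  obtain ⟨L, S, hS, hL⟩ := (hT.of_le (m := 1) (by simp)).exists_lipschitzOnWith
  have hB : ContinuousAt (fun x : ℝ × E => chartMetric h q₀ (ψ x.1 x.2)) (0, u₀) :=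
    ContinuousAt.comp (g := chartMetric h q₀) (f := Function.uncurry ψ) (x := ((0 : ℝ), u₀))
      ((isMetricOn_chartMetric h q₀).contDiffAt hψt).continuousAt hψd.continuousAt
  have hB' : ∀ᶠ x : ℝ × E in nhds (0, u₀), ‖chartMetric h q₀ (ψ x.1 x.2)‖ <
      ‖chartMetric h q₀ (ψ 0 u₀)‖ + 1 := hB.norm.eventually (gt_mem_nhds (lt_add_one _))
  have hext : ContinuousAt (fun x : ℝ × M => extChartAt I p₀ x.2) (0, p₀) :=
    ContinuousAt.comp (g := extChartAt I p₀) (f := Prod.snd) (x := ((0 : ℝ), p₀))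
      (continuousAt_extChartAt p₀) continuousAt_snd
  have hchart : Filter.Tendsto (fun x : ℝ × M => (x.1, extChartAt I p₀ x.2)) (nhds (0, p₀))
      (nhds (0, u₀)) := continuousAt_fst.prodMk hext
  have hchart0 : Filter.Tendsto (fun x : ℝ × M => ((0 : ℝ), extChartAt I p₀ x.2)) (nhds (0, p₀))
      (nhds (0, u₀)) := continuousAt_const.prodMk hext
  have hsrc : ∀ᶠ x : ℝ × M in nhds (0, p₀), x.2 ∈ (extChartAt I p₀).source :=
    continuousAt_snd.eventually (extChartAt_source_mem_nhds p₀)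
  have hsrc' : ∀ᶠ x : ℝ × M in nhds (0, p₀), Φ x.1 x.2 ∈ (extChartAt J q₀).source := by
    refine (hΦ.continuous.continuousAt (x := ((0 : ℝ), p₀))).eventually
      ((isOpen_extChartAt_source q₀).mem_nhds ?_)
    rw [Function.uncurry_apply_pair, h0]
    exact mem_extChartAt_source q₀
  have hsrc0 : ∀ᶠ x : ℝ × M in nhds (0, p₀), φ x.2 ∈ (extChartAt J q₀).source :=
    (hφ.1.continuous.continuousAt.comp continuousAt_snd).eventually
      (extChartAt_source_mem_nhds q₀)
  refine ⟨(‖chartMetric h q₀ (ψ 0 u₀)‖ + 1) * L ^ 2, ?_⟩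
  filter_upwards [hchart.eventually hB', hchart.eventually hS, hchart0.eventually hS, hsrc, hsrc',
    hsrc0] with x hx1 hx2 hx3 hx4 hx5 hx6
  rw [inner_tension_eq g h hx4 hx5 (contMDiff_of_uncurry hΦ x.1 x.2)]
  set T := localTension (chartMetric g p₀) (chartMetric h q₀) (inCharts I J (Φ x.1) p₀ q₀)
    (extChartAt I p₀ x.2) with hTd
  have hz : localTension (chartMetric g p₀) (chartMetric h q₀) (ψ 0) (extChartAt I p₀ x.2) = 0 := by
    have := inner_tension_eq g h hx4 hx6 (hφ.1 x.2)
    rw [hφ.2, map_zero] at this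
    simp only [hψ, h0]
    exact ((isMetricOn_chartMetric h q₀).posDef _
      ((extChartAt J q₀).map_source hx6)).eq_zero_of_self this.symm
  have hTn : ‖T‖ ≤ L * |x.1| := by
    have := hL.dist_le_mul _ hx2 _ hx3
    simp only [hz, dist_zero_right] at this
    refine this.trans (le_of_eq ?_)
    rw [Prod.dist_eq]
    simp
  have hψx : ψ x.1 (extChartAt I p₀ x.2) = extChartAt J q₀ (Φ x.1 x.2) := by
    simp only [hψ, inCharts]
    rw [(extChartAt I p₀).left_inv hx4]
  simp only [hψx] at hx1
  calc ‖chartMetric h q₀ (extChartAt J q₀ (Φ x.1 x.2)) T T‖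
      ≤ ‖chartMetric h q₀ (extChartAt J q₀ (Φ x.1 x.2))‖ * ‖T‖ * ‖T‖ :=
        ContinuousLinearMap.le_opNorm₂ _ _ _
    _ ≤ (‖chartMetric h q₀ (ψ 0 u₀)‖ + 1) * (L * |x.1|) * (L * |x.1|) := by gcongr
    _ = (‖chartMetric h q₀ (ψ 0 u₀)‖ + 1) * L ^ 2 * x.1 ^ 2 := by
        rw [← sq_abs x.1]
        ring

variable [MeasurableSpace E] [BorelSpace E] [MeasurableSpace M] [BorelSpace M]

/-- Harmonic maps are biharmonic. -/
theorem IsHarmonic.isBiharmonic {g : Metric I M} {h : Metric J N} {φ : M → N}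
    (hφ : IsHarmonic g h φ) : IsBiharmonic g h φ := by
  refine ⟨hφ.1, fun Ω hΩ Φ hΦ => ?_⟩
  obtain ⟨C, hC⟩ : ∃ C, ∀ᶠ t : ℝ in nhds 0, ∀ p ∈ Ω,
      ‖h.inner (Φ t p) (tension g h (Φ t) p) (tension g h (Φ t) p)‖ ≤ C * t ^ 2 := by
    refine hΩ.induction_on (p := fun S => ∃ C, ∀ᶠ t : ℝ in nhds 0, ∀ p ∈ S,
      ‖h.inner (Φ t p) (tension g h (Φ t) p) (tension g h (Φ t) p)‖ ≤ C * t ^ 2)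
      ⟨0, by simp⟩ (fun S S' hS ⟨C, hC⟩ => ⟨C, hC.mono fun t ht p hp => ht p (hS hp)⟩) ?_ ?_
    · rintro S S' ⟨C, hC⟩ ⟨C', hC'⟩
      refine ⟨max C C', ?_⟩
      filter_upwards [hC, hC'] with t h1 h2 p hp
      rcases hp with hp | hp
      · exact (h1 p hp).trans (mul_le_mul_of_nonneg_right (le_max_left _ _) (sq_nonneg _))
      · exact (h2 p hp).trans (mul_le_mul_of_nonneg_right (le_max_right _ _) (sq_nonneg _))
    · intro p₀ _
      obtain ⟨C, hC⟩ := hφ.exists_local_bound hΦ.smooth hΦ.zero p₀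
      rw [nhds_prod_eq] at hC
      obtain ⟨S, hS, S', hS', h⟩ := Filter.eventually_prod_iff.1 hC
      exact ⟨_, mem_nhdsWithin_of_mem_nhds hS', C, hS.mono fun t ht p hp => h ht hp⟩
  set V := (riemannianVolume g).real Ω with hV
  have hbound : ∀ᶠ t : ℝ in nhds 0, ‖bienergy g h (Φ t) Ω‖ ≤ (1 / 2 * C * V) * t ^ 2 := by
    filter_upwards [hC] with t ht
    rw [bienergy, norm_mul]
    have := norm_setIntegral_le_of_norm_le_const (μ := riemannianVolume g) hΩ.measure_lt_top ht
    calc _ ≤ ‖(1 / 2 : ℝ)‖ * (C * t ^ 2 * V) := by gcongr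
      _ = _ := by
        rw [Real.norm_of_nonneg (by norm_num)]
        ring
  have h00 : bienergy g h (Φ 0) Ω = 0 := by
    have := hbound.self_of_nhds
    rw [zero_pow two_ne_zero, mul_zero] at this
    exact norm_le_zero_iff.1 this
  rw [hasDerivAt_iff_isLittleO]
  simp only [h00, sub_zero, smul_zero]
  refine Asymptotics.IsBigO.trans_isLittleO (g := fun t : ℝ => t ^ 2) ?_ ?_
  · refine Asymptotics.IsBigO.of_bound (1 / 2 * C * V) (hbound.mono fun t ht => ?_)
    rwa [Real.norm_of_nonneg (sq_nonneg t)]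
  · exact Asymptotics.isLittleO_pow_id one_lt_two

end Variations

section IntegratedFirstVariation

variable {E : Type*} [NormedAddCommGroup E] [NormedSpace ℝ E] [FiniteDimensional ℝ E]
  {P : Type*} [NormedAddCommGroup P] [NormedSpace ℝ P] [FiniteDimensional ℝ P]
  {G : P → P →L[ℝ] P →L[ℝ] ℝ} {U : Set P} {g : E → E →L[ℝ] E →L[ℝ] ℝ} {V : Set E}
  {A : P →L[ℝ] E}

theorem contDiffAt_firstVariation (hG : IsMetricOn G U) (hg : IsMetricOn g V) {u : P} (hu : u ∈ U)
    (hV : A u ∈ V) {T W : P → E} (hT : ContDiffAt ℝ ∞ T u) (hW : ContDiffAt ℝ ∞ W u) :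
    ContDiffAt ℝ ∞ (firstVariation G g A T W) u := by
  have hA : ContDiffAt ℝ ∞ A u := A.contDiff.contDiffAt
  have c : ∀ v : P, ContDiffAt ℝ ∞ (fun _ : P => v) u := fun v => contDiffAt_const
  have d1 : ContDiffAt ℝ ∞ (fderiv ℝ W) u := hW.fderiv_right (by simp)
  have d2 : ContDiffAt ℝ ∞ (fderiv ℝ (fderiv ℝ W)) u := d1.fderiv_right (by simp)
  have g0 : ContDiffAt ℝ ∞ (fun x => g (A x)) u :=
    ContDiffAt.comp (g := g) u (hg.contDiffAt hV) hA
  have g1 : ContDiffAt ℝ ∞ (fun x => localChristoffel g (A x)) u :=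
    ContDiffAt.comp (g := localChristoffel g) u (hg.contDiffAt_christoffel hV) hA
  have g2 : ContDiffAt ℝ ∞ (fun x => fderiv ℝ (localChristoffel g) (A x)) u :=
    ContDiffAt.comp (g := fderiv ℝ (localChristoffel g)) u
      ((hg.contDiffAt_christoffel hV).fderiv_right (by simp)) hA
  refine (g0.clm_apply hT).clm_apply (ContDiffAt.add (ContDiffAt.sum fun i _ => ?_)
    ((g1.clm_apply hW).clm_apply hT))
  have s : ContDiffAt ℝ ∞ (fun x => (G x).inverse
      (LinearMap.toContinuousLinearMap ((Module.finBasis ℝ P).coord i))) u :=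
    (hG.contDiffAt_inverse hu).clm_apply contDiffAt_const
  have hAs := A.contDiff.contDiffAt.comp u s
  have b := c (Module.finBasis ℝ P i)
  have hAb : ContDiffAt ℝ ∞ (fun _ : P => A (Module.finBasis ℝ P i)) u := contDiffAt_const
  exact (((((d2.clm_apply b).clm_apply s).sub
    (d1.clm_apply (((hG.contDiffAt_christoffel hu).clm_apply b).clm_apply s))).add
    (((g2.clm_apply hW).clm_apply hAb).clm_apply hAs)).add
    ((g1.clm_apply (d1.clm_apply b)).clm_apply hAs)).add
    ((g1.clm_apply hAb).clm_apply (d1.clm_apply s))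

variable [MeasurableSpace P] [BorelSpace P]

/-- The first variation of the bienergy in the direction of a multiple of the tension field, after
integration by parts. -/
theorem setIntegral_firstVariation_smul (hG : IsMetricOn G U) (hg : IsMetricOn g V)
    (hUV : ∀ u ∈ U, A u ∈ V) {T : P → E} (hT : ContDiffOn ℝ ∞ T U) {f : P → ℝ}
    (hf : ContDiff ℝ ∞ f) (hfc : HasCompactSupport f) (hfU : tsupport f ⊆ U)
    (μ : Measure P) [μ.IsAddHaarMeasure] :
    ∫ u in tsupport f, firstVariation G g A T (fun x => f x • T x) u * volumeDensity G u ∂μ =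
      ∫ u in tsupport f, f u * (firstVariation G g A T T u * volumeDensity G u) ∂μ := by
  set K := tsupport f with hK
  have hKc : IsCompact K := hfc
  have hT' : ∀ u ∈ U, ContDiffAt ℝ ∞ T u := fun u hu =>
    (hT u hu).contDiffAt (hG.isOpen.mem_nhds hu)
  set φ : P → ℝ := fun x => 1 / 2 * g (A x) (T x) (T x) with hφ
  have hφd : ∀ u ∈ U, ContDiffAt ℝ ∞ φ u := fun u hu =>
    contDiffAt_const.mul ((ContDiffAt.clm_apply (ContDiffAt.comp (g := g) u
      (hg.contDiffAt (hUV u hu)) A.contDiff.contDiffAt) (hT' u hu)).clm_apply (hT' u hu))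
  set F : P → P := fun x => (volumeDensity G x * φ x) • (G x).inverse (fderiv ℝ f x) with hF
  have hF0 : ∀ x ∉ K, F =ᶠ[nhds x] 0 := fun x hx => by
    have h1 : f =ᶠ[nhds x] 0 := notMem_tsupport_iff_eventuallyEq.1 hx
    filter_upwards [h1.fderiv (𝕜 := ℝ)] with y hy
    have : fderiv ℝ f y = 0 := by
      rw [hy]
      simp
    rw [hF]
    simp [this]
  have hFd : ContDiff ℝ 1 F := by
    rw [contDiff_iff_contDiffAt]
    intro x
    by_cases hx : x ∈ K
    · have hxU := hfU hx
      have h1 : ContDiffAt ℝ ∞ (fderiv ℝ f) x := hf.contDiffAt.fderiv_right (by simp)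
      exact (((hG.contDiffAt_volumeDensity hxU).mul (hφd x hxU)).smul
        ((hG.contDiffAt_inverse hxU).clm_apply h1)).of_le (by simp)
    · exact contDiffAt_const.congr_of_eventuallyEq (hF0 x hx)
  have hFc : HasCompactSupport F :=
    HasCompactSupport.of_support_subset_isCompact hKc fun x hx => by
      by_contra h
      exact hx (hF0 x h).self_of_nhds
  have hdiv := integral_divergence_eq_zero hFd hFc (Module.finBasis ℝ P) μ
  have hdivK : ∫ u in K, ∑ i, (Module.finBasis ℝ P).coord i
      (fderiv ℝ F u (Module.finBasis ℝ P i)) ∂μ = 0 := by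
    rw [setIntegral_eq_integral_of_forall_compl_eq_zero, hdiv]
    intro x hx
    have : fderiv ℝ F x = 0 := by
      rw [(hF0 x hx).fderiv_eq]
      simp
    simp [this]
  have hcQ : ContinuousOn (fun u => f u * (firstVariation G g A T T u * volumeDensity G u)) K :=
    fun u hu => (hf.continuous.continuousAt.mul ((contDiffAt_firstVariation hG hg (hfU hu)
      (hUV u (hfU hu)) (hT' u (hfU hu)) (hT' u (hfU hu))).continuousAt.mul
      (hG.contDiffAt_volumeDensity (hfU hu)).continuousAt)).continuousWithinAt
  have hcF : Continuous fun u => ∑ i, (Module.finBasis ℝ P).coord i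
      (fderiv ℝ F u (Module.finBasis ℝ P i)) := by
    refine continuous_finsetSum _ fun i _ => ?_
    exact (LinearMap.toContinuousLinearMap ((Module.finBasis ℝ P).coord i)).continuous.comp
      ((hFd.continuous_fderiv one_ne_zero).clm_apply continuous_const)
  have hpt : ∀ u ∈ K, firstVariation G g A T (fun x => f x • T x) u * volumeDensity G u =
      2 * ∑ i, (Module.finBasis ℝ P).coord i (fderiv ℝ F u (Module.finBasis ℝ P i)) +
        f u * (firstVariation G g A T T u * volumeDensity G u) := fun u hu => by
    have huU := hfU hu
    rw [sum_coord_fderiv_gradient hG huU (hf.contDiffAt.of_le two_le_infty)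
      ((hφd u huU).differentiableAt (by simp)),
      firstVariation_smul hG hg huU (hUV u huU) ((hT' u huU).of_le two_le_infty)
        (hf.contDiffAt.of_le two_le_infty)]
    ring
  rw [setIntegral_congr_fun hKc.measurableSet hpt, integral_add
    (((hcF.const_mul 2).continuousOn).integrableOn_compact hKc) (hcQ.integrableOn_compact hKc),
    integral_const_mul, hdivK, mul_zero, zero_add]

theorem contDiffAt_tension_density (hG : IsMetricOn G U) (hg : IsMetricOn g V) {W : P → E} {t : ℝ}
    {u : P} (hu : u ∈ U) (hW : ContDiffAt ℝ ∞ W u) (hV : A u + Real.sin t • W u ∈ V) :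
    ContDiffAt ℝ ∞ (fun x : ℝ × P => g (A x.2 + Real.sin x.1 • W x.2)
      (localTension G g (fun y => A y + Real.sin x.1 • W y) x.2)
      (localTension G g (fun y => A y + Real.sin x.1 • W y) x.2)) (t, u) := by
  have hs : ContDiffAt ℝ ∞ (fun x : ℝ × P => x.2) (t, u) := contDiffAt_snd
  have h1 : ContDiffAt ℝ ∞ (Function.uncurry fun (t : ℝ) x => A x + Real.sin t • W x) (t, u) :=
    (A.contDiff.contDiffAt.comp (t, u) hs).add ((Real.contDiff_sin.contDiffAt.comp (t, u)
      contDiffAt_fst).smul (ContDiffAt.comp (g := W) (t, u) hW hs))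
  have h2 := contDiffAt_localTension hG hg h1 hu hV
  have h3 : ContDiffAt ℝ ∞ (fun x : ℝ × P => g (A x.2 + Real.sin x.1 • W x.2)) (t, u) :=
    ContDiffAt.comp (g := g) (t, u) (hg.contDiffAt hV) h1
  exact (h3.clm_apply h2).clm_apply h2

theorem hasDerivAt_integral_tension_density (hG : IsMetricOn G U) (hg : IsMetricOn g V)
    (hUV : ∀ u ∈ U, A u ∈ V) {W T : P → E} {K : Set P} (hK : IsCompact K) (hKU : K ⊆ U)
    (hW : ∀ u ∈ K, ContDiffAt ℝ ∞ W u) (hT : ∀ u ∈ K, localTension G g A u = T u)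
    (μ : Measure P) [IsFiniteMeasureOnCompacts μ] :
    HasDerivAt (fun t => ∫ u in K, g (A u + Real.sin t • W u)
      (localTension G g (fun y => A y + Real.sin t • W y) u)
      (localTension G g (fun y => A y + Real.sin t • W y) u) * volumeDensity G u ∂μ)
      (∫ u in K, 2 * firstVariation G g A T W u * volumeDensity G u ∂μ) 0 := by
  have hd : ∀ u ∈ K, ContDiffAt ℝ ∞ (fun x : ℝ × P => g (A x.2 + Real.sin x.1 • W x.2)
      (localTension G g (fun y => A y + Real.sin x.1 • W y) x.2)
      (localTension G g (fun y => A y + Real.sin x.1 • W y) x.2) * volumeDensity G x.2) (0, u) :=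
    fun u hu => (contDiffAt_tension_density hG hg (hKU hu) (hW u hu)
      (by simpa using hUV u (hKU hu))).mul (ContDiffAt.comp (g := volumeDensity G) ((0 : ℝ), u)
        (hG.contDiffAt_volumeDensity (hKU hu)) contDiffAt_snd)
  refine (hasDerivAt_setIntegral_of_contDiffAt hK (fun u hu => (hd u hu).of_le (by simp))
    μ).congr_deriv (setIntegral_congr_fun hK.measurableSet fun u hu => ?_)
  have h1 := ((hd u hu).differentiableAt (by simp)).hasFDerivAt.comp_hasDerivAt (0 : ℝ)
    ((hasDerivAt_id (0 : ℝ)).prodMk (hasDerivAt_const (0 : ℝ) u))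
  have h2 := (hasDerivAt_tension_density (G := G) hg (hUV u (hKU hu))
    ((hW u hu).of_le two_le_infty) (hT u hu) Real.sin_zero
    (by simpa using Real.hasDerivAt_sin 0)).mul_const (volumeDensity G u)
  exact h1.unique h2

end IntegratedFirstVariation

section FieldVariations

variable {E : Type*} [NormedAddCommGroup E] [NormedSpace ℝ E] [FiniteDimensional ℝ E]
  {H : Type*} [TopologicalSpace H] {I : ModelWithCorners ℝ E H} [I.Boundaryless]
  {M : Type*} [TopologicalSpace M] [ChartedSpace H M] [IsManifold I ∞ M]
  {E' : Type*} [NormedAddCommGroup E'] [NormedSpace ℝ E'] [FiniteDimensional ℝ E']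
  {H' : Type*} [TopologicalSpace H'] {J : ModelWithCorners ℝ E' H'} [J.Boundaryless]
  {N : Type*} [TopologicalSpace N] [ChartedSpace H' N] [IsManifold J ∞ N]
  {gM : Metric I M} {gN : Metric J N} {l : M → ℝ} {hl : ContMDiff I 𝓘(ℝ, ℝ) ∞ l}

open Classical in
/-- The variation of the first projection which moves the points of a chart along a vector field
with compact support in the chart. -/
def fieldVariation (I : ModelWithCorners ℝ E H) (J : ModelWithCorners ℝ E' H') (z₀ : M × N)
    (W : E × E' → E) (t : ℝ) (z : M × N) : M :=
  if z ∈ (extChartAt (I.prod J) z₀).source then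
    (extChartAt I z₀.1).symm ((extChartAt (I.prod J) z₀ z).1 +
      Real.sin t • W (extChartAt (I.prod J) z₀ z))
  else z.1

/-- Vector fields with compact support in a chart which generate a variation of the first
projection. -/
structure IsAdmissible (I : ModelWithCorners ℝ E H) (J : ModelWithCorners ℝ E' H') (z₀ : M × N)
    (K : Set (E × E')) (W : E × E' → E) : Prop where
  isCompact : IsCompact K
  subset : K ⊆ (extChartAt (I.prod J) z₀).target
  eq_zero : ∀ u ∉ K, W u = 0
  contDiffAt : ∀ u ∈ (extChartAt (I.prod J) z₀).target, ContDiffAt ℝ ∞ W u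
  mem_target : ∀ t : ℝ, ∀ u ∈ (extChartAt (I.prod J) z₀).target,
    u.1 + Real.sin t • W u ∈ (extChartAt I z₀.1).target

variable {z₀ : M × N} {K : Set (E × E')} {W : E × E' → E}

theorem fieldVariation_of_mem {z : M × N} (hz : z ∈ (extChartAt (I.prod J) z₀).source) (t : ℝ) :
    fieldVariation I J z₀ W t z = (extChartAt I z₀.1).symm ((extChartAt (I.prod J) z₀ z).1 +
      Real.sin t • W (extChartAt (I.prod J) z₀ z)) := if_pos hz

theorem symm_fst_extChartAt {z : M × N} (hz : z ∈ (extChartAt (I.prod J) z₀).source) :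
    (extChartAt I z₀.1).symm (extChartAt (I.prod J) z₀ z).1 = z.1 := by
  have := extChartAt_prod_symm_apply (I := I) (J := J) z₀ (extChartAt (I.prod J) z₀ z)
  rw [(extChartAt (I.prod J) z₀).left_inv hz] at this
  exact (congrArg Prod.fst this).symm

theorem IsAdmissible.fieldVariation_eq_fst (hW : IsAdmissible I J z₀ K W) {z : M × N}
    (hz : z ∉ (extChartAt (I.prod J) z₀).symm '' K) (t : ℝ) : fieldVariation I J z₀ W t z = z.1 := by
  by_cases h : z ∈ (extChartAt (I.prod J) z₀).source
  · have hu : extChartAt (I.prod J) z₀ z ∉ K := fun hu =>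
      hz ⟨_, hu, (extChartAt (I.prod J) z₀).left_inv h⟩
    rw [fieldVariation_of_mem h, hW.eq_zero _ hu, smul_zero, add_zero, symm_fst_extChartAt h]
  · exact if_neg h

theorem IsAdmissible.isVariation [T2Space M] [T2Space N] (hW : IsAdmissible I J z₀ K W) :
    IsVariation (I.prod J) I (Prod.fst : M × N → M) ((extChartAt (I.prod J) z₀).symm '' K)
      (fieldVariation I J z₀ W) where
  zero := by
    funext z
    by_cases h : z ∈ (extChartAt (I.prod J) z₀).source
    · rw [fieldVariation_of_mem h, Real.sin_zero, zero_smul, add_zero, symm_fst_extChartAt h]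
    · exact if_neg h
  fixed t z hz := hW.fieldVariation_eq_fst hz t
  smooth := by
    rintro ⟨t, z⟩
    have hst : ContMDiffAt (𝓘(ℝ, ℝ).prod (I.prod J)) (I.prod J) ∞
        (Prod.snd : ℝ × (M × N) → M × N) (t, z) := contMDiffAt_snd
    by_cases h : z ∈ (extChartAt (I.prod J) z₀).source
    · set u := extChartAt (I.prod J) z₀ z with hu
      have hut : u ∈ (extChartAt (I.prod J) z₀).target := (extChartAt (I.prod J) z₀).map_source h
      have hev : Function.uncurry (fieldVariation I J z₀ W) =ᶠ[nhds (t, z)] fun x =>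
          (extChartAt I z₀.1).symm ((extChartAt (I.prod J) z₀ x.2).1 +
            Real.sin x.1 • W (extChartAt (I.prod J) z₀ x.2)) := by
        have : ∀ᶠ x : ℝ × (M × N) in nhds (t, z), x.2 ∈ (extChartAt (I.prod J) z₀).source :=
          continuousAt_snd.eventually ((isOpen_extChartAt_source z₀).mem_nhds h)
        filter_upwards [this] with x hx
        exact fieldVariation_of_mem hx x.1
      refine ContMDiffAt.congr_of_eventuallyEq ?_ hev
      have h1 : ContMDiffAt (𝓘(ℝ, ℝ).prod (I.prod J)) 𝓘(ℝ, E × E') ∞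
          (fun x : ℝ × (M × N) => extChartAt (I.prod J) z₀ x.2) (t, z) :=
        (contMDiffAt_extChartAt' (n := ∞) (I := I.prod J) (x := z₀) (x' := z)
          (by simpa only [extChartAt_source] using h)).comp (t, z) hst
      have h2 : ContMDiffAt 𝓘(ℝ, ℝ × (E × E')) 𝓘(ℝ, E) ∞
          (fun y : ℝ × (E × E') => y.2.1 + Real.sin y.1 • W y.2) (t, u) := by
        refine contMDiffAt_iff_contDiffAt.2 ?_
        have hs : ContDiffAt ℝ ∞ (fun y : ℝ × (E × E') => y.2) (t, u) := contDiffAt_snd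
        exact (contDiffAt_fst.comp (t, u) hs).add ((Real.contDiff_sin.contDiffAt.comp (t, u)
          contDiffAt_fst).smul (ContDiffAt.comp (g := W) (t, u) (hW.contDiffAt u hut) hs))
      have h3 : ContMDiffAt (𝓘(ℝ, ℝ).prod (I.prod J)) 𝓘(ℝ, ℝ × (E × E')) ∞
          (fun x : ℝ × (M × N) => (x.1, extChartAt (I.prod J) z₀ x.2)) (t, z) :=
        (contMDiffAt_fst (I := 𝓘(ℝ, ℝ)) (J := I.prod J)).prodMk_space h1
      have h4 := (contMDiffOn_extChartAt_symm (I := I) (n := ∞) z₀.1 _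
        (hW.mem_target t u hut)).contMDiffAt
        ((isOpen_extChartAt_target z₀.1).mem_nhds (hW.mem_target t u hut))
      have h5 := ContMDiffAt.comp (t, z) h2 h3
      exact ContMDiffAt.comp (t, z) h4 h5
    · have hΩ : IsClosed ((extChartAt (I.prod J) z₀).symm '' K) :=
        (hW.isCompact.image_of_continuousOn
          ((continuousOn_extChartAt_symm z₀).mono hW.subset)).isClosed
      have hz : z ∉ (extChartAt (I.prod J) z₀).symm '' K := by
        rintro ⟨u, hu, rfl⟩
        exact h ((extChartAt (I.prod J) z₀).map_target (hW.subset hu))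
      have hev : Function.uncurry (fieldVariation I J z₀ W) =ᶠ[nhds (t, z)] fun x => x.2.1 := by
        have : ∀ᶠ x : ℝ × (M × N) in nhds (t, z), x.2 ∉ (extChartAt (I.prod J) z₀).symm '' K :=
          (continuous_snd.tendsto (t, z)).eventually (hΩ.isOpen_compl.mem_nhds hz)
        filter_upwards [this] with x hx
        exact hW.fieldVariation_eq_fst hx x.1
      refine ContMDiffAt.congr_of_eventuallyEq ?_ hev
      exact (contMDiffAt_fst (I := I) (J := J)).comp (t, z) hst

variable [MeasurableSpace E] [BorelSpace E] [MeasurableSpace E'] [BorelSpace E']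
  [MeasurableSpace M] [MeasurableSpace N] [BorelSpace (M × N)]

theorem IsAdmissible.bienergy_eq [T2Space M] [T2Space N] (hW : IsAdmissible I J z₀ K W) (t : ℝ) :
    bienergy (warpedMetric gM gN l hl) gM (fieldVariation I J z₀ W t)
        ((extChartAt (I.prod J) z₀).symm '' K) =
      1 / 2 * ∫ u in K, chartMetric gM z₀.1
        (ContinuousLinearMap.fst ℝ E E' u + Real.sin t • W u)
        (localTension (chartMetric (warpedMetric gM gN l hl) z₀) (chartMetric gM z₀.1)
          (fun y => ContinuousLinearMap.fst ℝ E E' y + Real.sin t • W y) u)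
        (localTension (chartMetric (warpedMetric gM gN l hl) z₀) (chartMetric gM z₀.1)
          (fun y => ContinuousLinearMap.fst ℝ E E' y + Real.sin t • W y) u) *
        volumeDensity (chartMetric (warpedMetric gM gN l hl) z₀) u
          ∂(Module.finBasis ℝ (E × E')).addHaar := by
  set g := warpedMetric gM gN l hl with hg
  set D : E × E' → ℝ := fun u => chartMetric gM z₀.1
        (ContinuousLinearMap.fst ℝ E E' u + Real.sin t • W u)
        (localTension (chartMetric g z₀) (chartMetric gM z₀.1)
          (fun y => ContinuousLinearMap.fst ℝ E E' y + Real.sin t • W y) u)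
        (localTension (chartMetric g z₀) (chartMetric gM z₀.1)
          (fun y => ContinuousLinearMap.fst ℝ E E' y + Real.sin t • W y) u) with hD
  have hpt : ∀ u ∈ K, gM.inner (fieldVariation I J z₀ W t ((extChartAt (I.prod J) z₀).symm u))
      (tension g gM (fieldVariation I J z₀ W t) ((extChartAt (I.prod J) z₀).symm u))
      (tension g gM (fieldVariation I J z₀ W t) ((extChartAt (I.prod J) z₀).symm u)) = D u := by
    intro u hu
    have hut := hW.subset hu
    have hval : ∀ x ∈ (extChartAt (I.prod J) z₀).target,
        fieldVariation I J z₀ W t ((extChartAt (I.prod J) z₀).symm x) =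
          (extChartAt I z₀.1).symm (x.1 + Real.sin t • W x) := fun x hx => by
      rw [fieldVariation_of_mem ((extChartAt (I.prod J) z₀).map_target hx),
        (extChartAt (I.prod J) z₀).right_inv hx]
    have hsrc : fieldVariation I J z₀ W t ((extChartAt (I.prod J) z₀).symm u) ∈
        (extChartAt I z₀.1).source := by
      rw [hval u hut]
      exact (extChartAt I z₀.1).map_target (hW.mem_target t u hut)
    have hev : inCharts (I.prod J) I (fieldVariation I J z₀ W t) z₀ z₀.1 =ᶠ[nhds u]
        fun y => ContinuousLinearMap.fst ℝ E E' y + Real.sin t • W y := by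
      filter_upwards [(isOpen_extChartAt_target z₀).mem_nhds hut] with x hx
      rw [inCharts, hval x hx, (extChartAt I z₀.1).right_inv (hW.mem_target t x hx)]
      rfl
    rw [inner_tension_eq g gM ((extChartAt (I.prod J) z₀).map_target hut) hsrc
      (contMDiff_of_uncurry hW.isVariation.smooth t _), (extChartAt (I.prod J) z₀).right_inv hut,
      localTension_congr hev, hval u hut, (extChartAt I z₀.1).right_inv (hW.mem_target t u hut)]
    rfl
  have hc : ContinuousOn D K := fun u hu => by
    have h := (contDiffAt_tension_density (A := ContinuousLinearMap.fst ℝ E E') (t := t)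
      (isMetricOn_chartMetric g z₀) (isMetricOn_chartMetric gM z₀.1) (hW.subset hu)
      (hW.contDiffAt u (hW.subset hu)) (hW.mem_target t u (hW.subset hu))).continuousAt
    exact (ContinuousAt.comp (f := fun y : E × E' => (t, y)) h
      (by fun_prop)).continuousWithinAt
  rw [bienergy, setIntegral_riemannianVolume (F := fun p => gM.inner (fieldVariation I J z₀ W t p)
    (tension g gM (fieldVariation I J z₀ W t) p) (tension g gM (fieldVariation I J z₀ W t) p))
    g z₀ hW.isCompact hW.subset (hc.congr hpt)]
  congr 1
  refine setIntegral_congr_fun hW.isCompact.measurableSet fun u hu => ?_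
  rw [hpt u hu]

end FieldVariations

section WarpedProjection

variable {E : Type*} [NormedAddCommGroup E] [NormedSpace ℝ E] [FiniteDimensional ℝ E]
  {H : Type*} [TopologicalSpace H] {I : ModelWithCorners ℝ E H} [I.Boundaryless]
  {M : Type*} [TopologicalSpace M] [ChartedSpace H M] [IsManifold I ∞ M]
  {E' : Type*} [NormedAddCommGroup E'] [NormedSpace ℝ E'] [FiniteDimensional ℝ E']
  {H' : Type*} [TopologicalSpace H'] {J : ModelWithCorners ℝ E' H'} [J.Boundaryless]
  {N : Type*} [TopologicalSpace N] [ChartedSpace H' N] [IsManifold J ∞ N]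
  {gM : Metric I M} {gN : Metric J N} {l : M → ℝ} {hl : ContMDiff I 𝓘(ℝ, ℝ) ∞ l}

/-- The tension field of the projection of a warped product in the preferred chart at `x`. -/
def chartTension (E' : Type*) [NormedAddCommGroup E'] [NormedSpace ℝ E'] (gM : Metric I M)
    (l : M → ℝ) (x : M) (u : E × E') : E :=
  (Module.finrank ℝ E' : ℝ) • chartGradient gM l x u.1

theorem contDiffAt_chartTension (hl : ContMDiff I 𝓘(ℝ, ℝ) ∞ l) {z : M × N} {u : E × E'}
    (hu : u ∈ (extChartAt (I.prod J) z).target) :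
    ContDiffAt ℝ ∞ (chartTension E' gM l z.1) u := by
  have h1 := (mem_target_prod.1 hu).1
  exact contDiffAt_const.smul (ContDiffAt.comp (g := chartGradient gM l z.1) u
    ((contDiffOn_chartGradient hl z.1 u.1 h1).contDiffAt
      ((isOpen_extChartAt_target z.1).mem_nhds h1)) contDiffAt_fst)

theorem inner_tension_fst_warpedMetric (z : M × N) {p : M × N}
    (hp : p ∈ (extChartAt (I.prod J) z).source) :
    gM.inner p.1 (tension (warpedMetric gM gN l hl) gM Prod.fst p)
        (tension (warpedMetric gM gN l hl) gM Prod.fst p) =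
      chartMetric gM z.1 (extChartAt (I.prod J) z p).1
        (chartTension E' gM l z.1 (extChartAt (I.prod J) z p))
        (chartTension E' gM l z.1 (extChartAt (I.prod J) z p)) := by
  have hu := (extChartAt (I.prod J) z).map_source hp
  have hq : p.1 ∈ (extChartAt I z.1).source := by
    rw [extChartAt_prod] at hp
    exact hp.1
  rw [inner_tension_eq _ gM hp hq contMDiffAt_fst,
    localTension_congr (inCharts_fst_eventuallyEq hu), localTension_fst_warpedMetric hu,
    extChartAt_prod_apply]
  rfl

/-- A small multiple of the tension field is admissible. -/
theorem exists_isAdmissible (hl : ContMDiff I 𝓘(ℝ, ℝ) ∞ l) (z : M × N) {u₀ : E × E'}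
    {O : Set (E × E')} (hO : O ∈ nhds u₀) (hOt : O ⊆ (extChartAt (I.prod J) z).target) :
    ∃ f : E × E' → ℝ, ContDiff ℝ ∞ f ∧ HasCompactSupport f ∧ tsupport f ⊆ O ∧ (∀ u, 0 ≤ f u) ∧
      0 < f u₀ ∧ IsAdmissible I J z (tsupport f) (fun u => f u • chartTension E' gM l z.1 u) := by
  obtain ⟨r, hr, hrO⟩ := Metric.nhds_basis_closedBall.mem_iff.1 hO
  set B := Metric.closedBall u₀ r with hB
  have hBc : IsCompact B := isCompact_closedBall u₀ r
  have hBt : B ⊆ (extChartAt (I.prod J) z).target := hrO.trans hOt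
  set T := chartTension E' gM l z.1 with hT
  obtain ⟨C, hC⟩ := hBc.exists_bound_of_continuousOn (f := T) fun u hu =>
    (contDiffAt_chartTension hl (hBt hu)).continuousAt.continuousWithinAt
  have hC0 : 0 ≤ C := (norm_nonneg _).trans (hC u₀ (Metric.mem_closedBall_self hr.le))
  obtain ⟨δ, hδ, hδt⟩ := (hBc.image continuous_fst).exists_thickening_subset_open
    (isOpen_extChartAt_target (I := I) z.1) (by
      rintro _ ⟨u, hu, rfl⟩
      exact (mem_target_prod.1 (hBt hu)).1)
  let b : ContDiffBump u₀ := ⟨r / 2, r, half_pos hr, half_lt_self hr⟩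
  set ε := δ / (C + 1) with hε
  have hε0 : 0 < ε := by positivity
  have hs : tsupport (fun u => ε * b u) ⊆ B :=
    (tsupport_mul_subset_right (f := fun _ => ε) (g := b)).trans b.tsupport_eq.le
  have hc : HasCompactSupport fun u => ε * b u := hBc.of_isClosed_subset (isClosed_tsupport _) hs
  have hd : ContDiff ℝ ∞ fun u => ε * b u := contDiff_const.mul b.contDiff
  refine ⟨fun u => ε * b u, hd, hc, hs.trans hrO, fun u => mul_nonneg hε0.le b.nonneg, ?_, hc,
    hs.trans hBt, fun u hu => ?_, fun u hu => hd.contDiffAt.smul (contDiffAt_chartTension hl hu),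
    fun t u hu => ?_⟩
  · beta_reduce
    rw [b.one_of_mem_closedBall (Metric.mem_closedBall_self b.rIn_pos.le), mul_one]
    exact hε0
  · have : ε * b u = 0 := image_eq_zero_of_notMem_tsupport (f := fun u => ε * b u) hu
    beta_reduce
    rw [this, zero_smul]
  · by_cases h : u ∈ tsupport fun u => ε * b u
    · refine hδt (Metric.mem_thickening_iff.2 ⟨u.1, ⟨u, hs h, rfl⟩, ?_⟩)
      rw [dist_eq_norm, add_sub_cancel_left, norm_smul, norm_smul, Real.norm_eq_abs, norm_mul,
        Real.norm_of_nonneg hε0.le, Real.norm_of_nonneg b.nonneg]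
      have h1 : ‖T u‖ < C + 1 := (hC u (hs h)).trans_lt (lt_add_one C)
      have h2 : ε * b u * ‖T u‖ ≤ ε * ‖T u‖ :=
        mul_le_mul_of_nonneg_right (mul_le_of_le_one_right hε0.le b.le_one) (norm_nonneg _)
      have h3 : ε * ‖T u‖ < δ := by
        calc ε * ‖T u‖ < ε * (C + 1) := mul_lt_mul_of_pos_left h1 hε0
          _ = δ := div_mul_cancel₀ δ (by positivity)
      have h4 : 0 ≤ ε * b u * ‖T u‖ := by
        have := b.nonneg (x := u)
        positivity
      exact (mul_le_of_le_one_left h4 (Real.abs_sin_le_one t)).trans_lt (h2.trans_lt h3)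
    · have : ε * b u = 0 := image_eq_zero_of_notMem_tsupport (f := fun u => ε * b u) h
      beta_reduce
      rw [this, zero_smul, smul_zero, add_zero]
      exact (mem_target_prod.1 hu).1

section Biharmonic

variable [MeasurableSpace E] [BorelSpace E] [MeasurableSpace E'] [BorelSpace E']
  [MeasurableSpace M] [MeasurableSpace N] [BorelSpace (M × N)] [T2Space M] [T2Space N]

theorem IsBiharmonic.integral_firstVariation_eq_zero
    (hb : IsBiharmonic (warpedMetric gM gN l hl) gM (Prod.fst : M × N → M)) {z : M × N}
    {K : Set (E × E')} {W : E × E' → E} (hW : IsAdmissible I J z K W) :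
    ∫ u in K, firstVariation (chartMetric (warpedMetric gM gN l hl) z) (chartMetric gM z.1)
      (ContinuousLinearMap.fst ℝ E E') (chartTension E' gM l z.1) W u *
        volumeDensity (chartMetric (warpedMetric gM gN l hl) z) u
          ∂(Module.finBasis ℝ (E × E')).addHaar = 0 := by
  have h1 := hb.2 _ (hW.isCompact.image_of_continuousOn
    ((continuousOn_extChartAt_symm z).mono hW.subset)) _ hW.isVariation
  simp_rw [hW.bienergy_eq] at h1
  have h2 := (hasDerivAt_integral_tension_density (A := ContinuousLinearMap.fst ℝ E E')
    (isMetricOn_chartMetric (warpedMetric gM gN l hl) z) (isMetricOn_chartMetric gM z.1)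
    (fun u hu => (mem_target_prod.1 hu).1) hW.isCompact hW.subset
    (fun u hu => hW.contDiffAt u (hW.subset hu))
    (fun u hu => localTension_fst_warpedMetric (hW.subset hu))
    (Module.finBasis ℝ (E × E')).addHaar).const_mul (1 / 2)
  have h3 := h2.unique h1
  simp_rw [mul_assoc, integral_const_mul] at h3
  rw [← mul_assoc] at h3
  norm_num at h3
  exact h3

theorem IsBiharmonic.firstVariation_nonneg
    (hb : IsBiharmonic (warpedMetric gM gN l hl) gM (Prod.fst : M × N → M)) {z : M × N}
    {u₀ : E × E'} (hu₀ : u₀ ∈ (extChartAt (I.prod J) z).target) :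
    0 ≤ firstVariation (chartMetric (warpedMetric gM gN l hl) z) (chartMetric gM z.1)
      (ContinuousLinearMap.fst ℝ E E') (chartTension E' gM l z.1) (chartTension E' gM l z.1) u₀ := by
  set G := chartMetric (warpedMetric gM gN l hl) z with hG
  set T := chartTension E' gM l z.1 with hT
  set U := (extChartAt (I.prod J) z).target with hU
  set Q := firstVariation G (chartMetric gM z.1) (ContinuousLinearMap.fst ℝ E E') T T with hQ
  have hGU : IsMetricOn G U := isMetricOn_chartMetric _ z
  have hg := isMetricOn_chartMetric gM z.1
  have hUV : ∀ u ∈ U, ContinuousLinearMap.fst ℝ E E' u ∈ (extChartAt I z.1).target :=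
    fun u hu => (mem_target_prod.1 hu).1
  have hTd : ∀ u ∈ U, ContDiffAt ℝ ∞ T u := fun u hu => contDiffAt_chartTension hl hu
  have hQc : ∀ u ∈ U, ContinuousAt Q u := fun u hu =>
    (contDiffAt_firstVariation hGU hg hu (hUV u hu) (hTd u hu) (hTd u hu)).continuousAt
  by_contra! hneg
  have hO : U ∩ {u | Q u < 0} ∈ nhds u₀ := Filter.inter_mem (hGU.isOpen.mem_nhds hu₀)
    ((hQc u₀ hu₀).eventually_lt continuousAt_const hneg)
  obtain ⟨f, hf, hfc, hfO, hf0, hfp, hW⟩ := exists_isAdmissible (gM := gM) hl z hO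
    Set.inter_subset_left
  have hfU : tsupport f ⊆ U := hfO.trans Set.inter_subset_left
  have h1 := hb.integral_firstVariation_eq_zero hW
  rw [setIntegral_firstVariation_smul hGU hg hUV (fun u hu => (hTd u hu).contDiffWithinAt) hf hfc
    hfU, setIntegral_eq_integral_of_forall_compl_eq_zero fun u hu => by
      rw [image_eq_zero_of_notMem_tsupport hu, zero_mul]] at h1
  set F : E × E' → ℝ := fun u => f u * (Q u * volumeDensity G u) with hF
  have hFz : ∀ u ∉ tsupport f, F u = 0 := fun u hu => by
    rw [hF]
    simp [image_eq_zero_of_notMem_tsupport hu]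
  have hFc : Continuous fun u => -F u := by
    refine (continuous_iff_continuousAt.2 fun u => ?_).neg
    by_cases hu : u ∈ tsupport f
    · exact hf.continuous.continuousAt.mul ((hQc u (hfU hu)).mul
        (hGU.contDiffAt_volumeDensity (hfU hu)).continuousAt)
    · refine (continuousAt_const (y := (0 : ℝ))).congr ?_
      filter_upwards [(isClosed_tsupport f).isOpen_compl.mem_nhds hu] with x hx
      exact (hFz x hx).symm
  have hFn : 0 ≤ fun u => -F u := fun u => by
    by_cases hu : u ∈ tsupport f
    · exact neg_nonneg.2 (mul_nonpos_of_nonneg_of_nonpos (hf0 u)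
        (mul_nonpos_of_nonpos_of_nonneg (hfO hu).2.le (volumeDensity_nonneg G u)))
    · simp [hFz u hu]
  have hFs : HasCompactSupport fun u => -F u :=
    HasCompactSupport.of_support_subset_isCompact hfc fun u hu => by
      by_contra h
      exact hu (by simp [hFz u h])
  have hF0 : -F u₀ ≠ 0 := by
    have := mul_neg_of_pos_of_neg hfp (mul_neg_of_neg_of_pos hneg (hGU.volumeDensity_pos hu₀))
    exact (neg_pos.2 this).ne'
  have h2 := hFc.integral_pos_of_hasCompactSupport_nonneg_nonzero
    (μ := (Module.finBasis ℝ (E × E')).addHaar) hFs hFn hF0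
  rw [integral_neg, h1, neg_zero] at h2
  exact lt_irrefl 0 h2

/-- On a compact manifold of negative Ricci curvature, a biharmonic projection of a warped product
is harmonic. -/
theorem IsBiharmonic.isHarmonic_fst_of_ricci_neg [CompactSpace M]
    (hRic : ∀ (x : M) (v : TangentSpace I x), v ≠ 0 → ricci gM x v v < 0)
    (hb : IsBiharmonic (warpedMetric gM gN l hl) gM (Prod.fst : M × N → M)) :
    IsHarmonic (warpedMetric gM gN l hl) gM (Prod.fst : M × N → M) := by
  refine ⟨hb.1, fun p => ?_⟩
  set e : M → ℝ := fun x => gM.inner x (tension (warpedMetric gM gN l hl) gM Prod.fst (x, p.2))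
    (tension (warpedMetric gM gN l hl) gM Prod.fst (x, p.2)) with he
  have hloc : ∀ x x' : M, x' ∈ (extChartAt I x).source →
      e x' = chartMetric gM x (extChartAt I x x')
        (chartTension E' gM l x (extChartAt I x x', extChartAt J p.2 p.2))
        (chartTension E' gM l x (extChartAt I x x', extChartAt J p.2 p.2)) := fun x x' h => by
    have := inner_tension_fst_warpedMetric (gM := gM) (gN := gN) (hl := hl) (x, p.2)
      (p := (x', p.2)) (by
        rw [extChartAt_prod]
        exact ⟨h, mem_extChartAt_source p.2⟩)
    rw [extChartAt_prod_apply] at this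
    exact this
  have hec : Continuous e := by
    refine continuous_iff_continuousAt.2 fun x => ?_
    have hu := mem_extChartAt_target (I := I.prod J) (x, p.2)
    rw [extChartAt_prod_apply] at hu
    have h1 : ContinuousAt (fun u : E × E' => chartMetric gM x u.1 (chartTension E' gM l x u)
        (chartTension E' gM l x u)) (extChartAt I x x, extChartAt J p.2 p.2) := by
      have h := contDiffAt_chartTension (gM := gM) hl hu
      exact ((ContDiffAt.clm_apply (ContDiffAt.comp (g := chartMetric gM x)
        (extChartAt I x x, extChartAt J p.2 p.2)
        ((isMetricOn_chartMetric gM x).contDiffAt (mem_extChartAt_target x)) contDiffAt_fst)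
        h).clm_apply h).continuousAt
    have h2 : ContinuousAt (fun x' => (extChartAt I x x', extChartAt J p.2 p.2)) x :=
      (continuousAt_extChartAt x).prodMk continuousAt_const
    refine (ContinuousAt.comp (f := fun x' => (extChartAt I x x', extChartAt J p.2 p.2)) h1
      h2).congr ?_
    filter_upwards [(isOpen_extChartAt_source (I := I) x).mem_nhds
      (mem_extChartAt_source x)] with x' hx'
    exact (hloc x x' hx').symm
  obtain ⟨x, -, hx⟩ := isCompact_univ.exists_isMaxOn ⟨p.1, Set.mem_univ _⟩ hec.continuousOn
  have hmax : ∀ x', e x' ≤ e x := fun x' => hx (Set.mem_univ x')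
  set u₀ := extChartAt (I.prod J) (x, p.2) (x, p.2) with hu₀
  have hu₀' : u₀ = (extChartAt I x x, extChartAt J p.2 p.2) := extChartAt_prod_apply _ _
  have hu : u₀ ∈ (extChartAt (I.prod J) (x, p.2)).target := mem_extChartAt_target _
  by_cases hT : chartTension E' gM l x u₀ = 0
  · have h0 : e x = 0 := by
      rw [hloc x x (mem_extChartAt_source x), ← hu₀', hT]
      simp
    by_contra hne
    exact absurd (gM.pos p.1 _ hne) (not_lt.2 ((hmax p.1).trans h0.le))
  · exfalso
    refine absurd (hb.firstVariation_nonneg hu) (not_le.2 ?_)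
    obtain ⟨h1, h2⟩ := mem_target_prod.1 hu
    refine firstVariation_self_neg (μ := fun u => l ((extChartAt I x).symm u))
      (isMetricOn_chartMetric _ _) (isMetricOn_chartMetric gM x) hu h1
      ((isMetricOn_chartMetric gN p.2).posDef _ h2) (fun v w => chartMetric_warpedMetric hu v w)
      ((contDiffAt_chartTension hl hu).of_le two_le_infty) (localTension_fst_warpedMetric hu) ?_ ?_
    · have hn : Prod.fst ⁻¹' (extChartAt I x).target ∈ nhds u₀ :=
        continuous_fst.continuousAt.preimage_mem_nhds ((isOpen_extChartAt_target x).mem_nhds h1)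
      have hval : ∀ u : E × E', u.1 ∈ (extChartAt I x).target →
          chartMetric gM x u.1 (chartTension E' gM l x u) (chartTension E' gM l x u) =
            e ((extChartAt I x).symm u.1) := fun u h => by
        rw [hloc x _ ((extChartAt I x).map_target h), (extChartAt I x).right_inv h]
        rfl
      filter_upwards [hn] with u hu'
      rw [hval u hu', hval u₀ h1]
      refine mul_le_mul_of_nonneg_left ((hmax _).trans_eq ?_) (by norm_num)
      rw [hu₀', (extChartAt I x).left_inv (mem_extChartAt_source x)]
    · set v : E := chartTension E' gM l x u₀ with hv
      have h3 : ∑ i, (Module.finBasis ℝ E).coord i (chartCurvature gM x (extChartAt I x x)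
        (Module.finBasis ℝ E i) v v) < 0 := hRic x v hT
      have h4 : u₀.1 = extChartAt I x x := by rw [hu₀']
      simp_rw [chartCurvature_eq gM x (mem_extChartAt_target x), ← h4] at h3
      exact h3

end Biharmonic

/-- The projection of a warped product with connected base is harmonic if and only if the warping
function is constant. -/
theorem isHarmonic_fst_warpedMetric_iff [PreconnectedSpace M] [Nontrivial E'] [Nonempty N] :
    IsHarmonic (warpedMetric gM gN l hl) gM (Prod.fst : M × N → M) ↔ ∃ c : ℝ, ∀ x, l x = c := by
  constructor
  · intro h
    obtain ⟨y⟩ := ‹Nonempty N›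
    have hfd : ∀ x : M, ∀ u ∈ (extChartAt I x).target,
        fderiv ℝ (fun u' => l ((extChartAt I x).symm u')) u = 0 := fun x u hu => by
      have hut : (u, extChartAt J y y) ∈ (extChartAt (I.prod J) (x, y)).target :=
        mem_target_prod.2 ⟨hu, mem_extChartAt_target y⟩
      have h1 := inner_tension_fst_warpedMetric (gM := gM) (gN := gN) (hl := hl) (x, y)
        ((extChartAt (I.prod J) (x, y)).map_target hut)
      rw [h.2, (extChartAt (I.prod J) (x, y)).right_inv hut] at h1
      have hp := (isMetricOn_chartMetric gM x).posDef u hu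
      have h2 : chartTension E' gM l x (u, extChartAt J y y) = 0 :=
        hp.eq_zero_of_self (h1.symm.trans (map_zero (gM.inner _ 0)))
      have h3 : chartGradient gM l x u = 0 := (smul_eq_zero.1 h2).resolve_left
        (Nat.cast_ne_zero.2 Module.finrank_pos.ne')
      rw [← hp.apply_inverse (fderiv ℝ _ u)]
      exact (congrArg (chartMetric gM x u) h3).trans (map_zero _)
    have hloc : IsLocallyConstant l := by
      refine (IsLocallyConstant.iff_eventually_eq l).2 fun x => ?_
      obtain ⟨r, hr, hrt⟩ := Metric.isOpen_iff.1 (isOpen_extChartAt_target (I := I) x) _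
        (mem_extChartAt_target x)
      have hb := (continuousAt_extChartAt (I := I) x).preimage_mem_nhds (Metric.ball_mem_nhds _ hr)
      filter_upwards [hb, (isOpen_extChartAt_source (I := I) x).mem_nhds
        (mem_extChartAt_source x)] with x' h1 h2
      have := Metric.isOpen_ball.is_const_of_fderiv_eq_zero (𝕜 := ℝ)
        (convex_ball (extChartAt I x x) r).isPreconnected
        (((contDiffOn_comp_symm hl x).differentiableOn (by simp)).mono hrt)
        (fun u hu => hfd x u (hrt hu)) h1 (Metric.mem_ball_self hr)
      rwa [(extChartAt I x).left_inv h2, (extChartAt I x).left_inv (mem_extChartAt_source x)]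
        at this
    by_cases hM : Nonempty M
    · obtain ⟨x₀⟩ := hM
      exact ⟨l x₀, fun x => hloc.apply_eq_of_preconnectedSpace x x₀⟩
    · exact ⟨0, fun x => (hM ⟨x⟩).elim⟩
  · rintro ⟨c, hc⟩
    refine ⟨contMDiff_fst, fun z => ?_⟩
    have : chartGradient gM l z.1 (extChartAt I z.1 z.1) = 0 := by
      rw [chartGradient]
      simp_rw [hc]
      rw [fderiv_fun_const]
      exact map_zero _
    rw [tension_fst_warpedMetric, this, smul_zero]
    rfl

end WarpedProjection

end RiemGeom

end

theorem mainTheorem4 (m n : ℕ) (hn : 1 ≤ n)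
    {M : Type*} [TopologicalSpace M] [ChartedSpace (EuclideanSpace ℝ (Fin m)) M]
    [IsManifold (𝓡 m) ∞ M] [T2Space M] [CompactSpace M] [MeasurableSpace M] [BorelSpace M]
    {N : Type*} [TopologicalSpace N] [ChartedSpace (EuclideanSpace ℝ (Fin n)) N]
    [IsManifold (𝓡 n) ∞ N] [T2Space N] [SecondCountableTopology N] [Nonempty N]
    [MeasurableSpace N] [BorelSpace N]
    (gM : RiemGeom.Metric (𝓡 m) M) (gN : RiemGeom.Metric (𝓡 n) N)
    (l : M → ℝ) (hl : ContMDiff (𝓡 m) 𝓘(ℝ, ℝ) ∞ l)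
    (hRic : ∀ (x : M) (v : TangentSpace (𝓡 m) x), v ≠ 0 → RiemGeom.ricci gM x v v < 0) :
    (RiemGeom.IsBiharmonic (RiemGeom.warpedMetric gM gN l hl) gM (Prod.fst : M × N → M) ↔
      RiemGeom.IsHarmonic (RiemGeom.warpedMetric gM gN l hl) gM (Prod.fst : M × N → M)) ∧
    (PreconnectedSpace M →
      (RiemGeom.IsHarmonic (RiemGeom.warpedMetric gM gN l hl) gM (Prod.fst : M × N → M) ↔
        ∃ c : ℝ, ∀ x, l x = c)) := by
  have : SecondCountableTopology M :=
    ChartedSpace.secondCountable_of_sigmaCompact (EuclideanSpace ℝ (Fin m)) M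
  have : BorelSpace (M × N) := Prod.borelSpace
  have : Nonempty (Fin n) := ⟨⟨0, hn⟩⟩
  have : Nontrivial (EuclideanSpace ℝ (Fin n)) := inferInstance
  exact ⟨⟨fun h => h.isHarmonic_fst_of_ricci_neg hRic, fun h => h.isBiharmonic⟩,
    fun _ => RiemGeom.isHarmonic_fst_warpedMetric_iff⟩
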